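/- **Theorem 2.** For $d,k\in\mathbb N$, a $(d,k)$-tree-model of a graph $G$ consists of a rooted tree $T$ of depth $d$ (the largest number of edges on a path from the root to a leaf) whose leaves are identified with the vertices of $G$, a symmetric Boolean $k\times k$ matrix $M_a$ for every node $a$ of $T$, a labelling $\lambda\colon V(G)\to[k]$, and a renaming function $\rho_{ab}\colon[k]\to[k]$ for every edge of $T$ between a node $a$ and a child $b$ of $a$, with the following property. For a node $a$ let $V_a$ be the set of the leaves that are descendants of $a$, and define $\lambda_a\colon V_a\to[k]$ by $\lambda_v(v)=\lambda(v)$ for a leaf $v$, and by $\lambda_a(v)=\rho_{ab}(\lambda_b(v))$ for a child $b$ of $a$ and $v\in V_b$. Then any two distinct vertices $u,v$ with least common ancestor $a$ are adjacent in $G$ if and only if $M_a[\lambda_a(u),\lambda_a(v)]=1$. The model of computation is the RAM with read-only random access to its input. The cost of an operation is polynomial in the number of bits of its operands, and space is the number of bits of working memory in use, the input not counted. There are a RAM program and an absolute constant $c$ such that, for all $n,d,k$, the program, given an $n$-vertex graph $G$ together with a $(d,k)$-tree-model of $G$, computes $$\max_{X\subseteq V(G)}|E(X,V(G)\setminus X)|$$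 (that is, it solves Max Cut on $G$), and, if $n\ge 2$, it runs in time at most $n^{c\,dk}$ and uses at most $c\,dk\log_2 n$ bits of space; in short, time $n^{O(dk)}$ and space $O(dk\log n)$. -/

import Mathlib

/-! ### Tree-models

A rooted tree is ordered by ancestorship: the root is `⊥`, the parent of a node `b ≠ ⊥` is
`Order.pred b`, the least common ancestor of `a` and `b` is `a ⊓ b`, and the leaves are the maximal
elements. -/

/-- The data `(T, M, R, lab)` of a tree-model with vertex set `V` and label set `Fin k`. The leaves
of the tree are identified with the vertices by `leaf`. The renaming function of the edge between
a node `b ≠ ⊥` and its parent is `rename b` (`rename ⊥` is never used). -/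
structure LabelledTree (V : Type*) (k : ℕ) (T : RootedTree) where
  leaf : V ≃ {a : T // IsMax a}
  label : V → Fin k
  rename : T → Fin k → Fin k
  mat : T → Matrix (Fin k) (Fin k) Bool
  mat_symm : ∀ a, (mat a).IsSymm

namespace LabelledTree

variable {V : Type*} {k : ℕ} {T : RootedTree} (L : LabelledTree V k T)

/-- The label of `v` after `m` steps from its leaf towards the root. -/
def labelUp (v : V) : ℕ → Fin k
  | 0 => L.label v
  | m + 1 => L.rename (Order.pred^[m] (L.leaf v)) (labelUp v m)

/-- The distance in the tree from the leaf `v` to its ancestor `a`. -/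
noncomputable def dist (v : V) (a : T) : ℕ := sInf {m : ℕ | Order.pred^[m] (L.leaf v : T) = a}

/-- The label `lab_a(v)` of the vertex `v` at the node `a`; meaningful when `v` is a descendant of
`a`. It satisfies the recursion in the two lemmas that follow. -/
noncomputable def labelAt (a : T) (v : V) : Fin k := L.labelUp v (L.dist v a)

/-- At its own leaf a vertex has its initial label. -/
theorem labelAt_leaf (v : V) : L.labelAt (L.leaf v) v = L.label v := by
  have h : L.dist v (L.leaf v) = 0 := Nat.sInf_eq_zero.2 (Or.inl rfl)
  simp [labelAt, h, labelUp]

/-- At the parent of a node `b`, a vertex below `b` has the renamed label. -/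
theorem labelAt_parent {b : T} (hb : b ≠ ⊥) (v : V) (hv : b ≤ L.leaf v) :
    L.labelAt (Order.pred b) v = L.rename b (L.labelAt b v) := by
  have hmem : Order.pred^[L.dist v b] (L.leaf v : T) = b := Nat.sInf_mem hv.exists_pred_iterate
  have hlt : Order.pred b < b := Order.pred_lt_of_not_isMin (fun h => hb h.eq_bot)
  have hd : L.dist v (Order.pred b) = L.dist v b + 1 := by
    have h1 : Order.pred^[L.dist v b + 1] (L.leaf v : T) = Order.pred b := by
      rw [Function.iterate_succ_apply', hmem]
    apply le_antisymm (Nat.sInf_le h1)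
    by_contra hlt'
    change ¬ L.dist v b + 1 ≤ L.dist v (Order.pred b) at hlt'
    have hm' : Order.pred^[L.dist v (Order.pred b)] (L.leaf v : T) = Order.pred b :=
      Nat.sInf_mem (s := {m : ℕ | Order.pred^[m] (L.leaf v : T) = Order.pred b}) ⟨_, h1⟩
    generalize L.dist v (Order.pred b) = m at hlt' hm'
    obtain ⟨e, he⟩ := Nat.exists_eq_add_of_le (show m ≤ L.dist v b by omega)
    rw [he, Nat.add_comm m e, Function.iterate_add_apply, hm'] at hmem
    have := Order.pred_iterate_le e (Order.pred b)
    rw [hmem] at this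
    exact absurd hlt this.not_gt
  simp only [labelAt, hd, labelUp, hmem]

end LabelledTree

/-- A `(d,k)`-tree-model of the graph `G` with the tree `T`. The depth of `T`, which is the largest
number of edges on a path from a node up to the root, is `d`. -/
structure TreeModel {V : Type*} (G : SimpleGraph V) (d k : ℕ) (T : RootedTree) extends
    LabelledTree V k T where
  depth : IsLeast {m : ℕ | ∀ a : T, Order.pred^[m] a = ⊥} d
  adj_iff : ∀ u v : V, u ≠ v →
    (G.Adj u v ↔
      mat ((leaf u : T) ⊓ leaf v) (toLabelledTree.labelAt ((leaf u : T) ⊓ leaf v) u)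
        (toLabelledTree.labelAt ((leaf u : T) ⊓ leaf v) v) = true)

/-! ### Max Cut -/

open Classical in
/-- The largest number of edges between `X` and its complement, over all vertex sets `X`. -/
noncomputable def maxCut {V : Type*} [Fintype V] (G : SimpleGraph V) : ℕ :=
  Finset.univ.sup fun X : Finset V => (G.interedges X Xᶜ).card

/-! ### Random access machines

Registers are indexed by natural numbers and hold natural numbers. The input is a sequence of
natural numbers with random access that can only be read. -/

namespace RAM

/-- The arithmetic operations (truncated subtraction; division rounds down). -/
inductive Op
  | add
  | sub
  | mul
  | div
  | mod

/-- The value of an arithmetic operation. -/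
def Op.eval : Op → ℕ → ℕ → ℕ
  | .add, x, y => x + y
  | .sub, x, y => x - y
  | .mul, x, y => x * y
  | .div, x, y => x / y
  | .mod, x, y => x % y

/-- The instructions; the comments write `r i` for the content of register `i`. -/
inductive Instr
  /-- `r dst := c` -/
  | const (dst c : ℕ)
  /-- `r dst := r a op r b` -/
  | arith (op : Op) (dst a b : ℕ)
  /-- `r dst := r (r a)` -/
  | load (dst a : ℕ)
  /-- `r (r a) := r b` -/
  | store (a b : ℕ)
  /-- `r dst :=` entry number `r a` of the input (`0` beyond its end) -/
  | input (dst a : ℕ)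
  /-- go to instruction number `l` -/
  | jump (l : ℕ)
  /-- go to instruction number `l` if `r a = 0` -/
  | jumpZero (a l : ℕ)

/-- A program is a finite list of instructions; it halts when the program counter leaves it. -/
abbrev Program := List Instr

/-- A configuration: the program counter and the contents of the registers, of which all but
finitely many are zero. -/
structure Config where
  pc : ℕ
  reg : ℕ →₀ ℕ

/-- The initial configuration. -/
noncomputable def Config.init : Config := ⟨0, 0⟩

/-- The number of bits of working memory in use: each nonzero register counts with the number of
bits of its address and the number of bits of its content. -/
noncomputable def Config.bits (c : Config) : ℕ := c.reg.sum fun i x => i.size + x.size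

/-- The effect of an instruction on a configuration, for the input `x`. -/
noncomputable def Instr.exec (x : List ℕ) (c : Config) : Instr → Config
  | .const dst v => ⟨c.pc + 1, c.reg.update dst v⟩
  | .arith op dst a b => ⟨c.pc + 1, c.reg.update dst (op.eval (c.reg a) (c.reg b))⟩
  | .load dst a => ⟨c.pc + 1, c.reg.update dst (c.reg (c.reg a))⟩
  | .store a b => ⟨c.pc + 1, c.reg.update (c.reg a) (c.reg b)⟩
  | .input dst a => ⟨c.pc + 1, c.reg.update dst (x.getD (c.reg a) 0)⟩
  | .jump l => ⟨l, c.reg⟩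
  | .jumpZero a l => ⟨if c.reg a = 0 then l else c.pc + 1, c.reg⟩

/-- The number of bits of the operands of an instruction. -/
def Instr.operandBits (x : List ℕ) (c : Config) : Instr → ℕ
  | .const _ v => v.size
  | .arith _ _ a b => (c.reg a).size + (c.reg b).size
  | .load _ a => (c.reg a).size + (c.reg (c.reg a)).size
  | .store a b => (c.reg a).size + (c.reg b).size
  | .input _ a => (c.reg a).size + (x.getD (c.reg a) 0).size
  | .jump _ => 0
  | .jumpZero a _ => (c.reg a).size

/-- The time charged for an instruction: quadratic in the number of bits of its operands. -/
def Instr.cost (x : List ℕ) (c : Config) (i : Instr) : ℕ := (1 + i.operandBits x c) ^ 2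

namespace Program

variable (P : Program) (x : List ℕ)

/-- One step of the program; nothing happens once it has halted. -/
noncomputable def step (c : Config) : Config :=
  match P[c.pc]? with
  | none => c
  | some i => i.exec x c

/-- The time of the next step. -/
def stepCost (c : Config) : ℕ :=
  match P[c.pc]? with
  | none => 0
  | some i => i.cost x c

/-- The configuration after `t` steps on the input `x`. -/
noncomputable def run (t : ℕ) : Config := (P.step x)^[t] Config.init

/-- On the input `x` the program has halted after `t` steps, with the number `y` in register `0`
as its output. -/
def HaltsWith (t y : ℕ) : Prop := P.length ≤ (P.run x t).pc ∧ (P.run x t).reg 0 = y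

/-- The total time of the first `t` steps on the input `x`. -/
noncomputable def time (t : ℕ) : ℕ := ∑ j ∈ Finset.range t, P.stepCost x (P.run x j)

/-- The largest number of bits of working memory in use during the first `t` steps on the
input `x`. -/
noncomputable def space (t : ℕ) : ℕ :=
  (Finset.range (t + 1)).sup fun j => (P.run x j).bits

end Program

end RAM

/-! ### The input -/

open Classical in
/-- The entries of the adjacency matrix of a graph, row by row. -/
noncomputable def encodeGraph {n : ℕ} (G : SimpleGraph (Fin n)) : List ℕ :=
  (List.ofFn fun u : Fin n => List.ofFn fun v : Fin n => if G.Adj u v then 1 else 0).flatten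

/-- A graph together with a tree-model of it as the input of a machine, where the nodes are
numbered by `e`: the numbers of vertices, labels and nodes, the depth and the root, then the
adjacency matrix, the parents of the nodes (the root is listed as its own parent), the leaves and
the labels of the vertices, the renaming functions, and the matrices. -/
noncomputable def TreeModel.encode {n d k N : ℕ} {G : SimpleGraph (Fin n)} {T : RootedTree}
    (M : TreeModel G d k T) (e : T ≃ Fin N) : List ℕ :=
  [n, k, N, d, (e ⊥ : ℕ)] ++ encodeGraph G ++
    List.ofFn (fun a : Fin N => (e (Order.pred (e.symm a)) : ℕ)) ++
    List.ofFn (fun v : Fin n => (e (M.leaf v) : ℕ)) ++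
    List.ofFn (fun v : Fin n => (M.label v : ℕ)) ++
    (List.ofFn fun a : Fin N => List.ofFn fun i : Fin k => (M.rename (e.symm a) i : ℕ)).flatten ++
    (List.ofFn fun a : Fin N =>
      (List.ofFn fun i : Fin k =>
        List.ofFn fun j : Fin k => (M.mat (e.symm a) i j).toNat).flatten).flatten

/-! ### A structured language and its compilation -/

namespace RAM

/-! For a prime `p`, the sum of `y ^ cutSize G X` over all vertex sets `X` is evaluated in `ZMod p`
by recursion along the tree. A two-colouring of the vertices below a node matters only through its
profile, the number of vertices of each colour and label. A pair of vertices of different colours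
should contribute the matrix entry at its least common ancestor. Instead, every common ancestor
contributes its own entry minus the entry that its parent would give (`LabelledTree.excess`). These
differences telescope (`prod_excess`), so the weight of a node depends on its profile alone
(`nodeWeight_eq`), and it never matters from which children the two vertices come.

A table indexed by profiles is too large to be stored. The generating function `gen` is therefore
only ever evaluated at points `w`. At a point, the values of the children simply multiply
(`prod_gen_children`), and the part with profile `s` is recovered by summing over all `w` against `w
^ (p - 1 - s)`, by orthogonality of powers in `ZMod p` (`ZMod.sum_prod_pow_sub_add`). The result is
`gen_eq`: a sum over guesses `(s, w)` of an explicit weight times the product of the children's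
values at `w`. A depth-first evaluation stores one guess and two residues per level, which is `O(k
log n)` bits for each of at most `d` levels.

At the root, interpolation in `y` yields, modulo `p`, the number of sets with a cut of size `v`
(`sum_gen_bot`). If such a set exists, this number lies between `1` and `2 ^ n`, so by Chebyshev's
estimate some prime between `n * n + 1` and `2 * (n + 2) ^ 4` does not divide it
(`Nat.exists_prime_not_dvd_of_le_two_pow`). The largest size detected modulo any of these primes is
the maximum cut (`sup_detected`).

For the machine, a structured language is compiled to programs with a fixed number of registers, and
its semantics carries a bound `B` on all values that occur. The space is then `O(log B)`. A halting
run never repeats a configuration, so its time is polynomial in `B` and no steps have to be counted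
(`Cmd.exists_program`). What remains is to keep all values below `valueBound n d k`. -/

/-- Arithmetic expressions over variables `ι` with access to the input. -/
inductive Expr (ι : Type)
  | lit (c : ℕ)
  | var (r : ι)
  | op (o : Op) (a b : Expr ι)
  | inp (a : Expr ι)

namespace Expr

variable {ι : Type}

def eval (x : List ℕ) (s : ι → ℕ) : Expr ι → ℕ
  | lit c => c
  | var r => s r
  | op o a b => o.eval (a.eval x s) (b.eval x s)
  | inp a => x.getD (a.eval x s) 0

/-- All the values that occur in the evaluation of an expression are less than `B`. -/
def Bdd (x : List ℕ) (B : ℕ) (s : ι → ℕ) : Expr ι → Prop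
  | lit c => c < B
  | var r => s r < B
  | op o a b => a.Bdd x B s ∧ b.Bdd x B s ∧ o.eval (a.eval x s) (b.eval x s) < B
  | inp a => a.Bdd x B s ∧ x.getD (a.eval x s) 0 < B

/-- The number of temporary registers that the evaluation needs. -/
def width : Expr ι → ℕ
  | lit _ => 1
  | var _ => 1
  | op _ a b => max a.width (b.width + 1)
  | inp a => a.width

/-- Code that leaves the value of an expression in register `j`, using registers from `j` on. -/
def code (idx : ι → ℕ) : Expr ι → ℕ → Program
  | lit c, j => [.const j c]
  | var r, j => [.const j 0, .arith .add j (idx r) j]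
  | op o a b, j => a.code idx j ++ (b.code idx (j + 1) ++ [.arith o j j (j + 1)])
  | inp a, j => a.code idx j ++ [.input j j]

theorem width_pos (e : Expr ι) : 0 < e.width := by
  induction e <;> simp_all [width]

theorem eval_lt {x : List ℕ} {B : ℕ} {s : ι → ℕ} : ∀ {e : Expr ι}, e.Bdd x B s → e.eval x s < B
  | lit _, h => h
  | var _, h => h
  | op _ _ _, h => h.2.2
  | inp _, h => h.2

end Expr

/-- Structured programs. -/
inductive Cmd (ι : Type)
  | skip
  | assign (r : ι) (e : Expr ι)
  | seq (c₁ c₂ : Cmd ι)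
  | ifz (e : Expr ι) (c₁ c₂ : Cmd ι)
  | loop (e : Expr ι) (c : Cmd ι)

namespace Cmd

variable {ι : Type}

def width : Cmd ι → ℕ
  | skip => 0
  | assign _ e => e.width
  | seq c₁ c₂ => max c₁.width c₂.width
  | ifz e c₁ c₂ => max e.width (max c₁.width c₂.width)
  | loop e c => max e.width c.width

/-- The code of a structured program to be placed at position `off`; the variables live in registers
below `m` and the temporary values in the registers from `m` on. -/
def code (idx : ι → ℕ) (m : ℕ) : Cmd ι → ℕ → Program
  | skip, _ => []
  | assign r e, _ => e.code idx m ++ [.const (m + 1) 0, .arith .add (idx r) m (m + 1)]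
  | seq c₁ c₂, off => c₁.code idx m off ++ c₂.code idx m (off + (c₁.code idx m off).length)
  | ifz e c₁ c₂, off =>
    let o₂ := off + (e.code idx m).length + 1
    let l₂ := c₂.code idx m o₂
    let o₁ := o₂ + l₂.length + 1
    let l₁ := c₁.code idx m o₁
    e.code idx m ++ (.jumpZero m o₁ :: (l₂ ++ (.jump (o₁ + l₁.length) :: l₁)))
  | loop e c, off =>
    let o := off + (e.code idx m).length + 1
    let l := c.code idx m o
    e.code idx m ++ (.jumpZero m (o + l.length + 1) :: (l ++ [.jump off]))

/-- Big-step semantics in which all values that occur are less than `B`. -/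
inductive Exec [DecidableEq ι] (x : List ℕ) (B : ℕ) : Cmd ι → (ι → ℕ) → (ι → ℕ) → Prop
  | skip (s) : Exec x B skip s s
  | assign (r e s) : e.Bdd x B s → Exec x B (assign r e) s (Function.update s r (e.eval x s))
  | seq {c₁ c₂ s s₁ s₂} : Exec x B c₁ s s₁ → Exec x B c₂ s₁ s₂ → Exec x B (seq c₁ c₂) s s₂
  | ifz_zero {e c₁ c₂ s s'} : e.Bdd x B s → e.eval x s = 0 → Exec x B c₁ s s' →
      Exec x B (ifz e c₁ c₂) s s'
  | ifz_ne {e c₁ c₂ s s'} : e.Bdd x B s → e.eval x s ≠ 0 → Exec x B c₂ s s' →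
      Exec x B (ifz e c₁ c₂) s s'
  | loop_zero {e c s} : e.Bdd x B s → e.eval x s = 0 → Exec x B (loop e c) s s
  | loop_ne {e c s s₁ s₂} : e.Bdd x B s → e.eval x s ≠ 0 → Exec x B c s s₁ →
      Exec x B (loop e c) s₁ s₂ → Exec x B (loop e c) s s₂

end Cmd

/-! #### Correctness of the compilation -/

/-- All registers are less than `B`, and those from `R` on are zero. -/
def Config.Good (B R : ℕ) (c : Config) : Prop := ∀ j, c.reg j < B ∧ (R ≤ j → c.reg j = 0)

/-- `c'` is reached from `c` through good configurations. -/
def Program.Reach (P : Program) (x : List ℕ) (B R : ℕ) : Config → Config → Prop :=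
  Relation.ReflTransGen fun c c' => P.step x c = c' ∧ c'.Good B R

/-- The instructions `l` stand at position `off` of the program. -/
def Program.At (P : Program) (off : ℕ) (l : Program) : Prop := l <+: P.drop off

namespace Program

variable {P : Program} {x : List ℕ} {B R : ℕ}

theorem At.append {off : ℕ} {l₁ l₂ : Program} (h : P.At off (l₁ ++ l₂)) :
    P.At off l₁ ∧ P.At (off + l₁.length) l₂ := by
  obtain ⟨t, ht⟩ := h
  refine ⟨⟨l₂ ++ t, by simpa using ht⟩, ⟨t, ?_⟩⟩
  rw [← List.drop_drop, ← ht]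
  simp

theorem At.cons {off : ℕ} {i : Instr} {l : Program} (h : P.At off (i :: l)) :
    P[off]? = some i ∧ P.At (off + 1) l := by
  obtain ⟨t, ht⟩ := h
  refine ⟨?_, ⟨t, ?_⟩⟩
  · have : (P.drop off)[0]? = some i := by rw [← ht]; simp
    simpa using this
  · rw [← List.drop_drop, ← ht]
    simp

theorem Reach.trans {c₁ c₂ c₃ : Config} (h₁ : P.Reach x B R c₁ c₂) (h₂ : P.Reach x B R c₂ c₃) :
    P.Reach x B R c₁ c₃ := Relation.ReflTransGen.trans h₁ h₂

theorem Reach.instr {off : ℕ} {i : Instr} {r : ℕ →₀ ℕ} (h : P[off]? = some i)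
    (hg : (i.exec x ⟨off, r⟩).Good B R) : P.Reach x B R ⟨off, r⟩ (i.exec x ⟨off, r⟩) := by
  apply Relation.ReflTransGen.single
  refine ⟨?_, hg⟩
  simp [step, h]

theorem Reach.iterate {c c' : Config} (h : P.Reach x B R c c') (hc : c.Good B R) :
    ∃ t, (P.step x)^[t] c = c' ∧ ∀ j ≤ t, ((P.step x)^[j] c).Good B R := by
  induction h with
  | refl => exact ⟨0, rfl, fun j hj => by simpa [Nat.le_zero.1 hj] using hc⟩
  | tail _ hs ih =>
    obtain ⟨t, ht, hj⟩ := ih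
    refine ⟨t + 1, by rw [Function.iterate_succ_apply', ht, hs.1], fun j hjt => ?_⟩
    rcases Nat.lt_or_ge j (t + 1) with h1 | h1
    · exact hj j (by omega)
    · obtain rfl : j = t + 1 := by omega
      rw [Function.iterate_succ_apply', ht, hs.1]
      exact hs.2

end Program

theorem Config.Good.update {B R off off' j v : ℕ} {r : ℕ →₀ ℕ}
    (h : Config.Good B R ⟨off, r⟩) (hv : v < B) (hj : j < R) :
    Config.Good B R ⟨off', r.update j v⟩ := by
  intro i
  simp only [Finsupp.coe_update, Function.update_apply]
  split_ifs with hi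
  · exact ⟨hv, fun h => absurd h (by omega)⟩
  · exact h i

theorem Config.Good.pc {B R off off' : ℕ} {r : ℕ →₀ ℕ}
    (h : Config.Good B R ⟨off, r⟩) : Config.Good B R ⟨off', r⟩ := h

section Compile

variable {ι : Type} {idx : ι → ℕ} {m : ℕ} {P : Program} {x : List ℕ} {B R : ℕ}

/-- The clause that registers below `j` keep their contents carries the induction: it protects the
left operand, held in `j`, while the right one is evaluated from `j + 1` on, and it protects the
variables, which lie below `m`. -/
theorem Expr.reach (hm : ∀ i, idx i < m) (s : ι → ℕ) (e : Expr ι) :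
    ∀ (j off : ℕ) (r : ℕ →₀ ℕ), (∀ i, r (idx i) = s i) → Config.Good B R ⟨off, r⟩ → m ≤ j →
      j + e.width ≤ R → e.Bdd x B s → P.At off (e.code idx j) →
      ∃ r' : ℕ →₀ ℕ, P.Reach x B R ⟨off, r⟩ ⟨off + (e.code idx j).length, r'⟩ ∧
        r' j = e.eval x s ∧ (∀ i < j, r' i = r i) ∧
        Config.Good B R ⟨off + (e.code idx j).length, r'⟩ := by
  induction e with
  | lit c =>
    intro j off r _ hg _ hw hb hP
    have hg' : Config.Good B R ⟨off + 1, r.update j c⟩ := hg.update hb (by simp [width] at hw; omega)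
    exact ⟨_, Program.Reach.instr (i := .const j c) hP.cons.1 hg', by simp [eval],
      fun i hi => by simp [hi.ne], hg'⟩
  | var q =>
    intro j off r hr hg hmj hw hb hP
    have hj : j < R := by simp [width] at hw; omega
    have hg₁ : Config.Good B R ⟨off + 1, r.update j 0⟩ := hg.update (by simp [Bdd] at hb; omega) hj
    -- Copying is done by adding to a cleared register; clearing `j` spares the variable because
    -- `idx q < m ≤ j`.
    have hq : (r.update j 0) (idx q) + (r.update j 0) j = s q := by
      have := hm q
      simp [hr, show idx q ≠ j by omega]
    have hg₂ : Config.Good B R ⟨off + 1 + 1, (r.update j 0).update j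
        ((r.update j 0) (idx q) + (r.update j 0) j)⟩ := hg₁.update (by rw [hq]; exact hb) hj
    refine ⟨_, (Program.Reach.instr (i := .const j 0) hP.cons.1 hg₁).trans
      (Program.Reach.instr (i := .arith .add j (idx q) j) hP.cons.2.cons.1 hg₂), ?_, ?_, hg₂⟩
    · simpa [eval, Op.eval] using hq
    · intro i hi
      simp [hi.ne]
  | op o a b iha ihb =>
    intro j off r hr hg hmj hw hb hP
    simp only [width] at hw
    have hbw := b.width_pos
    obtain ⟨r₁, h₁, hv₁, hk₁, hg₁⟩ := iha j off r hr hg hmj (by omega) hb.1 hP.append.1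
    obtain ⟨r₂, h₂, hv₂, hk₂, hg₂⟩ := ihb (j + 1) _ r₁
      (fun i => by rw [hk₁ _ (by have := hm i; omega), hr]) hg₁ (by omega) (by omega) hb.2.1
      hP.append.2.append.1
    have hv : o.eval (r₂ j) (r₂ (j + 1)) = o.eval (a.eval x s) (b.eval x s) := by
      rw [hk₂ j (by omega), hv₁, hv₂]
    have hg₃ : Config.Good B R ⟨off + (a.code idx j).length + (b.code idx (j + 1)).length + 1,
        r₂.update j (o.eval (r₂ j) (r₂ (j + 1)))⟩ := hg₂.update (by rw [hv]; exact hb.2.2) (by omega)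
    have h₃ := Program.Reach.instr (x := x) (i := .arith o j j (j + 1))
      hP.append.2.append.2.cons.1 hg₃
    have hlen : off + ((Expr.op o a b).code idx j).length =
        off + (a.code idx j).length + (b.code idx (j + 1)).length + 1 := by
      simp [code]; omega
    refine ⟨r₂.update j (o.eval (r₂ j) (r₂ (j + 1))), ?_, ?_, ?_, ?_⟩
    · rw [hlen]; exact (h₁.trans h₂).trans h₃
    · simpa [eval] using hv
    · intro i hi
      simp [hi.ne, hk₂ i (by omega), hk₁ i hi]
    · rw [hlen]; exact hg₃
  | inp a iha =>
    intro j off r hr hg hmj hw hb hP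
    simp only [width] at hw
    have haw := a.width_pos
    obtain ⟨r₁, h₁, hv₁, hk₁, hg₁⟩ := iha j off r hr hg hmj (by omega) hb.1 hP.append.1
    have hv : x.getD (r₁ j) 0 = x.getD (a.eval x s) 0 := by rw [hv₁]
    have hg₃ : Config.Good B R ⟨off + (a.code idx j).length + 1, r₁.update j (x.getD (r₁ j) 0)⟩ :=
      hg₁.update (by rw [hv]; exact hb.2) (by omega)
    have h₃ := Program.Reach.instr (x := x) (i := .input j j) hP.append.2.cons.1 hg₃
    have hlen : off + ((Expr.inp a).code idx j).length = off + (a.code idx j).length + 1 := by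
      simp [code]; omega
    refine ⟨r₁.update j (x.getD (r₁ j) 0), ?_, ?_, ?_, ?_⟩
    · rw [hlen]; exact h₁.trans h₃
    · simpa [eval] using hv
    · intro i hi
      simp [hi.ne, hk₁ i hi]
    · rw [hlen]; exact hg₃

/-- The induction is on the derivation, since a loop unfolds to itself. Temporaries carry no
information from one command to the next, so only the variables are tracked. The hypothesis `m + 1 <
R` is separate from the width because every assignment uses `m + 1` as a zero for copying. -/
theorem Cmd.Exec.reach [DecidableEq ι] (hinj : Function.Injective idx) (hm : ∀ i, idx i < m)
    (hmR : m + 1 < R) {c : Cmd ι} {s s' : ι → ℕ} (h : Cmd.Exec x B c s s') :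
    ∀ (off : ℕ) (r : ℕ →₀ ℕ), (∀ i, r (idx i) = s i) → Config.Good B R ⟨off, r⟩ →
      m + c.width ≤ R → P.At off (c.code idx m off) →
      ∃ r' : ℕ →₀ ℕ, P.Reach x B R ⟨off, r⟩ ⟨off + (c.code idx m off).length, r'⟩ ∧
        (∀ i, r' (idx i) = s' i) ∧ Config.Good B R ⟨off + (c.code idx m off).length, r'⟩ := by
  induction h with
  | skip s =>
    intro off r hr hg _ _
    exact ⟨r, Relation.ReflTransGen.refl, hr, hg⟩
  | assign q e s hb =>
    intro off r hr hg hw hP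
    obtain ⟨r₁, h₁, hv₁, hk₁, hg₁⟩ := Expr.reach hm s e m off r hr hg le_rfl hw hb hP.append.1
    have hlt := Expr.eval_lt hb
    have hg₂ : Config.Good B R ⟨off + (e.code idx m).length + 1, r₁.update (m + 1) 0⟩ :=
      hg₁.update (by omega) hmR
    have hv : (r₁.update (m + 1) 0) m + (r₁.update (m + 1) 0) (m + 1) = e.eval x s := by
      simp [hv₁]
    have hg₃ : Config.Good B R ⟨off + (e.code idx m).length + 1 + 1,
        (r₁.update (m + 1) 0).update (idx q)
          ((r₁.update (m + 1) 0) m + (r₁.update (m + 1) 0) (m + 1))⟩ :=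
      hg₂.update (by rw [hv]; exact hlt) (by have := hm q; omega)
    have hlen : off + ((Cmd.assign q e).code idx m off).length =
        off + (e.code idx m).length + 1 + 1 := by simp [code]; omega
    rw [hlen]
    refine ⟨_, (h₁.trans (Program.Reach.instr (i := .const (m + 1) 0) hP.append.2.cons.1 hg₂)).trans
      (Program.Reach.instr (i := .arith .add (idx q) m (m + 1)) hP.append.2.cons.2.cons.1 hg₃),
      fun i => ?_, hg₃⟩
    change ((r₁.update (m + 1) 0).update (idx q)
      ((r₁.update (m + 1) 0) m + (r₁.update (m + 1) 0) (m + 1))) (idx i) = _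
    have h1 := hm i
    rw [hv]
    by_cases hi : i = q
    · simp [hi]
    · simp [hi, hinj.ne hi, show idx i ≠ m + 1 by omega, hk₁ _ (hm i), hr]
  | seq _ _ ih₁ ih₂ =>
    intro off r hr hg hw hP
    simp only [width] at hw
    obtain ⟨r₁, h₁, hr₁, hg₁⟩ := ih₁ off r hr hg (by omega) hP.append.1
    obtain ⟨r₂, h₂, hr₂, hg₂⟩ := ih₂ _ r₁ hr₁ hg₁ (by omega) hP.append.2
    refine ⟨r₂, ?_, hr₂, ?_⟩
    · simp only [code, List.length_append, ← add_assoc]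
      exact h₁.trans h₂
    · simp only [code, List.length_append, ← add_assoc]
      exact hg₂
  | @ifz_zero e c₁ c₂ s s' hb he _ ih =>
    intro off r hr hg hw hP
    simp only [width] at hw
    simp only [code] at hP
    obtain ⟨r₁, h₁, hv₁, hk₁, hg₁⟩ := Expr.reach hm s e m off r hr hg le_rfl (by omega) hb
      hP.append.1
    have hr₁ : ∀ i, r₁ (idx i) = s i := fun i => by rw [hk₁ _ (hm i), hr]
    have hP' := hP.append.2.cons
    have h₂ := Program.Reach.instr (x := x) (B := B) (R := R) (r := r₁) hP'.1
      (hg₁.pc (off' := _))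
    simp only [Instr.exec, hv₁, he, if_true] at h₂
    have hP₁ := hP'.2.append.2.cons.2
    obtain ⟨r₂, h₃, hr₂, hg₂⟩ := ih _ r₁ hr₁ (hg₁.pc (off' := _)) (by omega) hP₁
    have hlen : off + ((Cmd.ifz e c₁ c₂).code idx m off).length = _ + List.length _ :=
      (show _ = off + (e.code idx m).length + 1 +
        (c₂.code idx m (off + (e.code idx m).length + 1)).length + 1 +
        (c₁.code idx m (off + (e.code idx m).length + 1 +
        (c₂.code idx m (off + (e.code idx m).length + 1)).length + 1)).length by simp [code]; omega)
    rw [hlen]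
    exact ⟨r₂, (h₁.trans h₂).trans h₃, hr₂, hg₂⟩
  | @ifz_ne e c₁ c₂ s s' hb he _ ih =>
    intro off r hr hg hw hP
    simp only [width] at hw
    simp only [code] at hP
    obtain ⟨r₁, h₁, hv₁, hk₁, hg₁⟩ := Expr.reach hm s e m off r hr hg le_rfl (by omega) hb
      hP.append.1
    have hr₁ : ∀ i, r₁ (idx i) = s i := fun i => by rw [hk₁ _ (hm i), hr]
    have hP' := hP.append.2.cons
    have h₂ := Program.Reach.instr (x := x) (B := B) (R := R) (r := r₁) hP'.1
      (hg₁.pc (off' := _))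
    simp only [Instr.exec, hv₁, he, if_false] at h₂
    obtain ⟨r₂, h₃, hr₂, hg₂⟩ := ih _ r₁ hr₁ (hg₁.pc (off' := _)) (by omega) hP'.2.append.1
    have h₄ := Program.Reach.instr (x := x) (B := B) (R := R) (r := r₂) hP'.2.append.2.cons.1
      (hg₂.pc (off' := _))
    simp only [Instr.exec] at h₄
    have hlen : off + ((Cmd.ifz e c₁ c₂).code idx m off).length = _ + List.length _ :=
      (show _ = off + (e.code idx m).length + 1 +
        (c₂.code idx m (off + (e.code idx m).length + 1)).length + 1 +
        (c₁.code idx m (off + (e.code idx m).length + 1 +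
        (c₂.code idx m (off + (e.code idx m).length + 1)).length + 1)).length by simp [code]; omega)
    rw [hlen]
    exact ⟨r₂, ((h₁.trans h₂).trans h₃).trans h₄, hr₂, hg₂.pc⟩
  | @loop_zero e c s hb he =>
    intro off r hr hg hw hP
    simp only [width] at hw
    simp only [code] at hP
    obtain ⟨r₁, h₁, hv₁, hk₁, hg₁⟩ := Expr.reach hm s e m off r hr hg le_rfl (by omega) hb
      hP.append.1
    have hr₁ : ∀ i, r₁ (idx i) = s i := fun i => by rw [hk₁ _ (hm i), hr]
    have h₂ := Program.Reach.instr (x := x) (B := B) (R := R) (r := r₁) hP.append.2.cons.1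
      (hg₁.pc (off' := _))
    simp only [Instr.exec, hv₁, he, if_true] at h₂
    have hlen : off + ((Cmd.loop e c).code idx m off).length = off + (e.code idx m).length + 1 +
        (c.code idx m (off + (e.code idx m).length + 1)).length + 1 := by simp [code]; omega
    rw [hlen]
    exact ⟨r₁, h₁.trans h₂, hr₁, hg₁.pc⟩
  | @loop_ne e c s s₁ s₂ hb he _ _ ih ih' =>
    intro off r hr hg hw hP
    have hw' := hw
    have hP₀ := hP
    simp only [width] at hw
    simp only [code] at hP
    obtain ⟨r₁, h₁, hv₁, hk₁, hg₁⟩ := Expr.reach hm s e m off r hr hg le_rfl (by omega) hb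
      hP.append.1
    have hr₁ : ∀ i, r₁ (idx i) = s i := fun i => by rw [hk₁ _ (hm i), hr]
    have h₂ := Program.Reach.instr (x := x) (B := B) (R := R) (r := r₁) hP.append.2.cons.1
      (hg₁.pc (off' := _))
    simp only [Instr.exec, hv₁, he, if_false] at h₂
    have hP' := hP.append.2.cons.2
    obtain ⟨r₂, h₃, hr₂, hg₂⟩ := ih _ r₁ hr₁ (hg₁.pc (off' := _)) (by omega) hP'.append.1
    have h₄ := Program.Reach.instr (x := x) (B := B) (R := R) (r := r₂) hP'.append.2.cons.1
      (hg₂.pc (off' := _))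
    simp only [Instr.exec] at h₄
    -- The jump back leads to `off`, where the same code stands, so the hypothesis for the remaining
    -- rounds applies to it unchanged.
    obtain ⟨r₃, h₅, hr₃, hg₃⟩ := ih' off r₂ hr₂ hg₂.pc hw' hP₀
    exact ⟨r₃, (((h₁.trans h₂).trans h₃).trans h₄).trans h₅, hr₃, hg₃⟩

end Compile

/-! #### Time and space of compiled programs -/

theorem Config.Good.bits_le {B R : ℕ} {c : Config} (h : c.Good B R) :
    c.bits ≤ R * (R.size + B.size) := by
  have hsub : c.reg.support ⊆ Finset.range R := fun i hi => by
    by_contra hR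
    exact Finsupp.mem_support_iff.1 hi ((h i).2 (by simpa using hR))
  calc c.bits ≤ ∑ _i ∈ c.reg.support, (R.size + B.size) := Finset.sum_le_sum fun i hi =>
        add_le_add (Nat.size_le_size (Finset.mem_range.1 (hsub hi)).le)
          (Nat.size_le_size (h i).1.le)
    _ ≤ ∑ _i ∈ Finset.range R, (R.size + B.size) :=
        Finset.sum_le_sum_of_subset hsub
    _ = _ := by simp

/-- Constants and input entries are not contents of registers before the step, but they are
afterwards; this is why the configuration after the step has to be good as well. -/
theorem Instr.operandBits_le {B R : ℕ} {c : Config} {x : List ℕ} (h : c.Good B R) (i : Instr)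
    (h' : (i.exec x c).Good B R) : i.operandBits x c ≤ 2 * B.size := by
  have hs : ∀ j, (c.reg j).size ≤ B.size := fun j => Nat.size_le_size (h j).1.le
  cases i with
  | const d v =>
    have := (h' d).1
    simp only [exec, Finsupp.coe_update, Function.update_self] at this
    have := Nat.size_le_size this.le
    simp only [operandBits]; omega
  | arith o d a b => have := hs a; have := hs b; simp only [operandBits]; omega
  | load d a => have := hs a; have := hs (c.reg a); simp only [operandBits]; omega
  | store a b => have := hs a; have := hs b; simp only [operandBits]; omega
  | input d a =>
    have := (h' d).1
    simp only [exec, Finsupp.coe_update, Function.update_self] at this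
    have := Nat.size_le_size this.le
    have := hs a
    simp only [operandBits]; omega
  | jump l => simp [operandBits]
  | jumpZero a l => have := hs a; simp only [operandBits]; omega

section Resources

variable {P : Program} {x : List ℕ} {B R : ℕ}

theorem Program.run_add (i j : ℕ) : P.run x (i + j) = (P.step x)^[i] (P.run x j) := by
  simp [run, Function.iterate_add_apply]

/-- A program that halts does not repeat a configuration before. -/
theorem Program.run_injOn {t : ℕ} (ht : P.length ≤ (P.run x t).pc)
    (hmin : ∀ j < t, (P.run x j).pc < P.length) :
    Set.InjOn (P.run x) (Finset.range t : Set ℕ) := by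
  have key : ∀ i j, i < j → j < t → P.run x i ≠ P.run x j := by
    intro i j hij hjt heq
    -- If the configurations at times `i < j` agree, they still agree `t - j` steps later, so the
    -- halted configuration would already occur at time `t - j + i < t`.
    have h1 := P.run_add (x := x) (t - j) j
    rw [← heq, ← P.run_add, Nat.sub_add_cancel hjt.le] at h1
    have h2 := hmin (t - j + i) (by omega)
    rw [← h1] at h2
    omega
  intro i hi j hj heq
  simp only [Finset.coe_range, Set.mem_Iio] at hi hj
  rcases lt_trichotomy i j with h | h | h
  · exact absurd heq (key i j h hj)
  · exact h
  · exact absurd heq.symm (key j i h hi)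

/-- Pigeonhole: the configurations before halting are distinct, and a good one is determined by the
program counter and `R` numbers below `B`. -/
theorem Program.halting_time_le {t : ℕ} (ht : P.length ≤ (P.run x t).pc)
    (hmin : ∀ j < t, (P.run x j).pc < P.length) (hg : ∀ j < t, (P.run x j).Good B R) :
    t ≤ P.length * B ^ R := by
  classical
  have hB : ∀ j : Fin t, ∀ i, (P.run x j).reg i < B := fun j i => (hg j j.2 i).1
  let f : Fin t → Fin P.length × (Fin R → Fin B) := fun j =>
    (⟨(P.run x j).pc, hmin j j.2⟩, fun i => ⟨(P.run x j).reg i, hB j i⟩)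
  have hf : Function.Injective f := by
    intro i j hij
    simp only [f, Prod.mk.injEq, Fin.mk.injEq, funext_iff] at hij
    have hreg : (P.run x i).reg = (P.run x j).reg := by
      ext a
      by_cases ha : a < R
      · exact hij.2 ⟨a, ha⟩
      · rw [(hg i i.2 a).2 (by omega), (hg j j.2 a).2 (by omega)]
    have hrun : P.run x i = P.run x j := by
      cases hi : P.run x i; cases hj : P.run x j
      simp_all
    exact Fin.ext (P.run_injOn ht hmin (by simp) (by simp) hrun)
  simpa using Fintype.card_le_of_injective f hf

/-- The given `t` need not be the first halting time. Only before the first one are the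
configurations distinct, so `t'` is taken minimal; afterwards nothing changes. -/
theorem Program.resources_le (hB : 2 ≤ B) {t : ℕ} (ht : P.length ≤ (P.run x t).pc)
    (hg : ∀ j ≤ t, (P.run x j).Good B R) :
    ∃ t' ≤ t, P.run x t' = P.run x t ∧ P.space x t' ≤ R * (R.size + B.size) ∧
      P.time x t' ≤ B ^ (P.length + R + 6) := by
  classical
  have hex : ∃ t, P.length ≤ (P.run x t).pc := ⟨t, ht⟩
  have hfind := Nat.find_spec hex
  have hmin : ∀ j < Nat.find hex, (P.run x j).pc < P.length :=
    fun j hj => not_le.1 (Nat.find_min hex hj)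
  have hle : Nat.find hex ≤ t := Nat.find_min' hex ht
  generalize Nat.find hex = t' at hfind hmin hle
  have hstep : P.step x (P.run x t') = P.run x t' := by
    simp [step, List.getElem?_eq_none hfind]
  refine ⟨t', hle, ?_, ?_, ?_⟩
  · have := P.run_add (x := x) (t - t') t'
    rw [Nat.sub_add_cancel hle, Function.iterate_fixed hstep] at this
    exact this.symm
  · refine Finset.sup_le fun j hj => (hg j ?_).bits_le
    have := Finset.mem_range.1 hj
    omega
  · have hcost : ∀ j < t', P.stepCost x (P.run x j) ≤ B ^ 6 := by
      intro j hj
      obtain ⟨i, hi⟩ : ∃ i, P[(P.run x j).pc]? = some i := ⟨_, List.getElem?_eq_getElem (hmin j hj)⟩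
      have hnext : P.run x (j + 1) = i.exec x (P.run x j) := by
        rw [add_comm, P.run_add]
        simp [step, hi]
      have hbits := i.operandBits_le (hg j (by omega)) (hnext ▸ hg (j + 1) (by omega))
      have hsize : B.size ≤ B := Nat.size_le.2 Nat.lt_two_pow_self
      calc P.stepCost x (P.run x j) = (1 + i.operandBits x (P.run x j)) ^ 2 := by
            simp [stepCost, hi, Instr.cost]
        _ ≤ (B ^ 3) ^ 2 := Nat.pow_le_pow_left (by
            have : 4 * B ≤ B ^ 3 := by nlinarith [Nat.mul_le_mul hB hB]
            omega) 2
        _ = B ^ 6 := by ring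
    calc P.time x t' ≤ ∑ _j ∈ Finset.range t', B ^ 6 :=
          Finset.sum_le_sum fun j hj => hcost j (Finset.mem_range.1 hj)
      _ = t' * B ^ 6 := by simp
      _ ≤ (P.length * B ^ R) * B ^ 6 :=
          Nat.mul_le_mul_right _ (P.halting_time_le hfind hmin fun j hj => hg j (by omega))
      _ ≤ (B ^ P.length * B ^ R) * B ^ 6 := by
          gcongr
          exact (Nat.lt_two_pow_self.le).trans (Nat.pow_le_pow_left hB _)
      _ = _ := by ring

end Resources

/-- A structured program compiles to a machine program whose resources are controlled by the
largest value that occurs. -/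
theorem Cmd.exists_program {ι : Type} [DecidableEq ι] {idx : ι → ℕ} {m : ℕ}
    (hinj : Function.Injective idx) (hm : ∀ i, idx i < m) {out : ι} (hout : idx out = 0)
    (c : Cmd ι) :
    ∃ (P : Program) (K : ℕ), ∀ (x : List ℕ) (B : ℕ) (s : ι → ℕ), 2 ≤ B →
      c.Exec x B (fun _ => 0) s →
      ∃ t, P.HaltsWith x t (s out) ∧ P.time x t ≤ B ^ K ∧ P.space x t ≤ K * B.size := by
  obtain ⟨R, hR⟩ : ∃ R, R = m + c.width + 2 := ⟨_, rfl⟩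
  refine ⟨c.code idx m 0, (c.code idx m 0).length + R + 6 + R * (R.size + 1), fun x B s hB h => ?_⟩
  have hinit : Config.Good B R Config.init := fun j => ⟨by simp [Config.init]; omega, fun _ => rfl⟩
  obtain ⟨r, hreach, hr, hg⟩ := h.reach (P := c.code idx m 0) (B := B) (R := R) hinj hm
    (by omega) 0 0 (fun _ => rfl) hinit (by omega) (List.prefix_refl _)
  obtain ⟨t, ht, hgood⟩ := hreach.iterate hinit
  change Program.run _ x t = _ at ht
  obtain ⟨t', -, hrun, hspace, htime⟩ := Program.resources_le hB (t := t) (by simp [ht]) hgood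
  have hBs : 0 < B.size := Nat.size_pos.2 (by omega)
  refine ⟨t', ⟨?_, ?_⟩, htime.trans (Nat.pow_le_pow_right (by omega) (by omega)),
    hspace.trans ?_⟩
  · simp [hrun, ht]
  · rw [hrun, ht, ← hout]
    exact hr out
  · have : R * R.size ≤ R * R.size * B.size := Nat.le_mul_of_pos_right _ hBs
    nlinarith

end RAM

/-! ### Sums over finite fields -/

section FieldSums

variable {p : ℕ} [Fact p.Prime]

/-- Detection of an exponent by a power sum. -/
theorem ZMod.sum_pow_sub_add {s t : ℕ} (hs : s < p) (ht : t < p - 1) :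
    ∑ x : ZMod p, x ^ (p - 1 - s + t) = if s = t then -1 else 0 := by
  classical
  have hp := (Fact.out : p.Prime).two_le
  have hsplit : ∀ i : ℕ, ∑ x : ZMod p, x ^ i = 0 ^ i + ∑ x : (ZMod p)ˣ, (x : ZMod p) ^ i := by
    intro i
    rw [← Finset.sum_erase_add _ _ (Finset.mem_univ (0 : ZMod p)), add_comm]
    congr 1
    symm
    refine Finset.sum_bij' (fun u _ => (u : ZMod p))
      (fun x hx => Units.mk0 x (by simpa using hx)) ?_ ?_ ?_ ?_ ?_ <;> simp
  have hu : ∀ i : ℕ, ∑ x : (ZMod p)ˣ, (x : ZMod p) ^ i = if p - 1 ∣ i then -1 else 0 := by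
    intro i
    have := FiniteField.sum_pow_units (K := ZMod p) i
    simpa [ZMod.card] using this
  rw [hsplit, hu]
  by_cases h : s = t
  · subst h
    rw [Nat.sub_add_cancel (by omega), if_pos (dvd_refl _), if_pos rfl, zero_pow (by omega), zero_add]
  · rw [if_neg h]
    -- The exponent is less than `2 * (p - 1)` and differs from `p - 1`, so `p - 1` divides it only
    -- if it is zero. In that case the term `0 ^ 0 = 1` cancels the `-1` from the units.
    by_cases h0 : p - 1 - s + t = 0
    · obtain rfl : t = 0 := by omega
      simp [h0]
    · rw [zero_pow h0, zero_add, if_neg]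
      rintro ⟨c, hc⟩
      have : c = 1 := by
        rcases c with _ | _ | c
        · omega
        · rfl
        · have : (p - 1) * (c + 1 + 1) = (p - 1) * c + 2 * (p - 1) := by ring
          omega
      subst this
      omega

/-- Detection of a vector of exponents. -/
theorem ZMod.sum_prod_pow_sub_add {ι : Type*} [Fintype ι] [DecidableEq ι]
    (hι : Even (Fintype.card ι)) {s t : ι → ℕ} (hs : ∀ i, s i < p) (ht : ∀ i, t i < p - 1) :
    ∑ w : ι → ZMod p, ∏ i, w i ^ (p - 1 - s i + t i) = if s = t then 1 else 0 := by
  rw [← Fintype.piFinset_univ, ← Finset.prod_univ_sum (fun _ => Finset.univ)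
    (fun i (x : ZMod p) => x ^ (p - 1 - s i + t i))]
  simp only [ZMod.sum_pow_sub_add (hs _) (ht _)]
  by_cases h : s = t
  · subst h
    -- Every factor is `-1`, and their number is even.
    simp [hι]
  · obtain ⟨i, hi⟩ := Function.ne_iff.1 h
    rw [if_neg h]
    exact Finset.prod_eq_zero (Finset.mem_univ i) (if_neg hi)

/-- The elements of `ZMod p` are the residues of the numbers less than `p`. -/
noncomputable def ZMod.equivFin (p : ℕ) [Fact p.Prime] : Fin p ≃ ZMod p where
  toFun i := (i : ℕ)
  invFun x := ⟨x.val, x.val_lt⟩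
  left_inv i := Fin.ext (ZMod.val_cast_of_lt i.2)
  right_inv x := ZMod.natCast_zmod_val x

end FieldSums

/-- A product of sums over the subsets of disjoint sets. -/
theorem Finset.prod_sum_powerset {α β R : Type*} [DecidableEq α] [CommSemiring R]
    (C : Finset β) (D : β → Finset α) (f : β → Finset α → R)
    (hD : (C : Set β).PairwiseDisjoint D) :
    ∏ c ∈ C, ∑ X ∈ (D c).powerset, f c X =
      ∑ X ∈ (C.biUnion D).powerset, ∏ c ∈ C, f c (X ∩ D c) := by
  classical
  induction C using Finset.induction_on with
  | empty => simp
  | insert c C hc ih =>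
    rw [Finset.prod_insert hc, ih (hD.subset (by simp)), Finset.sum_mul_sum, Finset.biUnion_insert,
      ← Finset.sum_product']
    have hdisj : Disjoint (D c) (C.biUnion D) := by
      rw [Finset.disjoint_biUnion_right]
      intro b hb
      exact hD (by simp) (by simp [hb]) (by rintro rfl; exact hc hb)
    have hsub : ∀ b ∈ C, D b ⊆ C.biUnion D := fun b hb => Finset.subset_biUnion_of_mem D hb
    refine Finset.sum_bij' (fun Y _ => Y.1 ∪ Y.2)
      (fun X _ => (X ∩ D c, X ∩ C.biUnion D)) ?_ ?_ ?_ ?_ ?_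
    · rintro ⟨Y, Z⟩ h
      simp only [Finset.mem_product, Finset.mem_powerset] at h ⊢
      exact Finset.union_subset_union h.1 h.2
    · intro X hX
      simp
    · rintro ⟨Y, Z⟩ h
      simp only [Finset.mem_product, Finset.mem_powerset] at h
      have h1 : Z ∩ D c = ∅ :=
        Finset.disjoint_iff_inter_eq_empty.1 (hdisj.symm.mono_left h.2)
      have h2 : Y ∩ C.biUnion D = ∅ := Finset.disjoint_iff_inter_eq_empty.1 (hdisj.mono_left h.1)
      simp [Finset.union_inter_distrib_right, h1, h2, Finset.inter_eq_left.2 h.1,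
        Finset.inter_eq_left.2 h.2]
    · intro X hX
      rw [Finset.mem_powerset] at hX
      simp only
      rw [← Finset.inter_union_distrib_left, Finset.inter_eq_left.2 hX]
    · rintro ⟨Y, Z⟩ h
      simp only [Finset.mem_product, Finset.mem_powerset] at h
      have h1 : Z ∩ D c = ∅ :=
        Finset.disjoint_iff_inter_eq_empty.1 (hdisj.symm.mono_left h.2)
      rw [Finset.prod_insert hc]
      simp only [Finset.union_inter_distrib_right, h1, Finset.union_empty,
        Finset.inter_eq_left.2 h.1]
      congr 1
      refine Finset.prod_congr rfl fun b hb => ?_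
      have h2 : Y ∩ D b = ∅ := Finset.disjoint_iff_inter_eq_empty.1
        (hdisj.mono h.1 (hsub b hb))
      rw [h2, Finset.empty_union]

/-! ### The generating function of the cuts -/

namespace LabelledTree

open scoped Classical

set_option linter.unusedSectionVars false

variable {V : Type*} [Fintype V] {k : ℕ} {T : RootedTree} [Fintype T] (L : LabelledTree V k T)

/-- The vertices below a node. -/
noncomputable def below (b : T) : Finset V := Finset.univ.filter fun v => b ≤ (L.leaf v : T)

theorem mem_below {b : T} {v : V} : v ∈ L.below b ↔ b ≤ (L.leaf v : T) := by simp [below]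

/-- The children of a node. -/
noncomputable def children (T : RootedTree) [Fintype T] (b : T) : Finset T :=
  Finset.univ.filter fun c => c ≠ ⊥ ∧ Order.pred c = b

theorem mem_children {b c : T} : c ∈ children T b ↔ c ≠ ⊥ ∧ Order.pred c = b := by simp [children]

theorem lt_of_mem_children {b c : T} (h : c ∈ children T b) : b < c := by
  obtain ⟨h1, rfl⟩ := mem_children.1 h
  exact Order.pred_lt_of_not_isMin fun h => h1 h.eq_bot

/-- Above a node lies exactly one child of the node in direction of a descendant. -/
theorem exists_child {a b : T} (h : b < a) : ∃ c ∈ children T b, c ≤ a := by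
  obtain ⟨m, hm⟩ := h.le.exists_pred_iterate
  have hex : ∃ m, Order.pred^[m] a = b := ⟨m, hm⟩
  have h0 : Nat.find hex ≠ 0 := by
    intro h0
    have := Nat.find_spec hex
    rw [h0] at this
    exact h.ne' this
  obtain ⟨j, hj⟩ := Nat.exists_eq_succ_of_ne_zero h0
  have hspec := Nat.find_spec hex
  rw [hj, Function.iterate_succ_apply'] at hspec
  -- The child is the last node before `b` is first reached on the way up from `a`. It is not the
  -- root: otherwise `b` would be the root too and would be reached already after `j` steps.
  refine ⟨Order.pred^[j] a, mem_children.2 ⟨?_, hspec⟩, Order.pred_iterate_le _ _⟩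
  intro hbot
  refine Nat.find_min hex (m := j) (by omega) ?_
  rw [hbot] at hspec ⊢
  simpa using hspec

/-- The ancestors of `a` form a chain, so the two children are comparable. If `c < c'`, then `c` is
at most the parent `b` of `c'`, which contradicts `b < c`. -/
theorem child_unique {a b c c' : T} (hc : c ∈ children T b) (hc' : c' ∈ children T b)
    (h : c ≤ a) (h' : c' ≤ a) : c = c' := by
  have key : ∀ {c c' : T}, c ∈ children T b → c' ∈ children T b → c ≤ c' → c = c' := by
    intro c c' hc hc' hle
    by_contra hne
    have h1 := Order.le_pred_of_lt (lt_of_le_of_ne hle hne)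
    rw [(mem_children.1 hc').2] at h1
    exact absurd (lt_of_mem_children hc) h1.not_gt
  rcases le_total_of_directed h h' with h1 | h1
  · exact (key hc' hc h1).symm
  · exact key hc hc' h1

/-- The contribution of a node to the exponent of a pair of vertices with labels `i` and `j`
at the node: what the node decides minus what its parent would decide, modulo `p - 1`. -/
noncomputable def excess (p : ℕ) (a : T) (i j : Fin k) : ℕ :=
  (L.mat a i j).toNat +
    if a = ⊥ then 0 else (p - 2) * (L.mat (Order.pred a) (L.rename a i) (L.rename a j)).toNat

/-- The vertices in `X` have colour `0`, the others have colour `1`. -/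
noncomputable def colour (X : Finset V) (v : V) : Fin 2 := if v ∈ X then 0 else 1

variable {p : ℕ}

/-- The weight of a node for a set of vertices. -/
noncomputable def nodeWeight (y : ZMod p) (a : T) (X : Finset V) : ZMod p :=
  ∏ u ∈ L.below a ∩ X, ∏ v ∈ L.below a \ X, y ^ L.excess p a (L.labelAt a u) (L.labelAt a v)

/-- The generating function of the subsets of the vertices below `b`, at the point `z` that is
indexed by the colours and the labels at the parent of `b`. -/
noncomputable def gen (y : ZMod p) (b : T) (z : Fin 2 × Fin k → ZMod p) : ZMod p :=
  ∑ X ∈ (L.below b).powerset, (∏ a ∈ Finset.univ.filter (b ≤ ·), L.nodeWeight y a X) *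
    ∏ v ∈ L.below b, z (colour X v, L.rename b (L.labelAt b v)) ^ (if b = ⊥ then 0 else 1)

/-- Weights in the subtree of a child see only the vertices below that child. This lets the choices
for different children be made independently. -/
theorem nodeWeight_inter (y : ZMod p) {a : T} {D : Finset V} (X : Finset V) (h : L.below a ⊆ D) :
    L.nodeWeight y a (X ∩ D) = L.nodeWeight y a X := by
  have h1 : L.below a ∩ (X ∩ D) = L.below a ∩ X := by
    ext v
    have := @h v
    simp only [Finset.mem_inter]; tauto
  have h2 : L.below a \ (X ∩ D) = L.below a \ X := by
    ext v
    have := @h v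
    simp only [Finset.mem_inter, Finset.mem_sdiff]; tauto
  rw [nodeWeight, nodeWeight, h1, h2]

theorem colour_inter {D X : Finset V} {v : V} (h : v ∈ D) : colour (X ∩ D) v = colour X v := by
  simp [colour, h]

theorem below_subset {a b : T} (h : b ≤ a) : L.below a ⊆ L.below b := fun _ hv =>
  L.mem_below.2 (h.trans (L.mem_below.1 hv))

theorem pairwiseDisjoint_below (b : T) :
    (children T b : Set T).PairwiseDisjoint L.below := by
  intro c hc c' hc' hne
  rw [Function.onFun, Finset.disjoint_left]
  intro v hv hv'
  exact hne (child_unique hc hc' (L.mem_below.1 hv) (L.mem_below.1 hv'))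

/-- The product over the children and the leaf at a node. -/
theorem prod_gen_children (y : ZMod p) (b : T) (w : Fin 2 × Fin k → ZMod p) :
    (∏ c ∈ children T b, L.gen y c w) *
      ∏ v ∈ Finset.univ.filter (fun v => (L.leaf v : T) = b),
        (w (0, L.label v) + w (1, L.label v)) =
    ∑ X ∈ (L.below b).powerset, (∏ a ∈ Finset.univ.filter (b < ·), L.nodeWeight y a X) *
      ∏ v ∈ L.below b, w (colour X v, L.labelAt b v) := by
  -- At a leaf there are no children, and the two colours of its single vertex give the sum of two
  -- coordinates. At an inner node the factor for leaves is empty, and a set below `b` is a disjoint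
  -- union of sets below its children.
  by_cases hb : IsMax b
  · obtain ⟨v, hv⟩ := L.leaf.surjective ⟨b, hb⟩
    have hv' : (L.leaf v : T) = b := by rw [hv]
    have h1 : children T b = ∅ := by
      ext c
      simp only [Finset.notMem_empty, iff_false]
      exact fun hc => hb.not_lt (lt_of_mem_children hc)
    have h2 : Finset.univ.filter (fun v => (L.leaf v : T) = b) = {v} := by
      ext u
      simp only [Finset.mem_filter, Finset.mem_univ, true_and, Finset.mem_singleton]
      refine ⟨fun hu => L.leaf.injective (Subtype.ext (hu.trans hv'.symm)), fun h => h ▸ hv'⟩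
    have h3 : L.below b = {v} := by
      rw [← h2]
      ext u
      simp only [mem_below, Finset.mem_filter, Finset.mem_univ, true_and]
      exact ⟨fun h => (hb.eq_of_le h).symm, fun h => h.ge⟩
    have h4 : Finset.univ.filter (b < ·) = (∅ : Finset T) := by
      ext c
      simp [hb.not_lt]
    have h5 : L.labelAt b v = L.label v := by rw [← hv', L.labelAt_leaf]
    rw [h1, h2, h3, h4]
    rw [show ({v} : Finset V) = insert v ∅ from rfl, Finset.sum_powerset_insert (by simp)]
    simp [colour, h5, add_comm]
  · have h2 : Finset.univ.filter (fun v => (L.leaf v : T) = b) = ∅ := by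
      ext u
      simp only [Finset.mem_filter, Finset.mem_univ, true_and, Finset.notMem_empty, iff_false]
      rintro rfl
      exact hb (L.leaf u).2
    have h3 : (children T b).biUnion L.below = L.below b := by
      ext v
      simp only [Finset.mem_biUnion, mem_below]
      constructor
      · rintro ⟨c, hc, hcv⟩
        exact (lt_of_mem_children hc).le.trans hcv
      · intro h
        exact exists_child (lt_of_le_of_ne h (by rintro rfl; exact hb (L.leaf v).2))
    have h4 : Finset.univ.filter (b < ·) =
        (children T b).biUnion fun c => Finset.univ.filter (c ≤ ·) := by
      ext a
      simp only [Finset.mem_filter, Finset.mem_univ, true_and, Finset.mem_biUnion]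
      exact ⟨exists_child, fun ⟨c, hc, hca⟩ => (lt_of_mem_children hc).trans_le hca⟩
    rw [h2, Finset.prod_empty, mul_one, ← h3, h4]
    simp only [gen]
    rw [Finset.prod_sum_powerset _ _ _ (L.pairwiseDisjoint_below b)]
    refine Finset.sum_congr rfl fun X _ => ?_
    rw [Finset.prod_biUnion (L.pairwiseDisjoint_below b), Finset.prod_biUnion, ← Finset.prod_mul_distrib]
    · refine Finset.prod_congr rfl fun c hc => ?_
      obtain ⟨hc0, hcb⟩ := mem_children.1 hc
      congr 1
      · refine Finset.prod_congr rfl fun a ha => ?_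
        exact L.nodeWeight_inter y X (L.below_subset (Finset.mem_filter.1 ha).2)
      · refine Finset.prod_congr rfl fun v hv => ?_
        -- The child indexes its point by renamed labels, and these are the labels at `b`.
        rw [if_neg hc0, pow_one, colour_inter hv, ← L.labelAt_parent hc0 v (L.mem_below.1 hv), hcb]
    · intro c hc c' hc' hne
      rw [Function.onFun, Finset.disjoint_left]
      intro a ha ha'
      exact hne (child_unique hc hc' (Finset.mem_filter.1 ha).2 (Finset.mem_filter.1 ha').2)

/-- The number of vertices below `b` of given colour and label at `b`. -/
noncomputable def count (b : T) (X : Finset V) (q : Fin 2 × Fin k) : ℕ :=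
  ((L.below b).filter fun v => (colour X v, L.labelAt b v) = q).card

theorem count_le (b : T) (X : Finset V) (q : Fin 2 × Fin k) :
    L.count b X q ≤ Fintype.card V := Finset.card_le_univ _

/-- Grouping the vertices by colour and label turns the product into a monomial whose exponent
vector is the profile. -/
theorem prod_eq_prod_pow_count {R : Type*} [CommMonoid R] (b : T) (X : Finset V)
    (f : Fin 2 × Fin k → R) :
    ∏ v ∈ L.below b, f (colour X v, L.labelAt b v) = ∏ q, f q ^ L.count b X q := by
  rw [← Finset.prod_fiberwise_of_maps_to (t := Finset.univ)
    (g := fun v => (colour X v, L.labelAt b v)) (fun _ _ => Finset.mem_univ _)]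
  refine Finset.prod_congr rfl fun q _ => ?_
  rw [Finset.prod_congr rfl (g := fun _ => f q), Finset.prod_const]
  · rfl
  · intro v hv
    rw [(Finset.mem_filter.1 hv).2]

/-- The exponent of a pair depends only on its two labels, so it suffices to count the pairs with
given labels. Telescoping pays off here: all pairs below `b` take part, not only those that separate
at `b`, and their number is a product of two profile entries. -/
theorem nodeWeight_eq (y : ZMod p) (b : T) (X : Finset V) :
    L.nodeWeight y b X = ∏ ij : Fin k × Fin k,
      y ^ (L.count b X (0, ij.1) * L.count b X (1, ij.2) * L.excess p b ij.1 ij.2) := by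
  have h0 : ∀ i, L.count b X (0, i) = ((L.below b ∩ X).filter fun v => L.labelAt b v = i).card := by
    intro i
    rw [count]
    congr 1
    ext v
    by_cases hv : v ∈ X <;> simp [colour, hv]
  have h1 : ∀ i, L.count b X (1, i) = ((L.below b \ X).filter fun v => L.labelAt b v = i).card := by
    intro i
    rw [count]
    congr 1
    ext v
    by_cases hv : v ∈ X <;> simp [colour, hv]
  simp only [nodeWeight, Finset.prod_pow_eq_pow_sum, h0, h1]
  congr 1
  rw [← Finset.sum_product']
  rw [← Finset.sum_fiberwise_of_maps_to (t := Finset.univ)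
    (g := fun uv : V × V => (L.labelAt b uv.1, L.labelAt b uv.2)) (fun _ _ => Finset.mem_univ _)]
  refine Finset.sum_congr rfl fun ij _ => ?_
  rw [Finset.sum_congr rfl (g := fun _ => L.excess p b ij.1 ij.2), Finset.sum_const, smul_eq_mul,
    ← Finset.card_product]
  · congr 2
    ext uv
    simp only [Finset.mem_filter, Finset.mem_product, Prod.ext_iff]
    tauto
  · intro uv huv
    simp only [Finset.mem_filter, Prod.ext_iff] at huv
    rw [huv.2.1, huv.2.2]

/-- The recursion that the algorithm evaluates. -/
theorem gen_eq [Fact p.Prime] (hp : Fintype.card V < p - 1) (y : ZMod p) (b : T)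
    (z : Fin 2 × Fin k → ZMod p) :
    L.gen y b z = ∑ s : Fin 2 × Fin k → Fin p, ∑ w : Fin 2 × Fin k → Fin p,
      (∏ ij : Fin k × Fin k, y ^ ((s (0, ij.1) : ℕ) * s (1, ij.2) * L.excess p b ij.1 ij.2)) *
      (∏ q, ((w q : ℕ) : ZMod p) ^ (p - 1 - s q) *
        z (q.1, L.rename b q.2) ^ ((if b = ⊥ then 0 else 1) * (s q : ℕ))) *
      ((∏ c ∈ children T b, L.gen y c fun q => ((w q : ℕ) : ZMod p)) *
        ∏ v ∈ Finset.univ.filter (fun v => (L.leaf v : T) = b),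
          ((w (0, L.label v) : ℕ) + (w (1, L.label v) : ℕ) : ZMod p)) := by
  -- Orthogonality: the sum over all points `w` keeps exactly the sets with profile `s`. There is no
  -- sign because the number `2 * k` of coordinates is even.
  have hw : ∀ s : Fin 2 × Fin k → Fin p, ∀ X : Finset V,
      ∑ w : Fin 2 × Fin k → Fin p, (∏ q, ((w q : ℕ) : ZMod p) ^ (p - 1 - s q)) *
        ∏ v ∈ L.below b, ((w (colour X v, L.labelAt b v) : ℕ) : ZMod p) =
      if (fun q => (s q : ℕ)) = L.count b X then 1 else 0 := by
    intro s X
    rw [← ZMod.sum_prod_pow_sub_add (p := p) (by simp) (fun q => (s q).2)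
      (fun q => (L.count_le b X q).trans_lt hp)]
    refine Fintype.sum_equiv (Equiv.piCongrRight fun _ => ZMod.equivFin p) _ _ fun w => ?_
    rw [L.prod_eq_prod_pow_count b X fun q => ((w q : ℕ) : ZMod p), ← Finset.prod_mul_distrib]
    refine Finset.prod_congr rfl fun q _ => ?_
    rw [pow_add]
    rfl
  -- For a fixed guess `s` only sets with profile `s` survive, and for these the weight of `b` may
  -- be computed from `s`.
  have hs : ∀ s : Fin 2 × Fin k → Fin p, ∑ w : Fin 2 × Fin k → Fin p,
      (∏ ij : Fin k × Fin k, y ^ ((s (0, ij.1) : ℕ) * s (1, ij.2) * L.excess p b ij.1 ij.2)) *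
      (∏ q, ((w q : ℕ) : ZMod p) ^ (p - 1 - s q) *
        z (q.1, L.rename b q.2) ^ ((if b = ⊥ then 0 else 1) * (s q : ℕ))) *
      ((∏ c ∈ children T b, L.gen y c fun q => ((w q : ℕ) : ZMod p)) *
        ∏ v ∈ Finset.univ.filter (fun v => (L.leaf v : T) = b),
          ((w (0, L.label v) : ℕ) + (w (1, L.label v) : ℕ) : ZMod p)) =
      ∑ X ∈ (L.below b).powerset, if (fun q => (s q : ℕ)) = L.count b X then
        L.nodeWeight y b X * (∏ a ∈ Finset.univ.filter (b < ·), L.nodeWeight y a X) *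
          (∏ q, z (q.1, L.rename b q.2) ^ ((if b = ⊥ then 0 else 1) * L.count b X q)) else 0 := by
    intro s
    simp only [L.prod_gen_children y b fun q => ((_ : Fin p) : ZMod p), Finset.mul_sum]
    rw [Finset.sum_comm]
    refine Finset.sum_congr rfl fun X _ => ?_
    have h1 := congrArg (fun t => (∏ ij : Fin k × Fin k,
      y ^ ((s (0, ij.1) : ℕ) * s (1, ij.2) * L.excess p b ij.1 ij.2)) *
      (∏ q : Fin 2 × Fin k, z (q.1, L.rename b q.2) ^ ((if b = ⊥ then 0 else 1) * (s q : ℕ))) *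
      (∏ a ∈ Finset.univ.filter (b < ·), L.nodeWeight y a X) * t) (hw s X)
    simp only [Finset.mul_sum] at h1
    refine (Finset.sum_congr rfl fun w _ => ?_).trans (h1.trans ?_)
    · rw [Finset.prod_mul_distrib]
      ring
    · by_cases h : (fun q => (s q : ℕ)) = L.count b X
      · rw [if_pos h, if_pos h, L.nodeWeight_eq]
        simp only [← congrFun h]
        ring
      · rw [if_neg h, if_neg h, mul_zero]
  simp only [hs]
  rw [Finset.sum_comm, gen]
  refine Finset.sum_congr rfl fun X _ => ?_
  -- Each set has exactly one profile, and its entries are small enough to be elements of `Fin p`,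
  -- so one guess is right.
  rw [Finset.sum_eq_single fun q => (⟨L.count b X q, by
    have := L.count_le b X q
    omega⟩ : Fin p)]
  · rw [if_pos rfl]
    have hsplit : Finset.univ.filter (b ≤ ·) = insert b (Finset.univ.filter (b < ·)) := by
      ext a
      simp [le_iff_eq_or_lt, eq_comm]
    rw [hsplit, Finset.prod_insert (by simp)]
    congr 1
    rw [L.prod_eq_prod_pow_count b X fun q => z (q.1, L.rename b q.2) ^ (if b = ⊥ then 0 else 1)]
    simp only [pow_mul]
  · intro s _ hne
    rw [if_neg]
    intro h
    exact hne (funext fun q => Fin.ext (congrFun h q))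
  · simp

/-- The exponents of a pair of vertices add up to the entry of the matrix at a common ancestor. -/
theorem prod_excess [Fact p.Prime] {y : ZMod p} (hy : y ≠ 0) {u v : V} (m : T)
    (hu : m ≤ L.leaf u) (hv : m ≤ L.leaf v) :
    ∏ a ∈ Finset.univ.filter (· ≤ m), y ^ L.excess p a (L.labelAt a u) (L.labelAt a v) =
      y ^ (L.mat m (L.labelAt m u) (L.labelAt m v)).toNat := by
  obtain ⟨j, hj⟩ := (bot_le (a := m)).exists_pred_iterate
  induction j generalizing m with
  | zero =>
    obtain rfl : m = ⊥ := hj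
    have : Finset.univ.filter (· ≤ (⊥ : T)) = {⊥} := by ext; simp
    rw [this]
    simp [excess]
  | succ j ih =>
    -- Since `Order.pred` fixes the root, `j` may exceed the distance of `m` from it.
    by_cases hm : m = ⊥
    · subst hm
      exact ih ⊥ bot_le bot_le (Function.iterate_fixed Order.pred_bot j)
    · have hlt : Order.pred m < m := Order.pred_lt_of_not_isMin fun h => hm h.eq_bot
      have hsplit : Finset.univ.filter (· ≤ m) =
          insert m (Finset.univ.filter (· ≤ Order.pred m)) := by
        ext a
        simp only [Finset.mem_filter, Finset.mem_univ, true_and, Finset.mem_insert]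
        constructor
        · intro h
          rcases h.eq_or_lt with h | h
          · exact Or.inl h
          · exact Or.inr (Order.le_pred_of_lt h)
        · rintro (rfl | h)
          · exact le_rfl
          · exact h.trans hlt.le
      rw [hsplit, Finset.prod_insert (by simp [hm]), ih _ (hlt.le.trans hu) (hlt.le.trans hv)
        (by rwa [Function.iterate_succ_apply] at hj), excess, if_neg hm,
        L.labelAt_parent hm u hu, L.labelAt_parent hm v hv, pow_add, mul_assoc, ← pow_add]
      -- The negative part of the excess meets the entry left by the parent; the exponents `(p - 2)
      -- * t` and `t` add up to a multiple of `p - 1`, and `y ^ (p - 1) = 1`.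
      convert mul_one _ using 2
      have hp := (Fact.out : p.Prime).two_le
      rw [show ∀ t : ℕ, (p - 2) * t + t = (p - 1) * t by
        intro t; rw [← Nat.succ_mul]; congr 1; omega, pow_mul, ZMod.pow_card_sub_one_eq_one hy,
        one_pow]

end LabelledTree

open Classical in
/-- The number of edges between a set of vertices and its complement. -/
noncomputable def cutSize {V : Type*} [Fintype V] (G : SimpleGraph V) (X : Finset V) : ℕ :=
  (G.interedges X Xᶜ).card

theorem maxCut_eq_sup {V : Type*} [Fintype V] (G : SimpleGraph V) :
    maxCut G = Finset.univ.sup (cutSize G) := rfl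

theorem cutSize_le {V : Type*} [Fintype V] (G : SimpleGraph V) (X : Finset V) :
    cutSize G X ≤ Fintype.card V * Fintype.card V := by
  classical
  refine (SimpleGraph.card_interedges_le_mul _ _ _).trans ?_
  exact Nat.mul_le_mul (Finset.card_le_univ _) (Finset.card_le_univ _)

/-! ### The generating function at the root and interpolation. -/

namespace TreeModel

open scoped Classical

variable {V : Type*} [Fintype V] {G : SimpleGraph V} {d k : ℕ} {T : RootedTree} [Fintype T]
  (M : TreeModel G d k T) {p : ℕ} [Fact p.Prime]

/-- At the root, the generating function counts all sets of vertices by the size of the cut. -/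
theorem gen_bot {y : ZMod p} (hy : y ≠ 0) (z : Fin 2 × Fin k → ZMod p) :
    M.gen y ⊥ z = ∑ X : Finset V, y ^ cutSize G X := by
  have hbelow : M.below ⊥ = Finset.univ := by ext; simp [LabelledTree.below]
  rw [LabelledTree.gen, hbelow, Finset.powerset_univ]
  refine Finset.sum_congr rfl fun X _ => ?_
  have h1 : ∀ a, M.nodeWeight y a X = ∏ u ∈ X, ∏ v ∈ Xᶜ,
      if a ≤ (M.leaf u : T) ⊓ M.leaf v then
        y ^ M.excess p a (M.labelAt a u) (M.labelAt a v) else 1 := by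
    intro a
    have e1 : M.below a ∩ X = X.filter fun u => a ≤ (M.leaf u : T) := by
      ext; simp [LabelledTree.below, and_comm]
    have e2 : M.below a \ X = Xᶜ.filter fun u => a ≤ (M.leaf u : T) := by
      ext; simp [LabelledTree.below, and_comm]
    rw [LabelledTree.nodeWeight, e1, e2, Finset.prod_filter]
    refine Finset.prod_congr rfl fun u _ => ?_
    rw [Finset.prod_filter]
    by_cases h : a ≤ (M.leaf u : T) <;> simp [h]
  simp only [bot_le, Finset.filter_true, h1, if_true, pow_zero, Finset.prod_const_one, mul_one]
  rw [Finset.prod_comm]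
  have h2 : ∀ u ∈ X, ∏ a : T, ∏ v ∈ Xᶜ, (if a ≤ (M.leaf u : T) ⊓ M.leaf v then
        y ^ M.excess p a (M.labelAt a u) (M.labelAt a v) else 1) =
      ∏ v ∈ Xᶜ, y ^ (if G.Adj u v then 1 else 0) := by
    intro u hu
    rw [Finset.prod_comm]
    refine Finset.prod_congr rfl fun v hv => ?_
    -- The nodes that see both `u` and `v` are those up to the infimum, so the telescoped exponent
    -- is the entry at the least common ancestor, which decides adjacency.
    rw [← Finset.prod_filter, M.prod_excess hy _ inf_le_left inf_le_right]
    have huv : u ≠ v := by rintro rfl; exact (Finset.mem_compl.1 hv) hu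
    congr 1
    by_cases h : G.Adj u v
    · rw [if_pos h, (M.adj_iff u v huv).1 h]; rfl
    · rw [if_neg h, Bool.eq_false_iff.2 fun h' => h ((M.adj_iff u v huv).2 h')]; rfl
  rw [Finset.prod_congr rfl h2, ← Finset.prod_product', Finset.prod_pow_eq_pow_sum,
    Finset.sum_boole]
  rfl

/-- The number of sets of vertices with cut of size `v`, modulo `p`, by interpolation. -/
theorem sum_gen_bot {v : ℕ} (hp : Fintype.card V * Fintype.card V < p - 1)
    (hv : v < p - 1) (z : Fin 2 × Fin k → ZMod p) :
    ∑ y : ZMod p, y ^ (p - 1 - v) * M.gen y ⊥ z =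
      -((Finset.univ.filter fun X : Finset V => cutSize G X = v).card : ZMod p) := by
  calc ∑ y : ZMod p, y ^ (p - 1 - v) * M.gen y ⊥ z
      = ∑ y : ZMod p, ∑ X : Finset V, y ^ (p - 1 - v + cutSize G X) := by
        refine Finset.sum_congr rfl fun y _ => ?_
        -- Telescoping relies on `y ^ (p - 1) = 1` and is not available at `y = 0`. There both sides
        -- vanish, because `p - 1 - v` is positive.
        by_cases hy : y = 0
        · subst hy
          rw [zero_pow (by omega), zero_mul]
          exact (Finset.sum_eq_zero fun X _ => zero_pow (by omega)).symm
        · rw [M.gen_bot hy, Finset.mul_sum]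
          simp only [pow_add]
    _ = ∑ X : Finset V, if v = cutSize G X then -1 else 0 := by
        rw [Finset.sum_comm]
        refine Finset.sum_congr rfl fun X _ => ?_
        exact ZMod.sum_pow_sub_add (by omega) ((cutSize_le G X).trans_lt hp)
    _ = _ := by
        rw [← Finset.sum_filter]
        simp [eq_comm]

end TreeModel

/-! ### A small prime that does not divide a given number -/

/-- Chebyshev's argument: each prime power in the central binomial coefficient is at most `2 * m`,
while the coefficient itself exceeds `4 ^ m / m`, so there cannot be too few primes up to `2 * m`.
-/
theorem Nat.four_pow_lt_of_primesLE {m K : ℕ} (hm : 4 ≤ m)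
    (hK : ((Finset.range (2 * m + 1)).filter Nat.Prime).card ≤ K) :
    4 ^ m < (2 * m) ^ (K + 1) := by
  have h1 : m.centralBinom ≤ (2 * m) ^ K := by
    calc m.centralBinom
        = ∏ p ∈ (Finset.range (2 * m + 1)).filter Nat.Prime, p ^ m.centralBinom.factorization p := by
          rw [Finset.prod_filter_of_ne, Nat.prod_pow_factorization_centralBinom]
          intro p _ hp
          by_contra hnp
          exact hp (by simp [Nat.factorization_eq_zero_of_not_prime _ hnp])
      _ ≤ ∏ p ∈ (Finset.range (2 * m + 1)).filter Nat.Prime, 2 * m :=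
          Finset.prod_le_prod' fun p _ => Nat.pow_factorization_choose_le (by omega)
      _ ≤ (2 * m) ^ K := by
          rw [Finset.prod_const]
          exact Nat.pow_le_pow_right (by omega) hK
  calc 4 ^ m < m * m.centralBinom := Nat.four_pow_lt_mul_centralBinom m hm
    _ ≤ (2 * m) * (2 * m) ^ K := Nat.mul_le_mul (by omega) h1
    _ = _ := by ring

/-- A nonzero number up to `2 ^ n` has at most `n` prime divisors. If every prime in the window
divided `c`, there would be at most `n * n + 2 + n` primes up to `2 * (n + 2) ^ 4`, too few for
Chebyshev's bound. -/
theorem Nat.exists_prime_not_dvd_of_le_two_pow {n c : ℕ} (hn : 1 ≤ n) (hc₀ : c ≠ 0)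
    (hc : c ≤ 2 ^ n) :
    ∃ p, p.Prime ∧ n * n + 1 < p ∧ p ≤ 2 * (n + 2) ^ 4 ∧ ¬ p ∣ c := by
  by_contra! hcon
  have hpf : c.primeFactors.card ≤ n := by
    have h1 : 2 ^ c.primeFactors.card ≤ ∏ p ∈ c.primeFactors, p :=
      Finset.pow_card_le_prod _ _ _ fun p hp => (Nat.prime_of_mem_primeFactors hp).two_le
    have h2 := Nat.le_of_dvd (Nat.pos_of_ne_zero hc₀) (Nat.prod_primeFactors_dvd c)
    exact (Nat.pow_le_pow_iff_right (by norm_num)).1 ((h1.trans h2).trans hc)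
  have hcard : ((Finset.range (2 * (n + 2) ^ 4 + 1)).filter Nat.Prime).card
      ≤ n * n + 2 + n := by
    have hsub : (Finset.range (2 * (n + 2) ^ 4 + 1)).filter Nat.Prime ⊆
        Finset.range (n * n + 2) ∪ c.primeFactors := by
      intro p hp
      simp only [Finset.mem_filter, Finset.mem_range] at hp
      simp only [Finset.mem_union, Finset.mem_range, Nat.mem_primeFactors]
      by_cases h : p < n * n + 2
      · exact Or.inl h
      · exact Or.inr ⟨hp.2, hcon p hp.2 (by omega) (by omega), hc₀⟩
    refine (Finset.card_le_card hsub).trans ((Finset.card_union_le _ _).trans ?_)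
    simpa using hpf
  have h4 : 4 ≤ (n + 2) ^ 4 := by
    calc 4 ≤ 2 ^ 4 := by norm_num
      _ ≤ (n + 2) ^ 4 := Nat.pow_le_pow_left (by omega) 4
  have hlt := Nat.four_pow_lt_of_primesLE h4 hcard
  -- The crude estimate `n + 2 ≤ 2 ^ (n + 2)` makes both sides powers of two; what remains is that a
  -- cubic exponent does not exceed the quartic one.
  have hle : (2 * (n + 2) ^ 4) ^ (n * n + 2 + n + 1) ≤
      2 ^ ((1 + (n + 2) * 4) * (n * n + 2 + n + 1)) := by
    rw [pow_mul]
    refine Nat.pow_le_pow_left ?_ _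
    rw [pow_add, pow_mul, pow_one]
    exact Nat.mul_le_mul_left _ (Nat.pow_le_pow_left Nat.lt_two_pow_self.le 4)
  have h5 := hlt.trans_le hle
  rw [show 4 ^ ((n + 2) ^ 4) = 2 ^ (2 * (n + 2) ^ 4) by rw [pow_mul]; norm_num,
    Nat.pow_lt_pow_iff_right (by norm_num)] at h5
  have h6 : (1 + (n + 2) * 4) * (n * n + 2 + n + 1) ≤ (2 * (n + 2) ^ 2) * (n + 2) ^ 2 :=
    Nat.mul_le_mul (by nlinarith) (by nlinarith)
  have h7 : (2 * (n + 2) ^ 2) * (n + 2) ^ 2 = 2 * (n + 2) ^ 4 := by ring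
  omega

/-! ### Rules for structured programs -/

namespace RAM

namespace Expr

variable {ι : Type}

instance : Add (Expr ι) := ⟨op .add⟩
instance : Sub (Expr ι) := ⟨op .sub⟩
instance : Mul (Expr ι) := ⟨op .mul⟩
instance : Div (Expr ι) := ⟨op .div⟩
instance : Mod (Expr ι) := ⟨op .mod⟩
instance (n : ℕ) : OfNat (Expr ι) n := ⟨lit n⟩
instance : Coe ι (Expr ι) := ⟨var⟩

variable (x : List ℕ) (B : ℕ) (s : ι → ℕ) (a b : Expr ι)

@[simp] theorem eval_add : (a + b).eval x s = a.eval x s + b.eval x s := rfl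
@[simp] theorem eval_sub : (a - b).eval x s = a.eval x s - b.eval x s := rfl
@[simp] theorem eval_mul : (a * b).eval x s = a.eval x s * b.eval x s := rfl
@[simp] theorem eval_div : (a / b).eval x s = a.eval x s / b.eval x s := rfl
@[simp] theorem eval_mod : (a % b).eval x s = a.eval x s % b.eval x s := rfl
@[simp] theorem eval_ofNat (n : ℕ) : (ofNat(n) : Expr ι).eval x s = n := rfl
@[simp] theorem eval_var (r : ι) : (var r : Expr ι).eval x s = s r := rfl
@[simp] theorem eval_inp : (inp a).eval x s = x.getD (a.eval x s) 0 := rfl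

@[simp] theorem bdd_add :
    (a + b).Bdd x B s ↔ a.Bdd x B s ∧ b.Bdd x B s ∧ a.eval x s + b.eval x s < B := Iff.rfl
@[simp] theorem bdd_mul :
    (a * b).Bdd x B s ↔ a.Bdd x B s ∧ b.Bdd x B s ∧ a.eval x s * b.eval x s < B := Iff.rfl
@[simp] theorem bdd_sub : (a - b).Bdd x B s ↔ a.Bdd x B s ∧ b.Bdd x B s :=
  ⟨fun h => ⟨h.1, h.2.1⟩, fun h => ⟨h.1, h.2, (Nat.sub_le _ _).trans_lt (eval_lt h.1)⟩⟩
@[simp] theorem bdd_div : (a / b).Bdd x B s ↔ a.Bdd x B s ∧ b.Bdd x B s :=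
  ⟨fun h => ⟨h.1, h.2.1⟩, fun h => ⟨h.1, h.2, (Nat.div_le_self _ _).trans_lt (eval_lt h.1)⟩⟩
@[simp] theorem bdd_mod : (a % b).Bdd x B s ↔ a.Bdd x B s ∧ b.Bdd x B s :=
  ⟨fun h => ⟨h.1, h.2.1⟩, fun h => ⟨h.1, h.2, (Nat.mod_le _ _).trans_lt (eval_lt h.1)⟩⟩
@[simp] theorem bdd_ofNat (n : ℕ) : (ofNat(n) : Expr ι).Bdd x B s ↔ n < B := Iff.rfl
@[simp] theorem bdd_var (r : ι) : (var r : Expr ι).Bdd x B s ↔ s r < B := Iff.rfl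
@[simp] theorem bdd_inp :
    (inp a).Bdd x B s ↔ a.Bdd x B s ∧ x.getD (a.eval x s) 0 < B := Iff.rfl

/-- The absolute difference. -/
def absDiff (a b : Expr ι) : Expr ι := (a - b) + (b - a)

@[simp] theorem eval_absDiff : (absDiff a b).eval x s =
    (a.eval x s - b.eval x s) + (b.eval x s - a.eval x s) := rfl

@[simp] theorem bdd_absDiff : (absDiff a b).Bdd x B s ↔ a.Bdd x B s ∧ b.Bdd x B s := by
  simp only [absDiff, bdd_add, bdd_sub, eval_sub]
  constructor
  · tauto
  · intro h
    have := eval_lt h.1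
    have := eval_lt h.2
    exact ⟨h, h.symm, by omega⟩

end Expr

namespace Cmd

variable {ι : Type} [DecidableEq ι] {x : List ℕ} {B : ℕ}

/-- The bound on the variables is an invariant. It is therefore available before every command, and
only intermediate values of expressions need an argument. -/
theorem Exec.lt {c : Cmd ι} {s s' : ι → ℕ} (h : c.Exec x B s s') (hs : ∀ r, s r < B) :
    ∀ r, s' r < B := by
  induction h with
  | skip => exact hs
  | assign r e s hb =>
    intro r'
    rw [Function.update_apply]
    split_ifs
    · exact Expr.eval_lt hb
    · exact hs r'
  | seq _ _ ih₁ ih₂ => exact ih₂ (ih₁ hs)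
  | ifz_zero _ _ _ ih => exact ih hs
  | ifz_ne _ _ _ ih => exact ih hs
  | loop_zero => exact hs
  | loop_ne _ _ _ _ ih₁ ih₂ => exact ih₂ (ih₁ hs)

/-- If all variables are less than `B`, then the program leads from `s` to `s'`, and all values
that occur are less than `B`. -/
def Runs (x : List ℕ) (B : ℕ) (c : Cmd ι) (s s' : ι → ℕ) : Prop :=
  (∀ r, s r < B) → c.Exec x B s s'

infixr:60 " ;; " => Cmd.seq

variable {s s₁ s₂ s' : ι → ℕ} {c c₁ c₂ : Cmd ι} {e : Expr ι} {r : ι}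

theorem Runs.skip : Runs x B skip s s := fun _ => .skip s

theorem Runs.assign (hb : (∀ r, s r < B) → e.Bdd x B s)
    (hs' : s' = Function.update s r (e.eval x s)) : Runs x B (.assign r e) s s' := fun hs =>
  hs' ▸ .assign r e s (hb hs)

theorem Runs.seq (h₁ : Runs x B c₁ s s₁) (h₂ : Runs x B c₂ s₁ s₂) : Runs x B (c₁ ;; c₂) s s₂ :=
  fun hs => .seq (h₁ hs) (h₂ ((h₁ hs).lt hs))

theorem Runs.ifz_zero (hb : (∀ r, s r < B) → e.Bdd x B s) (he : e.eval x s = 0)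
    (h : Runs x B c₁ s s') : Runs x B (ifz e c₁ c₂) s s' :=
  fun hs => .ifz_zero (hb hs) he (h hs)

theorem Runs.ifz_ne (hb : (∀ r, s r < B) → e.Bdd x B s) (he : e.eval x s ≠ 0)
    (h : Runs x B c₂ s s') : Runs x B (ifz e c₁ c₂) s s' :=
  fun hs => .ifz_ne (hb hs) he (h hs)

/-- An assignment followed by another program. -/
theorem Runs.assign_seq (hb : (∀ r, s r < B) → e.Bdd x B s)
    (h : Runs x B c (Function.update s r (e.eval x s)) s') : Runs x B (.assign r e ;; c) s s' :=
  (Runs.assign hb rfl).seq h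

/-- Repeat the program for all values of the variable below the current one, in descending
order. -/
def forDown (r : ι) (c : Cmd ι) : Cmd ι := loop r (assign r (r - 1) ;; c)

/-- Here `σ m a` is the store when the counter is `m` and `a` has been accumulated, `g m` is the
effect of the round with counter `m`, and `F m` that of the last `m` rounds together. The body has
to be verified for every `a`, not only for those that occur. -/
theorem Runs.forDown {α : Type*} (hB : 2 ≤ B) {σ : ℕ → α → ι → ℕ} {g F : ℕ → α → α}
    (hF₀ : ∀ a, F 0 a = a) (hF : ∀ m a, F (m + 1) a = F m (g m a)) (hσ : ∀ m a, σ m a r = m)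
    (K : ℕ) (hc : ∀ m < K, ∀ a, Runs x B c (Function.update (σ (m + 1) a) r m) (σ m (g m a)))
    (a : α) : Runs x B (forDown r c) (σ K a) (σ 0 (F K a)) := by
  induction K generalizing a with
  | zero =>
    intro hs
    rw [hF₀]
    exact .loop_zero (hs r) (hσ 0 a)
  | succ K ih =>
    intro hs
    have h1 : Exec x B (.assign r ((r : Expr ι) - 1)) (σ (K + 1) a)
        (Function.update (σ (K + 1) a) r K) := by
      have := Exec.assign (x := x) (B := B) r ((r : Expr ι) - 1) (σ (K + 1) a)
        ((Expr.bdd_sub _ _ _ _ _).2 ⟨hs r, hB⟩)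
      simpa [hσ] using this
    have h2 := Exec.seq h1 (hc K (by omega) a (h1.lt hs))
    refine .loop_ne (hs r) (by simp [hσ]) h2 ?_
    rw [hF]
    exact ih (fun m hm => hc m (by omega)) _ (h2.lt hs)

/-- Iterations of the body of a loop. -/
def Iter (x : List ℕ) (B : ℕ) (r : ι) (c : Cmd ι) : (ι → ℕ) → (ι → ℕ) → Prop :=
  Relation.ReflTransGen fun s s' => s r ≠ 0 ∧ Runs x B c s s'

/-- The depth-first evaluation is a single loop that simulates a recursion. Its rounds are chained
as a relation, and the loop rule is applied only once, at the end. -/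
theorem Iter.runs (h : Iter x B r c s s') (h0 : s' r = 0) : Runs x B (loop r c) s s' := by
  induction h using Relation.ReflTransGen.head_induction_on with
  | refl => exact fun hs => .loop_zero (hs r) h0
  | head h₁ _ ih => exact fun hs => .loop_ne (hs r) h₁.1 (h₁.2 hs) (ih ((h₁.2 hs).lt hs))

end Cmd

end RAM

/-! ### The program for Max Cut -/

namespace MaxCutProgram

open RAM RAM.Expr RAM.Cmd

/-- The variables of the program. -/
inductive Reg
  | ans | p | u | q | v | tot | y | S | A | R | G | B | C | mode | t | i | e | a | b
  deriving DecidableEq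

/-- The input with its entries: the numbers of vertices, labels and nodes, the root, and the tables
of the parents, leaves, labels, renamings and matrices. -/
structure Input (x : List ℕ) (n k N root : ℕ) (par leaf lab : ℕ → ℕ) (ren mat : ℕ → ℕ → ℕ) :
    Prop where
  getD_zero : x.getD 0 0 = n
  getD_one : x.getD 1 0 = k
  getD_two : x.getD 2 0 = N
  getD_four : x.getD 4 0 = root
  root_lt : root < N
  getD_par : ∀ a < N, x.getD (5 + n * n + a) 0 = par a ∧ par a < N
  getD_leaf : ∀ v < n, x.getD (5 + n * n + N + v) 0 = leaf v ∧ leaf v < N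
  getD_lab : ∀ v < n, x.getD (5 + n * n + N + n + v) 0 = lab v ∧ lab v < k
  getD_ren : ∀ a < N, ∀ i < k, x.getD (5 + n * n + N + n + n + a * k + i) 0 = ren a i ∧ ren a i < k
  getD_mat : ∀ a < N, ∀ i < k * k,
    x.getD (5 + n * n + N + n + n + N * k + a * (k * k) + i) 0 = mat a i ∧ mat a i ≤ 1

def eN : Expr Reg := inp 0
def eK : Expr Reg := inp 1
def eNodes : Expr Reg := inp 2
def eRoot : Expr Reg := inp 4
def ePar (a : Expr Reg) : Expr Reg := inp (5 + eN * eN + a)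
def eLeaf (v : Expr Reg) : Expr Reg := inp (5 + eN * eN + eNodes + v)
def eLab (v : Expr Reg) : Expr Reg := inp (5 + eN * eN + eNodes + eN + v)
def eRen (a i : Expr Reg) : Expr Reg := inp (5 + eN * eN + eNodes + eN + eN + a * eK + i)
def eMat (a i : Expr Reg) : Expr Reg :=
  inp (5 + eN * eN + eNodes + eN + eN + eNodes * eK + a * (eK * eK) + i)

/-- `0` at the root and `1` elsewhere. -/
def eNonRoot : Expr Reg := 1 - (1 - absDiff Reg.B eRoot)

/-- Put the digit number `idx` of `src` in base `p` into `dst`. -/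
def digit (dst src : Reg) (idx : Expr Reg) : Cmd Reg :=
  assign .t idx ;; assign dst src ;; forDown .t (assign dst (dst / Reg.p)) ;;
    assign dst (dst % Reg.p)

/-- Multiply `R` by the power of `base` with exponent `e`, modulo `p`. -/
def mulPow (base : Reg) : Cmd Reg := forDown .e (assign .R (Reg.R * base % Reg.p))

/-- A guess `G` has `4k` digits in base `p`: the lower `2k` are the profile `s`, the upper `2k` the
point `w` for the children. In each half, colour `c` and label `i` have position `i + k * c`. The
two digits read here are the coordinates of `w` at the label of the leaf. -/
def leafWeight : Cmd Reg :=
  assign .i eN ;; forDown .i (ifz (absDiff (eLeaf Reg.i) Reg.B)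
    (digit .a .G (eK + eK + eLab Reg.i) ;; digit .b .G (eK + eK + eK + eLab Reg.i) ;;
      assign .R (Reg.R * (Reg.a + Reg.b) % Reg.p) ;; assign .a 0 ;; assign .b 0)
    skip)

/-- The exponent `p - 1 - s` plays the role of `-s`. The point at which the node is evaluated
belongs to the guess of its parent, which occupies the lowest digits of the stack `S`. -/
def profileWeight : Cmd Reg :=
  assign .i (eK + eK) ;; forDown .i (
    digit .a .G Reg.i ;; digit .b .G (eK + eK + Reg.i) ;; assign .e (Reg.p - 1 - Reg.a) ;;
    mulPow .b ;;
    digit .b .S (eK + eK + (eRen Reg.B (Reg.i % eK) + eK * (Reg.i / eK))) ;;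
    assign .e (Reg.a * eNonRoot) ;; mulPow .b ;; assign .a 0 ;; assign .b 0)

/-- The last factor of the exponent is `excess`, with `p - 2` for `-1` and the term of the parent
switched off at the root. -/
def pairWeight : Cmd Reg :=
  assign .i (eK * eK) ;; forDown .i (
    digit .a .G (Reg.i / eK) ;; digit .b .G (eK + Reg.i % eK) ;;
    assign .e (Reg.a * Reg.b * (eMat Reg.B Reg.i + eNonRoot * (Reg.p - 2) *
      eMat (ePar Reg.B) (eRen Reg.B (Reg.i / eK) * eK + eRen Reg.B (Reg.i % eK)))) ;;
    mulPow .y ;; assign .a 0 ;; assign .b 0)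

/-- One step of the depth-first evaluation. -/
def body : Cmd Reg :=
  ifz Reg.C
    (leafWeight ;; profileWeight ;; pairWeight ;; assign .A ((Reg.A + Reg.R) % Reg.p) ;;
      assign .R 1 ;;
      ifz Reg.G
        (ifz (absDiff Reg.B eRoot) (assign .mode 0)
          (assign .R (Reg.S / Reg.q % Reg.p * Reg.A % Reg.p) ;;
            assign .A (Reg.S / Reg.q / Reg.p % Reg.p) ;; assign .G (Reg.S % Reg.q) ;;
            -- Children are scanned in descending order of their numbers, so the number of the
            -- finished child tells where the scan at the parent resumes and need not be stored.
            assign .S (Reg.S / Reg.q / Reg.p / Reg.p) ;; assign .C Reg.B ;;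
            assign .B (ePar Reg.B)))
        (assign .G (Reg.G - 1) ;; assign .C eNodes))
    (assign .C (Reg.C - 1) ;;
      -- The root is listed as its own parent and must not be taken for its own child.
      ifz (absDiff (ePar Reg.C) Reg.B + (1 - absDiff Reg.C eRoot))
        (assign .S (((Reg.S * Reg.p + Reg.A) * Reg.p + Reg.R) * Reg.q + Reg.G) ;;
          assign .B Reg.C ;; assign .A 0 ;; assign .R 1 ;; assign .G (Reg.q - 1) ;;
          assign .C eNodes)
        skip)

/-- Add to `tot` the term of the interpolation formula for the point `y`. -/
def addTerm : Cmd Reg :=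
  assign .R 1 ;; assign .G (Reg.q - 1) ;; assign .B eRoot ;; assign .C eNodes ;; assign .mode 1 ;;
  loop Reg.mode body ;;
  assign .R Reg.A ;; assign .e (Reg.p - 1 - Reg.v) ;; mulPow .y ;;
  assign .tot ((Reg.tot + Reg.R) % Reg.p) ;; assign .A 0 ;; assign .R 0 ;; assign .B 0

/-- Make `ans` the maximum of its value and the sizes of the cuts that are detected modulo `p`. -/
def scanCuts : Cmd Reg :=
  assign .q 1 ;; assign .i (eK + eK + (eK + eK)) ;; forDown .i (assign .q (Reg.q * Reg.p)) ;;
  assign .v (eN * eN + 1) ;; forDown .v (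
    assign .y Reg.p ;; forDown .y addTerm ;;
    ifz Reg.tot skip (assign .ans (Reg.ans + (Reg.v - Reg.ans))) ;; assign .tot 0) ;;
  assign .q 0

/-- Make `u` nonzero if and only if `p` is a prime greater than `n ^ 2 + 1`. -/
def testPrime : Cmd Reg :=
  assign .u (Reg.p - (eN * eN + 1)) ;; assign .i (Reg.p - 2) ;;
  forDown .i (assign .u (1 - (1 - Reg.u * (Reg.p % (Reg.i + 2)))))

def main : Cmd Reg :=
  assign .p (2 * ((eN + 2) * (eN + 2) * (eN + 2) * (eN + 2)) + 1) ;;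
  forDown .p (testPrime ;; ifz Reg.u skip scanCuts ;; assign .u 0)

/-- The contents of the variables. -/
structure Store where
  (ans p u q v tot y S A R G B C mode t i e a b : ℕ)

/-- The content of a variable. -/
def Store.get (D : Store) : Reg → ℕ
  | .ans => D.ans | .p => D.p | .u => D.u | .q => D.q | .v => D.v | .tot => D.tot | .y => D.y
  | .S => D.S | .A => D.A | .R => D.R | .G => D.G | .B => D.B | .C => D.C | .mode => D.mode
  | .t => D.t | .i => D.i | .e => D.e | .a => D.a | .b => D.b

end MaxCutProgram

/-! ### Updates of the store, access to the input tables, digits and powers. -/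

namespace MaxCutProgram

open RAM RAM.Expr RAM.Cmd

@[simp] theorem get_ans (D : Store) : D.get .ans = D.ans := rfl
@[simp] theorem get_p (D : Store) : D.get .p = D.p := rfl
@[simp] theorem get_u (D : Store) : D.get .u = D.u := rfl
@[simp] theorem get_q (D : Store) : D.get .q = D.q := rfl
@[simp] theorem get_v (D : Store) : D.get .v = D.v := rfl
@[simp] theorem get_tot (D : Store) : D.get .tot = D.tot := rfl
@[simp] theorem get_y (D : Store) : D.get .y = D.y := rfl
@[simp] theorem get_S (D : Store) : D.get .S = D.S := rfl
@[simp] theorem get_A (D : Store) : D.get .A = D.A := rfl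
@[simp] theorem get_R (D : Store) : D.get .R = D.R := rfl
@[simp] theorem get_G (D : Store) : D.get .G = D.G := rfl
@[simp] theorem get_B (D : Store) : D.get .B = D.B := rfl
@[simp] theorem get_C (D : Store) : D.get .C = D.C := rfl
@[simp] theorem get_mode (D : Store) : D.get .mode = D.mode := rfl
@[simp] theorem get_t (D : Store) : D.get .t = D.t := rfl
@[simp] theorem get_i (D : Store) : D.get .i = D.i := rfl
@[simp] theorem get_e (D : Store) : D.get .e = D.e := rfl
@[simp] theorem get_a (D : Store) : D.get .a = D.a := rfl
@[simp] theorem get_b (D : Store) : D.get .b = D.b := rfl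

@[simp] theorem update_ans (D : Store) (v : ℕ) :
    Function.update D.get .ans v = Store.get {D with ans := v} := by
  funext r; cases r <;> simp

@[simp] theorem update_p (D : Store) (v : ℕ) :
    Function.update D.get .p v = Store.get {D with p := v} := by
  funext r; cases r <;> simp

@[simp] theorem update_u (D : Store) (v : ℕ) :
    Function.update D.get .u v = Store.get {D with u := v} := by
  funext r; cases r <;> simp

@[simp] theorem update_q (D : Store) (v : ℕ) :
    Function.update D.get .q v = Store.get {D with q := v} := by
  funext r; cases r <;> simp

@[simp] theorem update_v (D : Store) (v : ℕ) :
    Function.update D.get .v v = Store.get {D with v := v} := by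
  funext r; cases r <;> simp

@[simp] theorem update_tot (D : Store) (v : ℕ) :
    Function.update D.get .tot v = Store.get {D with tot := v} := by
  funext r; cases r <;> simp

@[simp] theorem update_y (D : Store) (v : ℕ) :
    Function.update D.get .y v = Store.get {D with y := v} := by
  funext r; cases r <;> simp

@[simp] theorem update_S (D : Store) (v : ℕ) :
    Function.update D.get .S v = Store.get {D with S := v} := by
  funext r; cases r <;> simp

@[simp] theorem update_A (D : Store) (v : ℕ) :
    Function.update D.get .A v = Store.get {D with A := v} := by
  funext r; cases r <;> simp

@[simp] theorem update_R (D : Store) (v : ℕ) :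
    Function.update D.get .R v = Store.get {D with R := v} := by
  funext r; cases r <;> simp

@[simp] theorem update_G (D : Store) (v : ℕ) :
    Function.update D.get .G v = Store.get {D with G := v} := by
  funext r; cases r <;> simp

@[simp] theorem update_B (D : Store) (v : ℕ) :
    Function.update D.get .B v = Store.get {D with B := v} := by
  funext r; cases r <;> simp

@[simp] theorem update_C (D : Store) (v : ℕ) :
    Function.update D.get .C v = Store.get {D with C := v} := by
  funext r; cases r <;> simp

@[simp] theorem update_mode (D : Store) (v : ℕ) :
    Function.update D.get .mode v = Store.get {D with mode := v} := by
  funext r; cases r <;> simp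

@[simp] theorem update_i (D : Store) (v : ℕ) :
    Function.update D.get .i v = Store.get {D with i := v} := by
  funext r; cases r <;> simp

@[simp] theorem update_e (D : Store) (v : ℕ) :
    Function.update D.get .e v = Store.get {D with e := v} := by
  funext r; cases r <;> simp

@[simp] theorem update_a (D : Store) (v : ℕ) :
    Function.update D.get .a v = Store.get {D with a := v} := by
  funext r; cases r <;> simp

@[simp] theorem update_b (D : Store) (v : ℕ) :
    Function.update D.get .b v = Store.get {D with b := v} := by
  funext r; cases r <;> simp

section Expressions

variable {x : List ℕ} {B n k N root : ℕ} {par leaf lab : ℕ → ℕ} {ren mat : ℕ → ℕ → ℕ}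
  {s : Reg → ℕ} {a i : Expr Reg}

/-- Addresses and products of three residues are less than `B`. -/
structure Fits (B n k N p : ℕ) : Prop where
  addr : 5 + n * n + N + n + n + N * k + N * (k * k) < B
  cube : p * p * p ≤ B
  digits : k + k + k + k < B

theorem Fits.two_le {p : ℕ} (h : Fits B n k N p) : 2 ≤ B := by have := h.addr; omega

variable (h : Input x n k N root par leaf lab ren mat)

include h

theorem Input.eval_eN : eN.eval x s = n := h.getD_zero
theorem Input.eval_eK : eK.eval x s = k := h.getD_one
theorem Input.eval_eNodes : eNodes.eval x s = N := h.getD_two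
theorem Input.eval_eRoot : eRoot.eval x s = root := h.getD_four

theorem Input.eval_ePar (ha : a.eval x s < N) : (ePar a).eval x s = par (a.eval x s) := by
  simp [ePar, h.eval_eN, -List.getD_eq_getElem?_getD, h.getD_par _ ha]

theorem Input.eval_eLeaf (ha : a.eval x s < n) : (eLeaf a).eval x s = leaf (a.eval x s) := by
  simp [eLeaf, h.eval_eN, h.eval_eNodes, -List.getD_eq_getElem?_getD, h.getD_leaf _ ha]

theorem Input.eval_eLab (ha : a.eval x s < n) : (eLab a).eval x s = lab (a.eval x s) := by
  simp [eLab, h.eval_eN, h.eval_eNodes, -List.getD_eq_getElem?_getD, h.getD_lab _ ha]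

theorem Input.eval_eRen (ha : a.eval x s < N) (hi : i.eval x s < k) :
    (eRen a i).eval x s = ren (a.eval x s) (i.eval x s) := by
  simp [eRen, h.eval_eN, h.eval_eNodes, h.eval_eK, -List.getD_eq_getElem?_getD,
    h.getD_ren _ ha _ hi]

theorem Input.eval_eMat (ha : a.eval x s < N) (hi : i.eval x s < k * k) :
    (eMat a i).eval x s = mat (a.eval x s) (i.eval x s) := by
  simp [eMat, h.eval_eN, h.eval_eNodes, h.eval_eK, -List.getD_eq_getElem?_getD,
    h.getD_mat _ ha _ hi]

theorem Input.eval_eNonRoot : eNonRoot.eval x s = if s .B = root then 0 else 1 := by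
  simp only [eNonRoot, eval_sub, eval_ofNat, eval_absDiff, eval_var, h.eval_eRoot]
  split_ifs <;> omega

variable {p : ℕ} (hB : Fits B n k N p)

include hB

theorem Input.bdd_eN : eN.Bdd x B s := by
  have := hB.addr
  refine (bdd_inp _ _ _ _).2 ⟨show 0 < B by omega, ?_⟩
  rw [show (0 : Expr Reg).eval x s = 0 from rfl, h.getD_zero]
  omega

theorem Input.bdd_eK : eK.Bdd x B s := by
  have := hB.addr
  have := hB.digits
  refine (bdd_inp _ _ _ _).2 ⟨show 1 < B by omega, ?_⟩
  rw [show (1 : Expr Reg).eval x s = 1 from rfl, h.getD_one]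
  omega

theorem Input.bdd_eNodes : eNodes.Bdd x B s := by
  have := hB.addr
  refine (bdd_inp _ _ _ _).2 ⟨show 2 < B by omega, ?_⟩
  rw [show (2 : Expr Reg).eval x s = 2 from rfl, h.getD_two]
  omega

theorem Input.bdd_eRoot : eRoot.Bdd x B s := by
  have := hB.addr
  have := h.root_lt
  refine (bdd_inp _ _ _ _).2 ⟨show 4 < B by omega, ?_⟩
  rw [show (4 : Expr Reg).eval x s = 4 from rfl, h.getD_four]
  omega

theorem Input.bdd_ePar (hb : a.Bdd x B s) (ha : a.eval x s < N) : (ePar a).Bdd x B s := by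
  have := hB.addr
  have h1 := h.eval_ePar ha
  have h2 := (h.getD_par _ ha).2
  simp only [ePar, bdd_inp, bdd_add, bdd_mul, bdd_ofNat, h.bdd_eN hB, hb, eval_add,
    eval_mul, eval_ofNat, h.eval_eN, true_and, eval_inp] at h1 ⊢
  omega

theorem Input.bdd_eLeaf (hb : a.Bdd x B s) (ha : a.eval x s < n) : (eLeaf a).Bdd x B s := by
  have := hB.addr
  have h1 := h.eval_eLeaf ha
  have h2 := (h.getD_leaf _ ha).2
  simp only [eLeaf, bdd_inp, bdd_add, bdd_mul, bdd_ofNat, h.bdd_eN hB, h.bdd_eNodes hB, hb, eval_add,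
    eval_mul, eval_ofNat, h.eval_eN, h.eval_eNodes, true_and, eval_inp] at h1 ⊢
  omega

theorem Input.bdd_eLab (hb : a.Bdd x B s) (ha : a.eval x s < n) : (eLab a).Bdd x B s := by
  have := hB.addr
  have := hB.digits
  have h1 := h.eval_eLab ha
  have h2 := (h.getD_lab _ ha).2
  simp only [eLab, bdd_inp, bdd_add, bdd_mul, bdd_ofNat, h.bdd_eN hB, h.bdd_eNodes hB, hb, eval_add,
    eval_mul, eval_ofNat, h.eval_eN, h.eval_eNodes, true_and, eval_inp] at h1 ⊢
  omega

theorem Input.bdd_eRen (hb : a.Bdd x B s) (hb' : i.Bdd x B s) (ha : a.eval x s < N)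
    (hi : i.eval x s < k) : (eRen a i).Bdd x B s := by
  have := hB.addr
  have := hB.digits
  have h1 := h.eval_eRen ha hi
  have h2 := (h.getD_ren _ ha _ hi).2
  have h3 : a.eval x s * k + k ≤ N * k := by
    rw [← Nat.succ_mul]; exact Nat.mul_le_mul_right _ ha
  simp only [eRen, bdd_inp, bdd_add, bdd_mul, bdd_ofNat, h.bdd_eN hB, h.bdd_eNodes hB, h.bdd_eK hB,
    hb, hb', eval_add, eval_mul, eval_ofNat, h.eval_eN, h.eval_eNodes, h.eval_eK, true_and,
    eval_inp] at h1 ⊢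
  omega

theorem Input.bdd_eMat (hb : a.Bdd x B s) (hb' : i.Bdd x B s) (ha : a.eval x s < N)
    (hi : i.eval x s < k * k) : (eMat a i).Bdd x B s := by
  have := hB.addr
  have h1 := h.eval_eMat ha hi
  have h2 := (h.getD_mat _ ha _ hi).2
  have h3 : a.eval x s * (k * k) + k * k ≤ N * (k * k) := by
    rw [← Nat.succ_mul]; exact Nat.mul_le_mul_right _ ha
  simp only [eMat, bdd_inp, bdd_add, bdd_mul, bdd_ofNat, h.bdd_eN hB, h.bdd_eNodes hB, h.bdd_eK hB,
    hb, hb', eval_add, eval_mul, eval_ofNat, h.eval_eN, h.eval_eNodes, h.eval_eK, true_and,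
    eval_inp] at h1 ⊢
  have h4 : k * k ≤ N * (k * k) := Nat.le_mul_of_pos_left _ (by omega)
  omega

theorem Input.bdd_eNonRoot (hs : ∀ r, s r < B) : eNonRoot.Bdd x B s := by
  have := hB.two_le
  simp only [eNonRoot, bdd_sub, bdd_absDiff, bdd_ofNat, bdd_var, h.bdd_eRoot hB, hs, and_true]
  omega

end Expressions

section Macros

variable {x : List ℕ} {B : ℕ} {s : Reg → ℕ}

/-- The source is divided by `p` repeatedly, and never by a computed power of `p`, so no value
larger than those already present arises. -/
theorem runs_digit (hB : 2 ≤ B) {dst src : Reg} {idx : Expr Reg} (hdt : dst ≠ .t) (hdp : dst ≠ .p)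
    (hst : src ≠ .t) (ht : s .t = 0) (hidx : (∀ r, s r < B) → idx.Bdd x B s) :
    Runs x B (digit dst src idx) s
      (Function.update s dst (s src / s .p ^ idx.eval x s % s .p)) := by
  refine Runs.assign_seq hidx (Runs.assign_seq (fun hs => hs _) ?_)
  have hfor := Runs.forDown (x := x) (B := B) (r := Reg.t)
    (c := Cmd.assign dst ((dst : Expr Reg) / (Reg.p : Expr Reg))) hB
    (σ := fun m a => Function.update (Function.update s .t m) dst a)
    (g := fun _ a => a / s .p) (F := fun m a => a / s .p ^ m) (by simp)
    (fun m a => by rw [pow_succ', Nat.div_div_eq_div_mul])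
    (fun m a => by simp [hdt.symm])
    (idx.eval x s) (fun m _ a => Runs.assign (fun hs => (bdd_div _ _ _ _ _).2 ⟨hs _, hs _⟩) (by
      funext r
      by_cases h1 : r = dst
      · subst h1; simp [hdt, hdp.symm]
      · by_cases h2 : r = .t
        · subst h2; simp [h1]
        · simp [h1, h2])) (s src)
  simp only [eval_var, Function.update_of_ne hst]
  refine Runs.seq hfor (Runs.assign (fun hs => (bdd_mod _ _ _ _ _).2 ⟨hs _, hs _⟩) ?_)
  funext r
  by_cases h1 : r = dst
  · subst h1; simp [hdp.symm]
  · by_cases h2 : r = .t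
    · subst h2; simp [h1, ht]
    · simp [h1, h2]

/-- The accumulator is tracked as an element of `ZMod p`, so that the loop is described by powers in
the field. The base is limited to two variables that the loop does not change. -/
theorem runs_mulPow {p : ℕ} [Fact p.Prime] (hpB : p * p * p ≤ B) (D : Store) {base : Reg}
    (hbase : base = .b ∨ base = .y) (hp : D.p = p) (hb : D.get base ≤ p) (r : ZMod p)
    (hr : D.R = r.val) :
    Runs x B (mulPow base) D.get
      (Store.get {D with e := 0, R := (r * (D.get base : ZMod p) ^ D.e).val}) := by
  have hp2 := (Fact.out : p.Prime).two_le
  have hB : p * p < B := by nlinarith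
  have hget : ∀ m a, Store.get {D with e := m, R := a} base = D.get base := by
    intro m a
    rcases hbase with rfl | rfl <;> rfl
  have hfor := Runs.forDown (x := x) (B := B) (r := Reg.e)
    (c := Cmd.assign .R ((Reg.R : Expr Reg) * (base : Expr Reg) % (Reg.p : Expr Reg)))
    (by nlinarith) (σ := fun m (r : ZMod p) => Store.get {D with e := m, R := r.val})
    (g := fun _ r => r * (D.get base : ZMod p)) (F := fun m r => r * (D.get base : ZMod p) ^ m)
    (by simp) (fun m a => by ring) (fun m a => rfl)
    D.e (fun m _ a => by
      refine Runs.assign (fun hs => ?_) ?_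
      · have h1 : a.val * D.get base ≤ p * p := Nat.mul_le_mul a.val_lt.le hb
        have h2 := hs base
        have h3 := hs .p
        have h4 := hs .R
        simp only [update_e, bdd_mod, bdd_mul, bdd_var, eval_var, hget] at h2 h3 h4 ⊢
        exact ⟨⟨h4, h2, h1.trans_lt hB⟩, h3⟩
      · have : ((a * (D.get base : ZMod p)).val) = a.val * D.get base % D.p := by
          rw [hp, ZMod.val_mul, ZMod.val_natCast, Nat.mul_mod_mod]
        simp only [update_e, update_R, eval_mod, eval_mul, eval_var, hget, get_R, get_p, this]) r
  have hD : D = {D with R := r.val, e := D.e} := by cases D; simp_all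
  rw [hD]
  simp only [hget]
  exact hfor

end Macros

end MaxCutProgram

/-! ### The three factors of the weight of a guess. -/

namespace MaxCutProgram

open RAM RAM.Expr RAM.Cmd

section Weights

variable {x : List ℕ} {B n k N root : ℕ} {par leaf lab : ℕ → ℕ} {ren mat : ℕ → ℕ → ℕ}

theorem runs_digit_seq (hB : 2 ≤ B) {dst src : Reg} {idx : Expr Reg} {c : Cmd Reg}
    {s s' : Reg → ℕ} (hdt : dst ≠ .t) (hdp : dst ≠ .p)
    (hst : src ≠ .t) (ht : s .t = 0) (hidx : (∀ r, s r < B) → idx.Bdd x B s)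
    (h : Runs x B c (Function.update s dst (s src / s .p ^ idx.eval x s % s .p)) s') :
    Runs x B (digit dst src idx ;; c) s s' :=
  (runs_digit hB hdt hdp hst ht hidx).seq h

theorem runs_mulPow_seq {p : ℕ} [Fact p.Prime] (hpB : p * p * p ≤ B) {D : Store} {base : Reg}
    {c : Cmd Reg} {s' : Reg → ℕ}
    (hbase : base = .b ∨ base = .y) (hp : D.p = p) (hb : D.get base ≤ p) (r : ZMod p)
    (hr : D.R = r.val)
    (h : Runs x B c (Store.get {D with e := 0, R := (r * (D.get base : ZMod p) ^ D.e).val}) s') :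
    Runs x B (mulPow base ;; c) D.get s' :=
  (runs_mulPow hpB D hbase hp hb r hr).seq h

/-- The digit number `i` of `g` in base `p`. -/
def dig (p g i : ℕ) : ℕ := g / p ^ i % p

theorem dig_lt {p : ℕ} [hp : Fact p.Prime] (g i : ℕ) : dig p g i < p :=
  Nat.mod_lt _ hp.out.pos

variable (hI : Input x n k N root par leaf lab ren mat)
  {p : ℕ} [Fact p.Prime] (hB : Fits B n k N p) (ans u q v tot y S A G b C mode : ℕ) (r : ZMod p)

include hI hB

theorem runs_leafWeight :
    Runs x B leafWeight
      (Store.get ⟨ans, p, u, q, v, tot, y, S, A, r.val, G, b, C, mode, 0, 0, 0, 0, 0⟩)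
      (Store.get ⟨ans, p, u, q, v, tot, y, S, A, (r * ∏ v ∈ Finset.range n, if leaf v = b then
        ((dig p G (k + k + lab v) : ZMod p) + (dig p G (k + k + k + lab v) : ZMod p)) else 1).val,
        G, b, C, mode, 0, 0, 0, 0, 0⟩) := by
  have hp2 := (Fact.out : p.Prime).two_le
  have hcube := hB.cube
  have hdig := hB.digits
  refine Runs.assign_seq (fun _ => hI.bdd_eN hB) ?_
  rw [hI.eval_eN, update_i]
  refine Runs.forDown hB.two_le (r := .i)
    (σ := fun m (r : ZMod p) => Store.get
      ⟨ans, p, u, q, v, tot, y, S, A, r.val, G, b, C, mode, 0, m, 0, 0, 0⟩)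
    (g := fun m r => r * if leaf m = b then
        ((dig p G (k + k + lab m) : ZMod p) + (dig p G (k + k + k + lab m) : ZMod p)) else 1)
    (F := fun K r => r * ∏ v ∈ Finset.range K, if leaf v = b then
        ((dig p G (k + k + lab v) : ZMod p) + (dig p G (k + k + k + lab v) : ZMod p)) else 1)
    (by simp) (fun m a => by rw [Finset.prod_range_succ]; ring) (fun _ _ => rfl) n ?_ r
  intro m hm r
  rw [update_i]
  simp only
  have hlf : ∀ D : Store, D.i = m → (eLeaf Reg.i).eval x D.get = leaf m := fun D h => by
    subst h; exact hI.eval_eLeaf hm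
  have hlb : ∀ D : Store, D.i = m → (eLab Reg.i).eval x D.get = lab m := fun D h => by
    subst h; exact hI.eval_eLab hm
  have hblb : ∀ D : Store, D.i = m → m < B → (eLab Reg.i).Bdd x B D.get := fun D h h' => by
    subst h; exact hI.bdd_eLab hB h' hm
  have hbdd : ∀ D : Store, D.i = m → (∀ r, D.get r < B) →
      (absDiff (eLeaf Reg.i) Reg.B).Bdd x B D.get := fun D h h' => by
    subst h; exact (bdd_absDiff _ _ _ _ _).2 ⟨hI.bdd_eLeaf hB (h' _) hm, h' _⟩
  have hlab := (hI.getD_lab m hm).2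
  by_cases hv : leaf m = b
  · refine Runs.ifz_zero (hbdd _ rfl) (by simp [hlf, hv]) ?_
    refine runs_digit_seq hB.two_le (by decide) (by decide) (by decide) rfl (fun hs => ?_) ?_
    · have := hs .i
      simp only [get_i] at this
      simp only [bdd_add, hI.bdd_eK hB, hblb, this, eval_add, hI.eval_eK, hlb, true_and]
      omega
    refine runs_digit_seq hB.two_le (by decide) (by decide) (by decide) rfl (fun hs => ?_) ?_
    · have := hs .i
      simp only [update_a, get_i] at this ⊢
      simp only [bdd_add, hI.bdd_eK hB, hblb, this, eval_add, hI.eval_eK, hlb, true_and]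
      omega
    simp only [update_a, update_b, eval_add, hI.eval_eK, hlb, get_G, get_p]
    have h1 := dig_lt (p := p) G (k + k + lab m)
    have h2 := dig_lt (p := p) G (k + k + k + lab m)
    have h0 := r.val_lt
    refine Runs.assign_seq (fun hs => ?_) (Runs.assign_seq (fun hs => ?_)
      (Runs.assign (fun hs => ?_) ?_))
    · have ha := hs .a
      have hb := hs .b
      have hR := hs .R
      have hP := hs .p
      simp only [bdd_mod, bdd_mul, bdd_add, bdd_var, eval_add, eval_var] at *
      simp only [get_a, get_b, get_R, get_p] at *
      change dig p G (k + k + lab m) < B at ha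
      change dig p G (k + k + k + lab m) < B at hb
      refine ⟨⟨hR, ⟨ha, hb, ?_⟩, ?_⟩, hP⟩
      · change dig p G (k + k + lab m) + dig p G (k + k + k + lab m) < B
        nlinarith
      · change r.val * (dig p G (k + k + lab m) + dig p G (k + k + k + lab m)) < B
        calc _ < p * (p + p) := Nat.mul_lt_mul'' h0 (by omega)
          _ ≤ p * p * p := by nlinarith
          _ ≤ B := hcube
    · have := hB.two_le
      exact show 0 < B by omega
    · have := hB.two_le
      exact show 0 < B by omega
    · simp only [update_R, update_a, update_b, eval_ofNat, eval_mod, eval_mul, eval_add, eval_var,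
        get_R, get_a, get_b, get_p, hv, if_true]
      have : (r * ((dig p G (k + k + lab m) : ZMod p) + (dig p G (k + k + k + lab m) : ZMod p))).val
          = r.val * (dig p G (k + k + lab m) + dig p G (k + k + k + lab m)) % p := by
        rw [ZMod.val_mul, ← Nat.cast_add, ZMod.val_natCast, Nat.mul_mod_mod]
      rw [this]
      rfl
  · refine Runs.ifz_ne (hbdd _ rfl) ?_ ?_
    · simp only [eval_absDiff, hlf, eval_var, get_B]
      omega
    · simp only [hv, if_false, mul_one]
      exact Runs.skip

theorem runs_profileWeight (hb : b < N) :
    Runs x B profileWeight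
      (Store.get ⟨ans, p, u, q, v, tot, y, S, A, r.val, G, b, C, mode, 0, 0, 0, 0, 0⟩)
      (Store.get ⟨ans, p, u, q, v, tot, y, S, A, (r * ∏ i ∈ Finset.range (k + k),
        ((dig p G (k + k + i) : ZMod p) ^ (p - 1 - dig p G i) *
          (dig p S (k + k + (ren b (i % k) + k * (i / k))) : ZMod p) ^
            (dig p G i * if b = root then 0 else 1))).val,
        G, b, C, mode, 0, 0, 0, 0, 0⟩) := by
  have hp2 := (Fact.out : p.Prime).two_le
  have hcube := hB.cube
  have hdigits := hB.digits
  have htwo := hB.two_le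
  have hpB : p < B := by nlinarith
  refine Runs.assign_seq (fun _ => ?_) ?_
  · simp only [bdd_add, hI.bdd_eK hB, hI.eval_eK, true_and]
    omega
  rw [eval_add, hI.eval_eK, update_i]
  refine Runs.forDown hB.two_le (r := .i)
    (σ := fun m (r : ZMod p) => Store.get
      ⟨ans, p, u, q, v, tot, y, S, A, r.val, G, b, C, mode, 0, m, 0, 0, 0⟩)
    (g := fun i r => r * ((dig p G (k + k + i) : ZMod p) ^ (p - 1 - dig p G i) *
          (dig p S (k + k + (ren b (i % k) + k * (i / k))) : ZMod p) ^
            (dig p G i * if b = root then 0 else 1)))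
    (F := fun K r => r * ∏ i ∈ Finset.range K,
        ((dig p G (k + k + i) : ZMod p) ^ (p - 1 - dig p G i) *
          (dig p S (k + k + (ren b (i % k) + k * (i / k))) : ZMod p) ^
            (dig p G i * if b = root then 0 else 1)))
    (by simp) (fun m a => by rw [Finset.prod_range_succ]; ring) (fun _ _ => rfl) (k + k) ?_ r
  intro m hm r
  rw [update_i]
  simp only
  have hk : 0 < k := by omega
  have hmod : m % k < k := Nat.mod_lt _ hk
  -- The quotient `m / k` is the colour, `0` or `1`.
  have hmul : k * (m / k) ≤ k := by
    have : m / k < 2 := Nat.div_lt_of_lt_mul (by omega)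
    nlinarith
  have hren := (hI.getD_ren b hb _ hmod).2
  have hrn : ∀ D : Store, D.i = m → D.B = b →
      (eRen Reg.B (Reg.i % eK)).eval x D.get = ren b (m % k) := fun D h h' => by
    subst h h'
    have e : ((Reg.i : Expr Reg) % eK).eval x D.get = D.i % k := by simp [hI.eval_eK]
    rw [hI.eval_eRen (a := (Reg.B : Expr Reg)) (s := D.get) hb (by rwa [e]), e]
    rfl
  have hbrn : ∀ D : Store, D.i = m → D.B = b → (∀ r, D.get r < B) →
      (eRen Reg.B (Reg.i % eK)).Bdd x B D.get := fun D h h' hs => by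
    subst h h'
    have e : ((Reg.i : Expr Reg) % eK).eval x D.get = D.i % k := by simp [hI.eval_eK]
    exact hI.bdd_eRen hB (hs _) ((bdd_mod _ _ _ _ _).2 ⟨hs _, hI.bdd_eK hB⟩) hb (by rwa [e])
  have ha := dig_lt (p := p) G m
  refine runs_digit_seq htwo (by decide) (by decide) (by decide) rfl (fun hs => hs _) ?_
  simp only [update_a, eval_var, get_i, get_G, get_p]
  refine runs_digit_seq htwo (by decide) (by decide) (by decide) rfl (fun hs => ?_) ?_
  · have := hs .i
    simp only [get_i] at this
    simp only [bdd_add, hI.bdd_eK hB, eval_add, hI.eval_eK, true_and, bdd_var, eval_var, get_i]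
    omega
  simp only [update_b, eval_var, eval_add, hI.eval_eK, get_i, get_G, get_p]
  refine Runs.assign_seq (fun hs => ?_) ?_
  · have h1 := hs .p
    have h2 := hs .a
    exact (bdd_sub _ _ _ _ _).2 ⟨(bdd_sub _ _ _ _ _).2 ⟨h1, htwo⟩, h2⟩
  simp only [update_e, eval_sub, eval_var, eval_ofNat, get_p, get_a]
  refine runs_mulPow_seq hcube (Or.inl rfl) rfl (dig_lt (p := p) G (k + k + m)).le r rfl ?_
  simp only [get_b]
  refine runs_digit_seq htwo (by decide) (by decide) (by decide) rfl (fun hs => ?_) ?_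
  · have h1 := hs .i
    simp only [get_i] at h1
    simp only [bdd_add, bdd_mul, bdd_div, hI.bdd_eK hB, eval_add, eval_mul, eval_div, hI.eval_eK,
      true_and, bdd_var, eval_var, get_i, hrn, hbrn _ rfl rfl hs, h1, and_true]
    omega
  simp only [update_b, eval_var, eval_add, eval_mul, eval_div, hI.eval_eK, hrn, get_i, get_S, get_p]
  refine Runs.assign_seq (fun hs => ?_) ?_
  · have h2 := hs .a
    refine (bdd_mul _ _ _ _ _).2 ⟨h2, hI.bdd_eNonRoot hB hs, ?_⟩
    rw [hI.eval_eNonRoot]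
    refine lt_of_le_of_lt ?_ h2
    split_ifs
    · simp
    · rw [mul_one]; rfl
  simp only [update_e, eval_mul, eval_var, hI.eval_eNonRoot, get_B, get_a]
  refine runs_mulPow_seq hcube (Or.inl rfl) rfl
    (dig_lt (p := p) S (k + k + (ren b (m % k) + k * (m / k)))).le _ rfl ?_
  refine Runs.assign_seq (fun _ => show 0 < B by omega)
    (Runs.assign (fun _ => show 0 < B by omega) ?_)
  simp only [update_a, update_b, eval_ofNat, get_b, mul_assoc]
  rfl

theorem runs_pairWeight (hy : y < p) (hb : b < N) :
    Runs x B pairWeight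
      (Store.get ⟨ans, p, u, q, v, tot, y, S, A, r.val, G, b, C, mode, 0, 0, 0, 0, 0⟩)
      (Store.get ⟨ans, p, u, q, v, tot, y, S, A, (r * ∏ i ∈ Finset.range (k * k), (y : ZMod p) ^
        (dig p G (i / k) * dig p G (k + i % k) * (mat b i + (if b = root then 0 else 1) * (p - 2) *
          mat (par b) (ren b (i / k) * k + ren b (i % k))))).val,
        G, b, C, mode, 0, 0, 0, 0, 0⟩) := by
  have hp2 := (Fact.out : p.Prime).two_le
  have hcube := hB.cube
  have hdigits := hB.digits
  have htwo := hB.two_le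
  have haddr := hB.addr
  have hpB : p < B := by nlinarith
  have hkk : k * k ≤ N * (k * k) := Nat.le_mul_of_pos_left _ (by omega)
  refine Runs.assign_seq (fun _ => ?_) ?_
  · simp only [bdd_mul, hI.bdd_eK hB, hI.eval_eK, true_and]
    omega
  rw [eval_mul, hI.eval_eK, update_i]
  refine Runs.forDown hB.two_le (r := .i)
    (σ := fun m (r : ZMod p) => Store.get
      ⟨ans, p, u, q, v, tot, y, S, A, r.val, G, b, C, mode, 0, m, 0, 0, 0⟩)
    (g := fun i r => r * (y : ZMod p) ^
        (dig p G (i / k) * dig p G (k + i % k) * (mat b i + (if b = root then 0 else 1) * (p - 2) *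
          mat (par b) (ren b (i / k) * k + ren b (i % k)))))
    (F := fun K r => r * ∏ i ∈ Finset.range K, (y : ZMod p) ^
        (dig p G (i / k) * dig p G (k + i % k) * (mat b i + (if b = root then 0 else 1) * (p - 2) *
          mat (par b) (ren b (i / k) * k + ren b (i % k)))))
    (by simp) (fun m a => by rw [Finset.prod_range_succ]; ring) (fun _ _ => rfl) (k * k) ?_ r
  intro m hm r
  rw [update_i]
  simp only
  have hk : 0 < k := Nat.pos_of_ne_zero (by rintro rfl; simp at hm)
  have hmod : m % k < k := Nat.mod_lt _ hk
  have hdiv : m / k < k := Nat.div_lt_of_lt_mul hm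
  have hren := (hI.getD_ren b hb _ hmod).2
  have hren' := (hI.getD_ren b hb _ hdiv).2
  have hpar := (hI.getD_par b hb).2
  have hcell : ren b (m / k) * k + ren b (m % k) < k * k := by nlinarith
  have hrn : ∀ D : Store, D.i = m → D.B = b →
      (eRen Reg.B (Reg.i % eK)).eval x D.get = ren b (m % k) := fun D h h' => by
    subst h h'
    have e : ((Reg.i : Expr Reg) % eK).eval x D.get = D.i % k := by simp [hI.eval_eK]
    rw [hI.eval_eRen (a := (Reg.B : Expr Reg)) (s := D.get) hb (by rwa [e]), e]
    rfl
  have hbrn : ∀ D : Store, D.i = m → D.B = b → (∀ r, D.get r < B) →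
      (eRen Reg.B (Reg.i % eK)).Bdd x B D.get := fun D h h' hs => by
    subst h h'
    have e : ((Reg.i : Expr Reg) % eK).eval x D.get = D.i % k := by simp [hI.eval_eK]
    exact hI.bdd_eRen hB (hs _) ((bdd_mod _ _ _ _ _).2 ⟨hs _, hI.bdd_eK hB⟩) hb (by rwa [e])
  have hrn' : ∀ D : Store, D.i = m → D.B = b →
      (eRen Reg.B (Reg.i / eK)).eval x D.get = ren b (m / k) := fun D h h' => by
    subst h h'
    have e : ((Reg.i : Expr Reg) / eK).eval x D.get = D.i / k := by simp [hI.eval_eK]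
    rw [hI.eval_eRen (a := (Reg.B : Expr Reg)) (s := D.get) hb (by rwa [e]), e]
    rfl
  have hbrn' : ∀ D : Store, D.i = m → D.B = b → (∀ r, D.get r < B) →
      (eRen Reg.B (Reg.i / eK)).Bdd x B D.get := fun D h h' hs => by
    subst h h'
    have e : ((Reg.i : Expr Reg) / eK).eval x D.get = D.i / k := by simp [hI.eval_eK]
    exact hI.bdd_eRen hB (hs _) ((bdd_div _ _ _ _ _).2 ⟨hs _, hI.bdd_eK hB⟩) hb (by rwa [e])
  have hpr : ∀ D : Store, D.B = b → (ePar Reg.B).eval x D.get = par b := fun D h => by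
    subst h; exact hI.eval_ePar hb
  have hbpr : ∀ D : Store, D.B = b → (∀ r, D.get r < B) → (ePar Reg.B).Bdd x B D.get :=
    fun D h hs => by subst h; exact hI.bdd_ePar hB (hs _) hb
  have hmt : ∀ D : Store, D.i = m → D.B = b → (eMat Reg.B Reg.i).eval x D.get = mat b m :=
    fun D h h' => by subst h h'; exact hI.eval_eMat hb hm
  have hbmt : ∀ D : Store, D.i = m → D.B = b → (∀ r, D.get r < B) →
      (eMat Reg.B Reg.i).Bdd x B D.get := fun D h h' hs => by
    subst h h'; exact hI.bdd_eMat hB (hs _) (hs _) hb hm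
  have hcl : ∀ D : Store, D.i = m → D.B = b →
      (eRen Reg.B (Reg.i / eK) * eK + eRen Reg.B (Reg.i % eK)).eval x D.get =
        ren b (m / k) * k + ren b (m % k) := fun D h h' => by
    simp only [eval_add, eval_mul, hrn _ h h', hrn' _ h h', hI.eval_eK]
  have hmt' : ∀ D : Store, D.i = m → D.B = b →
      (eMat (ePar Reg.B) (eRen Reg.B (Reg.i / eK) * eK + eRen Reg.B (Reg.i % eK))).eval x D.get =
        mat (par b) (ren b (m / k) * k + ren b (m % k)) := fun D h h' => by
    rw [hI.eval_eMat (by rwa [hpr _ h']) (by rwa [hcl _ h h']), hpr _ h', hcl _ h h']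
  have hbmt' : ∀ D : Store, D.i = m → D.B = b → (∀ r, D.get r < B) →
      (eMat (ePar Reg.B) (eRen Reg.B (Reg.i / eK) * eK + eRen Reg.B (Reg.i % eK))).Bdd x B D.get :=
    fun D h h' hs => by
    refine hI.bdd_eMat hB (hbpr _ h' hs) ?_ (by rwa [hpr _ h']) (by rwa [hcl _ h h'])
    simp only [bdd_add, bdd_mul, hbrn _ h h' hs, hbrn' _ h h' hs, hI.bdd_eK hB, eval_mul,
      hrn _ h h', hrn' _ h h', hI.eval_eK, true_and]
    omega
  have hm1 := (hI.getD_mat b hb m hm).2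
  have hm2 := (hI.getD_mat (par b) hpar _ hcell).2
  have ha := dig_lt (p := p) G (m / k)
  have ha' := dig_lt (p := p) G (k + m % k)
  refine runs_digit_seq htwo (by decide) (by decide) (by decide) rfl
    (fun hs => (bdd_div _ _ _ _ _).2 ⟨hs _, hI.bdd_eK hB⟩) ?_
  simp only [update_a, eval_var, eval_div, hI.eval_eK, get_i, get_G, get_p]
  refine runs_digit_seq htwo (by decide) (by decide) (by decide) rfl (fun hs => ?_) ?_
  · have := hs .i
    simp only [get_i] at this
    simp only [bdd_add, bdd_mod, hI.bdd_eK hB, eval_mod, hI.eval_eK, true_and, bdd_var, eval_var,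
      get_i, and_true]
    omega
  simp only [update_b, eval_var, eval_add, eval_mod, hI.eval_eK, get_i, get_G, get_p]
  refine Runs.assign_seq (fun hs => ?_) ?_
  · have h1 := hs .p
    have h2 := hs .a
    have h3 := hs .b
    have hnr : (if b = root then 0 else 1) ≤ 1 := by split_ifs <;> omega
    have h4 : (if b = root then 0 else 1) * (p - 2) ≤ p - 2 := by
      calc _ ≤ 1 * (p - 2) := Nat.mul_le_mul_right _ hnr
        _ = p - 2 := one_mul _
    have h5 : (if b = root then 0 else 1) * (p - 2) *
        mat (par b) (ren b (m / k) * k + ren b (m % k)) ≤ p - 2 := by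
      calc _ ≤ (p - 2) * 1 := Nat.mul_le_mul h4 hm2
        _ = p - 2 := mul_one _
    have h6 : dig p G (m / k) * dig p G (k + m % k) < p * p := Nat.mul_lt_mul'' ha ha'
    -- Matrix entries are at most `1`, so the excess is at most `1 + (p - 2) < p`, and the exponent
    -- stays below `p * p * p`.
    have h7 : dig p G (m / k) * dig p G (k + m % k) * (mat b m + (if b = root then 0 else 1) *
        (p - 2) * mat (par b) (ren b (m / k) * k + ren b (m % k))) < p * p * p :=
      Nat.mul_lt_mul'' h6 (by omega)
    have hpp : p * p ≤ p * p * p := Nat.le_mul_of_pos_right _ (by omega)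
    simp only [get_a, get_b, get_p] at h1 h2 h3
    simp only [bdd_mul, bdd_add, bdd_sub, bdd_var, bdd_ofNat, hI.bdd_eNonRoot hB hs,
      hbmt _ rfl rfl hs, hbmt' _ rfl rfl hs, eval_mul, eval_add, eval_sub, eval_var, eval_ofNat,
      hI.eval_eNonRoot, hmt, hmt', get_a, get_b, get_p, get_B, h1, h2, h3, true_and]
    refine ⟨h6.trans_le (hpp.trans hcube), ⟨⟨?_, ?_⟩, ?_⟩, ?_⟩
    · exact ⟨by omega, h4.trans_lt (by omega)⟩
    · exact h5.trans_lt (by omega)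
    · exact (Nat.add_le_add hm1 h5).trans_lt (by omega)
    · exact h7.trans_le hcube
  simp only [update_e, eval_mul, eval_add, eval_sub, eval_var, eval_ofNat, hI.eval_eNonRoot, hmt,
    hmt', get_a, get_b, get_p, get_B]
  refine runs_mulPow_seq hcube (Or.inr rfl) rfl hy.le r rfl ?_
  refine Runs.assign_seq (fun _ => show 0 < B by omega)
    (Runs.assign (fun _ => show 0 < B by omega) ?_)
  simp only [update_a, update_b, eval_ofNat, get_y]
  rfl

end Weights

end MaxCutProgram

/-! ### Guesses as numbers, and the recursion in terms of the input tables. -/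

namespace MaxCutProgram

open LabelledTree

/-- The tables of a tree-model as functions of numbers, where the nodes are numbered by `e`. -/
structure Tables {n k N : ℕ} {T : RootedTree} (L : LabelledTree (Fin n) k T) (e : T ≃ Fin N)
    (par leaf lab : ℕ → ℕ) (ren mat : ℕ → ℕ → ℕ) : Prop where
  par : ∀ a : T, par (e a) = e (Order.pred a)
  leaf : ∀ v : Fin n, leaf v = e (L.leaf v)
  lab : ∀ v : Fin n, lab v = L.label v
  ren : ∀ a : T, ∀ i : Fin k, ren (e a) i = L.rename a i
  mat : ∀ a : T, ∀ i j : Fin k, mat (e a) (i * k + j) = (L.mat a i j).toNat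

/-- The position of a colour and a label in a profile. -/
def profileEquiv (k : ℕ) : Fin 2 × Fin k ≃ Fin (k + k) :=
  finProdFinEquiv.trans (finCongr (two_mul k))

@[simp] theorem profileEquiv_val {k : ℕ} (q : Fin 2 × Fin k) :
    (profileEquiv k q : ℕ) = q.2 + k * q.1 := rfl

section Digits

variable {p k : ℕ}

/-- A guess is a number whose digits are two profiles. -/
def guessEquiv (p k : ℕ) : (Fin 2 × Fin k → Fin p) × (Fin 2 × Fin k → Fin p) ≃
    Fin (p ^ (k + k + (k + k))) :=
  (Equiv.sumArrowEquivProdArrow _ _ _).symm.trans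
    ((Equiv.arrowCongr ((Equiv.sumCongr (profileEquiv k) (profileEquiv k)).trans finSumFinEquiv)
      (Equiv.refl _)).trans finFunctionFinEquiv)

/-- The digits of the number `g` from position `2k` on, as a point. -/
def point (p k g : ℕ) (q : Fin 2 × Fin k) : ZMod p := (dig p g (k + k + (q.2 + k * q.1)) : ZMod p)

theorem sum_profiles {R : Type*} [AddCommMonoid R]
    (f : (Fin 2 × Fin k → ℕ) → (Fin 2 × Fin k → ℕ) → R) :
    ∑ s : Fin 2 × Fin k → Fin p, ∑ w : Fin 2 × Fin k → Fin p,
      f (fun q => s q) (fun q => w q) =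
    ∑ g ∈ Finset.range (p ^ (k + k + (k + k))), f (fun q => dig p g (q.2 + k * q.1))
      (fun q => dig p g (k + k + (q.2 + k * q.1))) := by
  rw [Finset.sum_range, ← Fintype.sum_prod_type'
    (f := fun (s w : Fin 2 × Fin k → Fin p) => f (fun q => s q) (fun q => w q))]
  refine Fintype.sum_equiv (guessEquiv p k) _ _ fun sw => ?_
  -- Going from `g` to its digits is the direction in which the equivalence computes, so the terms
  -- then agree by definition.
  obtain ⟨g, rfl⟩ := (guessEquiv p k).symm.surjective sw
  rw [Equiv.apply_symm_apply]
  rfl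

/-- All the digits that are read lie among the lowest `4k`, so what is deeper in the stack does not
matter. -/
theorem point_mod (σ : ℕ) : point p k (σ % p ^ (k + k + (k + k))) = point p k σ := by
  funext q
  have hlt : k + k + ((q.2 : ℕ) + k * q.1) < k + k + (k + k) := by
    have := (profileEquiv k q).2
    rw [profileEquiv_val] at this
    omega
  obtain ⟨j, hj⟩ := Nat.exists_eq_add_of_lt hlt
  simp only [point, dig]
  rw [hj, show k + k + ((q.2 : ℕ) + k * q.1) + j + 1 = k + k + ((q.2 : ℕ) + k * q.1) + (j + 1) by rfl,
    pow_add, Nat.mod_mul_right_div_self, Nat.mod_mod_of_dvd _ (dvd_pow_self _ (by omega))]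

end Digits

section NodeTerm

variable {n k N p : ℕ} {T : RootedTree} [Fintype T] (L : LabelledTree (Fin n) k T) (e : T ≃ Fin N)
  {par leaf lab : ℕ → ℕ} {ren mat : ℕ → ℕ → ℕ}

/-- The weight of a guess `g` at the node number `b` with the guess of the parent at the end
of `σ`. -/
def guessWeight (p n k root : ℕ) (par leaf lab : ℕ → ℕ) (ren mat : ℕ → ℕ → ℕ) (y b σ g : ℕ) :
    ZMod p :=
  (∏ v ∈ Finset.range n, if leaf v = b then
    ((dig p g (k + k + lab v) : ZMod p) + (dig p g (k + k + k + lab v) : ZMod p)) else 1) *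
  (∏ i ∈ Finset.range (k + k), ((dig p g (k + k + i) : ZMod p) ^ (p - 1 - dig p g i) *
    (dig p σ (k + k + (ren b (i % k) + k * (i / k))) : ZMod p) ^
      (dig p g i * if b = root then 0 else 1))) *
  (∏ i ∈ Finset.range (k * k), (y : ZMod p) ^
    (dig p g (i / k) * dig p g (k + i % k) * (mat b i + (if b = root then 0 else 1) * (p - 2) *
      mat (par b) (ren b (i / k) * k + ren b (i % k)))))

-- This is `gen_eq` in the form in which the machine computes it: the tree is replaced by tables,
-- and the double sum over profiles and points by one loop over numbers.
open scoped Classical in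
theorem gen_eq_sum_guessWeight [Fact p.Prime] (hT : Tables L e par leaf lab ren mat)
    (hp : n < p - 1) (y σ : ℕ) (b : T) :
    L.gen (y : ZMod p) b (point p k σ) = ∑ g ∈ Finset.range (p ^ (k + k + (k + k))),
      guessWeight p n k (e ⊥) par leaf lab ren mat y (e b) σ g *
        ∏ c ∈ children T b, L.gen (y : ZMod p) c (point p k g) := by
  rw [L.gen_eq (by simpa using hp)]
  rw [sum_profiles (p := p) (fun s w =>
      (∏ ij : Fin k × Fin k, (y : ZMod p) ^ (s (0, ij.1) * s (1, ij.2) *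
        L.excess p b ij.1 ij.2)) *
      (∏ q, (w q : ZMod p) ^ (p - 1 - s q) *
        point p k σ (q.1, L.rename b q.2) ^ ((if b = ⊥ then 0 else 1) * s q)) *
      ((∏ c ∈ children T b, L.gen (y : ZMod p) c fun q => (w q : ZMod p)) *
        ∏ v ∈ Finset.univ.filter (fun v => (L.leaf v : T) = b),
          ((w (0, L.label v) : ZMod p) + (w (1, L.label v) : ZMod p))))]
  refine Finset.sum_congr rfl fun g _ => ?_
  have hroot : ((e b : ℕ) = e ⊥) ↔ b = ⊥ := by
    rw [Fin.val_inj, e.apply_eq_iff_eq]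
  have h1 : (∏ v ∈ Finset.range n, if leaf v = e b then
      ((dig p g (k + k + lab v) : ZMod p) + (dig p g (k + k + k + lab v) : ZMod p)) else 1) =
      ∏ v ∈ Finset.univ.filter (fun v => (L.leaf v : T) = b),
        ((dig p g (k + k + ((L.label v : ℕ) + k * (0 : Fin 2))) : ZMod p) +
          (dig p g (k + k + ((L.label v : ℕ) + k * (1 : Fin 2))) : ZMod p)) := by
    rw [Finset.prod_range, Finset.prod_filter]
    refine Finset.prod_congr rfl fun v _ => ?_
    have : leaf v = e b ↔ (L.leaf v : T) = b := by
      rw [hT.leaf, Fin.val_inj, e.apply_eq_iff_eq]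
    simp only [this, hT.lab]
    rw [show k + k + ((L.label v : ℕ) + k * ((0 : Fin 2) : ℕ)) = k + k + L.label v by simp,
      show k + k + ((L.label v : ℕ) + k * ((1 : Fin 2) : ℕ)) = k + k + k + L.label v by simp; omega]
  have h2 : (∏ i ∈ Finset.range (k + k), ((dig p g (k + k + i) : ZMod p) ^ (p - 1 - dig p g i) *
      (dig p σ (k + k + (ren (e b) (i % k) + k * (i / k))) : ZMod p) ^
        (dig p g i * if (e b : ℕ) = e ⊥ then 0 else 1))) =
      ∏ q : Fin 2 × Fin k, (dig p g (k + k + (q.2 + k * q.1)) : ZMod p) ^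
        (p - 1 - dig p g (q.2 + k * q.1)) * point p k σ (q.1, L.rename b q.2) ^
          ((if b = ⊥ then 0 else 1) * dig p g (q.2 + k * q.1)) := by
    rw [Finset.prod_range, ← (profileEquiv k).prod_comp]
    refine Finset.prod_congr rfl fun q _ => ?_
    have hk : 0 < k := q.2.pos
    have hmod : ((q.2 : ℕ) + k * q.1) % k = q.2 := by simp [Nat.mod_eq_of_lt q.2.2]
    have hdiv : ((q.2 : ℕ) + k * q.1) / k = q.1 := by
      rw [Nat.add_mul_div_left _ _ hk, Nat.div_eq_of_lt q.2.2, zero_add]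
    simp only [profileEquiv_val, hmod, hdiv, hT.ren, hroot, point]
    rw [mul_comm (dig p g ((q.2 : ℕ) + k * q.1)) (if b = ⊥ then 0 else 1)]
  have h3 : (∏ i ∈ Finset.range (k * k), (y : ZMod p) ^
      (dig p g (i / k) * dig p g (k + i % k) * (mat (e b) i +
        (if (e b : ℕ) = e ⊥ then 0 else 1) * (p - 2) *
        mat (par (e b)) (ren (e b) (i / k) * k + ren (e b) (i % k))))) =
      ∏ ij : Fin k × Fin k, (y : ZMod p) ^
        (dig p g (ij.1 + k * (0 : Fin 2)) * dig p g (ij.2 + k * (1 : Fin 2)) *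
          L.excess p b ij.1 ij.2) := by
    rw [Finset.prod_range, ← finProdFinEquiv.prod_comp]
    refine Finset.prod_congr rfl fun q _ => ?_
    have hk : 0 < k := q.2.pos
    have hmod : ((q.2 : ℕ) + k * q.1) % k = q.2 := by simp [Nat.mod_eq_of_lt q.2.2]
    have hdiv : ((q.2 : ℕ) + k * q.1) / k = q.1 := by
      rw [Nat.add_mul_div_left _ _ hk, Nat.div_eq_of_lt q.2.2, zero_add]
    have hval : ((finProdFinEquiv q : Fin (k * k)) : ℕ) = q.2 + k * q.1 := rfl
    have hmat : mat (e b) ((q.2 : ℕ) + k * q.1) = (L.mat b q.1 q.2).toNat := by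
      rw [← hT.mat]
      congr 1
      ring
    rw [hval, hmod, hdiv, hmat, hT.ren, hT.ren, hT.par, hT.mat, excess]
    simp only [hroot]
    rw [show (q.1 : ℕ) + k * ((0 : Fin 2) : ℕ) = q.1 by simp,
      show (q.2 : ℕ) + k * ((1 : Fin 2) : ℕ) = k + q.2 by simp [add_comm]]
    split_ifs <;> simp
  rw [guessWeight, h1, h2, h3]
  exact (by intros; ring : ∀ a b c d : ZMod p, a * b * (c * d) = d * b * a * c) _ _ _ _

end NodeTerm

end MaxCutProgram

/-! ### Single rounds of the depth-first evaluation. -/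

namespace MaxCutProgram

open RAM RAM.Expr RAM.Cmd

/-- The variables during the evaluation: `σ` is the stack, `A` the sum and `r` the product under
construction, `g` the guess, `b` the current node and `c` the number of nodes still to be
scanned. -/
def evalState (k ans u v tot y : ℕ) {p : ℕ} (σ : ℕ) (A r : ZMod p) (g b c mode : ℕ) : Reg → ℕ :=
  Store.get ⟨ans, p, u, p ^ (k + k + (k + k)), v, tot, y, σ, A.val, r.val, g, b, c, mode,
    0, 0, 0, 0, 0⟩

/-- The stack after a frame has been put on it. -/
def push (k : ℕ) {p : ℕ} (σ : ℕ) (A r : ZMod p) (g : ℕ) : ℕ :=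
  ((σ * p + A.val) * p + r.val) * p ^ (k + k + (k + k)) + g

section Steps

variable {x : List ℕ} {B n k N root : ℕ} {par leaf lab : ℕ → ℕ} {ren mat : ℕ → ℕ → ℕ}
  (hI : Input x n k N root par leaf lab ren mat)
  {p : ℕ} [Fact p.Prime] (hB : Fits B n k N p) {ans u v tot y σ g b : ℕ} {A r : ZMod p}

include hI hB

theorem runs_weights_seq (hy : y < p) (hb : b < N) {c mode : ℕ} {P : Cmd Reg} {s' : Reg → ℕ}
    (h : Runs x B P (evalState k ans u v tot y σ A
      (r * guessWeight p n k root par leaf lab ren mat y b σ g) g b c mode) s') :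
    Runs x B (leafWeight ;; profileWeight ;; pairWeight ;; P)
      (evalState k ans u v tot y σ A r g b c mode) s' := by
  refine Runs.seq (runs_leafWeight hI hB _ _ _ _ _ _ _ _ _ _ _ _ _)
    (Runs.seq (runs_profileWeight hI hB _ _ _ _ _ _ _ _ _ _ _ _ _ hb)
    (Runs.seq (runs_pairWeight hI hB _ _ _ _ _ _ _ _ _ _ _ _ _ hy hb) ?_))
  rw [mul_assoc r, mul_assoc r]
  exact h

omit [Fact p.Prime] in
theorem runs_body_skip {c : ℕ} (hc : c < N) (hb : b < N) (hnot : ¬ (par c = b ∧ c ≠ root)) :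
    Runs x B body (evalState k ans u v tot y σ A r g b (c + 1) 1)
      (evalState k ans u v tot y σ A r g b c 1) := by
  have htwo := hB.two_le
  have haddr := hB.addr
  have hpar := (hI.getD_par c hc).2
  have hpr : ∀ D : Store, D.C = c → (ePar Reg.C).eval x D.get = par c := fun D h => by
    subst h; exact hI.eval_ePar hc
  refine Runs.ifz_ne (fun hs => hs _) (by simp [evalState]) (Runs.assign_seq (fun hs =>
    (bdd_sub _ _ _ _ _).2 ⟨hs _, htwo⟩) (Runs.ifz_ne (fun hs => ?_) ?_ ?_))
  · have h1 := hs .C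
    have h2 := hs .B
    simp only [evalState, update_C, eval_sub, eval_var, eval_ofNat, get_C, get_B,
      Nat.add_sub_cancel] at h1 h2 ⊢
    simp only [bdd_add, bdd_sub, bdd_absDiff, bdd_var, bdd_ofNat, hI.bdd_eRoot hB, get_C, get_B,
      eval_absDiff, eval_var, eval_sub, eval_ofNat, hI.eval_eRoot, hpr, h1, h2, and_true]
    refine ⟨hI.bdd_ePar hB h1 hc, by omega, by omega⟩
  · simp only [evalState, update_C, eval_sub, eval_var, eval_ofNat, get_C, get_B,
      Nat.add_sub_cancel, eval_add, eval_absDiff, hI.eval_eRoot, hpr]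
    omega
  · simp only [evalState, update_C, eval_sub, eval_var, eval_ofNat, get_C, Nat.add_sub_cancel]
    exact Runs.skip

/-- A child starts with an empty sum, an empty product and the largest guess. The hypothesis `hσ` is
where the height of the stack enters the bound on the values. -/
theorem runs_body_push {c : ℕ} (hc : c < N) (hpar : par c = b) (hne : c ≠ root)
    (hσ : push k σ A r g < B) :
    Runs x B body (evalState k ans u v tot y σ A r g b (c + 1) 1)
      (evalState k ans u v tot y (push k σ A r g) (0 : ZMod p) 1 (p ^ (k + k + (k + k)) - 1)
        c N 1) := by
  have htwo := hB.two_le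
  have haddr := hB.addr
  have hp := (Fact.out : p.Prime).pos
  have hpr : ∀ D : Store, D.C = c → (ePar Reg.C).eval x D.get = par c := fun D h => by
    subst h; exact hI.eval_ePar hc
  refine Runs.ifz_ne (fun hs => hs _) (by simp [evalState]) (Runs.assign_seq (fun hs =>
    (bdd_sub _ _ _ _ _).2 ⟨hs _, htwo⟩) (Runs.ifz_zero (fun hs => ?_) ?_ ?_))
  · have h1 := hs .C
    have h2 := hs .B
    simp only [evalState, update_C, eval_sub, eval_var, eval_ofNat, get_C, get_B,
      Nat.add_sub_cancel] at h1 h2 ⊢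
    simp only [bdd_add, bdd_sub, bdd_absDiff, bdd_var, bdd_ofNat, hI.bdd_eRoot hB, get_C, get_B,
      eval_absDiff, eval_var, eval_sub, eval_ofNat, hI.eval_eRoot, hpr, h1, h2, and_true]
    refine ⟨hI.bdd_ePar hB h1 hc, by omega, by omega⟩
  · simp only [evalState, update_C, eval_sub, eval_var, eval_ofNat, get_C, get_B,
      Nat.add_sub_cancel, eval_add, eval_absDiff, hI.eval_eRoot, hpr, hpar]
    omega
  · have hq : 0 < p ^ (k + k + (k + k)) := pow_pos hp _
    have hz : (0 : ZMod p).val = 0 := ZMod.val_zero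
    have ho : (1 : ZMod p).val = 1 := ZMod.val_one p
    refine Runs.assign_seq (fun hs => ?_) (Runs.assign_seq (fun hs => hs _)
      (Runs.assign_seq (fun hs => show 0 < B by omega) (Runs.assign_seq (fun hs => htwo)
      (Runs.assign_seq (fun hs => (bdd_sub _ _ _ _ _).2 ⟨hs _, htwo⟩)
      (Runs.assign (fun hs => hI.bdd_eNodes hB) ?_)))))
    · have h1 := hs .S
      have h2 := hs .p
      have h3 := hs .A
      have h4 := hs .R
      have h5 := hs .q
      have h6 := hs .G
      simp only [evalState, update_C, get_S, get_p, get_A, get_R, get_q, get_G] at h1 h2 h3 h4 h5 h6 ⊢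
      simp only [bdd_add, bdd_mul, bdd_var, eval_add, eval_mul, eval_var, get_S, get_p, get_A, get_R,
        get_q, get_G, h1, h2, h3, h4, h5, h6, true_and]
      simp only [push] at hσ
      have e1 : (σ * p + A.val) * p + r.val ≤
        ((σ * p + A.val) * p + r.val) * p ^ (k + k + (k + k)) := Nat.le_mul_of_pos_right _ hq
      have e2 : σ * p + A.val ≤ (σ * p + A.val) * p := Nat.le_mul_of_pos_right _ hp
      refine ⟨⟨⟨⟨?_, ?_⟩, ?_⟩, ?_⟩, ?_⟩ <;> omega
    · simp only [evalState, update_C, update_S, update_B, update_A, update_R, update_G, eval_sub,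
        eval_var, eval_ofNat, eval_add, eval_mul, get_C, get_S, get_p, get_A, get_R, get_q, get_G,
        Nat.add_sub_cancel, hI.eval_eNodes, hz, ho, push]

theorem runs_body_next (hy : y < p) (hb : b < N) :
    Runs x B body (evalState k ans u v tot y σ A r (g + 1) b 0 1)
      (evalState k ans u v tot y σ
        (A + r * guessWeight p n k root par leaf lab ren mat y b σ (g + 1)) 1 g b N 1) := by
  have htwo := hB.two_le
  have hp2 := (Fact.out : p.Prime).two_le
  have hcube := hB.cube
  have ho : (1 : ZMod p).val = 1 := ZMod.val_one p
  refine Runs.ifz_zero (fun hs => hs _) (by simp [evalState]) (runs_weights_seq hI hB hy hb ?_)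
  generalize r * guessWeight p n k root par leaf lab ren mat y b σ (g + 1) = r'
  refine Runs.assign_seq (fun hs => ?_) (Runs.assign_seq (fun hs => htwo)
    (Runs.ifz_ne (fun hs => hs _) ?_ (Runs.assign_seq (fun hs =>
      (bdd_sub _ _ _ _ _).2 ⟨hs _, htwo⟩) (Runs.assign (fun hs => hI.bdd_eNodes hB) ?_))))
  · refine (bdd_mod _ _ _ _ _).2 ⟨⟨hs _, hs _, ?_⟩, hs _⟩
    change A.val + r'.val < B
    have := A.val_lt
    have := r'.val_lt
    nlinarith
  · simp [evalState]
  · simp only [evalState, update_A, update_R, update_G, update_C, eval_mod, eval_add, eval_sub,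
      eval_var, eval_ofNat, get_A, get_R, get_G, get_p, Nat.add_sub_cancel, hI.eval_eNodes, ho,
      ZMod.val_add]

/-- Division with remainder undoes `push` because each component of a frame is smaller than its
base. The completed sum of the child becomes a factor in the product `r'` of its parent. -/
theorem runs_body_pop (hy : y < p) (hb : b < N) (hbr : b ≠ root) {g' : ℕ}
    (hg' : g' < p ^ (k + k + (k + k))) {A' r' : ZMod p} :
    Runs x B body (evalState k ans u v tot y (push k σ A' r' g') A r 0 b 0 1)
      (evalState k ans u v tot y σ A' (r' *
        (A + r * guessWeight p n k root par leaf lab ren mat y b (push k σ A' r' g') 0))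
        g' (par b) b 1) := by
  have htwo := hB.two_le
  have hp2 := (Fact.out : p.Prime).two_le
  have hcube := hB.cube
  have ho : (1 : ZMod p).val = 1 := ZMod.val_one p
  have hq : 0 < p ^ (k + k + (k + k)) := pow_pos (by omega) _
  have e1 : push k σ A' r' g' / p ^ (k + k + (k + k)) = (σ * p + A'.val) * p + r'.val := by
    rw [push, add_comm, Nat.add_mul_div_right _ _ hq, Nat.div_eq_of_lt hg', zero_add]
  have e2 : push k σ A' r' g' % p ^ (k + k + (k + k)) = g' := by
    rw [push, add_comm, Nat.add_mul_mod_self_right, Nat.mod_eq_of_lt hg']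
  have e3 : ((σ * p + A'.val) * p + r'.val) / p = σ * p + A'.val := by
    rw [add_comm, Nat.add_mul_div_right _ _ (by omega), Nat.div_eq_of_lt r'.val_lt, zero_add]
  have e4 : ((σ * p + A'.val) * p + r'.val) % p = r'.val := by
    rw [add_comm, Nat.add_mul_mod_self_right, Nat.mod_eq_of_lt r'.val_lt]
  have e5 : (σ * p + A'.val) / p = σ := by
    rw [add_comm, Nat.add_mul_div_right _ _ (by omega), Nat.div_eq_of_lt A'.val_lt, zero_add]
  have e6 : (σ * p + A'.val) % p = A'.val := by
    rw [add_comm, Nat.add_mul_mod_self_right, Nat.mod_eq_of_lt A'.val_lt]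
  refine Runs.ifz_zero (fun hs => hs _) (by simp [evalState]) (runs_weights_seq hI hB hy hb ?_)
  generalize r * guessWeight p n k root par leaf lab ren mat y b (push k σ A' r' g') 0 = r₁
  have hpr : ∀ D : Store, D.B = b → (ePar Reg.B).eval x D.get = par b := fun D h => by
    subst h; exact hI.eval_ePar hb
  refine Runs.assign_seq (fun hs => ?_) (Runs.assign_seq (fun hs => htwo)
    (Runs.ifz_zero (fun hs => hs _) ?_ (Runs.ifz_ne (fun hs =>
      (bdd_absDiff _ _ _ _ _).2 ⟨hs _, hI.bdd_eRoot hB⟩) ?_ (Runs.assign_seq (fun hs => ?_)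
      (Runs.assign_seq (fun hs => ?_) (Runs.assign_seq (fun hs => ?_)
      (Runs.assign_seq (fun hs => ?_) (Runs.assign_seq (fun hs => hs _)
      (Runs.assign (fun hs => ?_) ?_)))))))))
  · refine (bdd_mod _ _ _ _ _).2 ⟨⟨hs _, hs _, ?_⟩, hs _⟩
    change A.val + r₁.val < B
    have := A.val_lt
    have := r₁.val_lt
    nlinarith
  · simp [evalState]
  · simp only [evalState, update_A, update_R, eval_absDiff, eval_var, get_B, hI.eval_eRoot]
    omega
  · simp only [bdd_mod, bdd_mul, bdd_div, bdd_var, hs, true_and, and_true]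
    simp only [evalState, update_A, update_R, eval_mod, eval_add, eval_div, eval_var,
      get_A, get_R, get_p, get_S, get_q, e1, e4]
    have h1 := r'.val_lt
    have h2 : (A.val + r₁.val) % p < p := Nat.mod_lt _ (by omega)
    calc _ < p * p := Nat.mul_lt_mul'' h1 h2
      _ ≤ p * p * p := Nat.le_mul_of_pos_right _ (by omega)
      _ ≤ B := hcube
  · simp only [bdd_mod, bdd_div, bdd_var, hs, and_true]
  · simp only [bdd_mod, bdd_var, hs, and_self]
  · simp only [bdd_div, bdd_var, hs, and_self]
  · exact hI.bdd_ePar hB (hs _) hb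
  · simp only [evalState, update_A, update_R, update_G, update_C, update_S, update_B, eval_mod,
      eval_add, eval_div, eval_mul, eval_var, eval_ofNat, get_A, get_R, get_p, get_S, get_q,
      get_B, e1, e2, e3, e4, e5, e6, hpr]
    rw [ZMod.val_mul, ZMod.val_add]

theorem runs_body_stop (hy : y < p) (hb : root < N) :
    Runs x B body (evalState k ans u v tot y σ A r 0 root 0 1)
      (evalState k ans u v tot y σ
        (A + r * guessWeight p n k root par leaf lab ren mat y root σ 0) 1 0 root 0 0) := by
  have htwo := hB.two_le
  have hp2 := (Fact.out : p.Prime).two_le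
  have hcube := hB.cube
  have ho : (1 : ZMod p).val = 1 := ZMod.val_one p
  refine Runs.ifz_zero (fun hs => hs _) (by simp [evalState]) (runs_weights_seq hI hB hy hb ?_)
  generalize r * guessWeight p n k root par leaf lab ren mat y root σ 0 = r'
  refine Runs.assign_seq (fun hs => ?_) (Runs.assign_seq (fun hs => htwo)
    (Runs.ifz_zero (fun hs => hs _) ?_ (Runs.ifz_zero (fun hs =>
      (bdd_absDiff _ _ _ _ _).2 ⟨hs _, hI.bdd_eRoot hB⟩) ?_
      (Runs.assign (fun hs => show 0 < B by omega) ?_))))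
  · refine (bdd_mod _ _ _ _ _).2 ⟨⟨hs _, hs _, ?_⟩, hs _⟩
    change A.val + r'.val < B
    have := A.val_lt
    have := r'.val_lt
    nlinarith
  · simp [evalState]
  · simp only [evalState, update_A, update_R, eval_absDiff, eval_var, get_B, hI.eval_eRoot]
    omega
  · simp only [evalState, update_A, update_R, update_mode, eval_mod, eval_add,
      eval_var, eval_ofNat, get_A, get_R, get_p, ho, ZMod.val_add]

end Steps

end MaxCutProgram

/-! ### Correctness of the depth-first evaluation. -/

namespace MaxCutProgram

open RAM RAM.Expr RAM.Cmd LabelledTree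

section Evaluation

open scoped Classical

variable {x : List ℕ} {B n k N d p : ℕ} {par leaf lab : ℕ → ℕ} {ren mat : ℕ → ℕ → ℕ}
  {T : RootedTree} [Fintype T] {L : LabelledTree (Fin n) k T} {e : T ≃ Fin N}
  [Fact p.Prime] {ans u v tot y : ℕ} {height : T → ℕ}

/-- A frame is a digit in base `p * p * p ^ (4k)`, so a stack of `j` frames stays below the `j`-th
power of this base. -/
theorem push_lt {σ m g : ℕ} (A r : ZMod p) (hσ : σ < m) (hg : g < p ^ (k + k + (k + k))) :
    push k σ A r g < m * (p * p * p ^ (k + k + (k + k))) := by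
  have h1 : σ * p + A.val < m * p := by
    have := A.val_lt
    nlinarith [Nat.mul_le_mul_right p (Nat.succ_le_of_lt hσ)]
  have h2 : (σ * p + A.val) * p + r.val < m * p * p := by
    have := r.val_lt
    nlinarith [Nat.mul_le_mul_right p (Nat.succ_le_of_lt h1)]
  have h3 := Nat.mul_le_mul_right (p ^ (k + k + (k + k))) (Nat.succ_le_of_lt h2)
  calc push k σ A r g < ((σ * p + A.val) * p + r.val + 1) * p ^ (k + k + (k + k)) := by
        rw [push, add_mul _ 1, one_mul]; omega
    _ ≤ _ := h3.trans_eq (by ring)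

omit [Fact p.Prime] in
theorem point_push {σ g : ℕ} (A r : ZMod p) : point p k (push k σ A r g) = point p k g := by
  rw [← point_mod, push, add_comm, Nat.add_mul_mod_self_right, point_mod]

variable (hI : Input x n k N (e ⊥) par leaf lab ren mat) (hB : Fits B n k N p)
  (hT : Tables L e par leaf lab ren mat)
  (hheight : ∀ c, c ≠ ⊥ → height c = height (Order.pred c) + 1) (hd : ∀ c, height c ≤ d)
  (hW : (p * p * p ^ (k + k + (k + k))) ^ d ≤ B) (hy : y < p)

include hI hB hT hheight hd hW hy

/-- The search for the children of a node. -/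
theorem iter_children (b : T)
    (ih : ∀ c, b < c → ∀ σ < (p * p * p ^ (k + k + (k + k))) ^ height c, ∃ A r : ZMod p,
      Iter x B .mode body
        (evalState k ans u v tot y σ (0 : ZMod p) 1 (p ^ (k + k + (k + k)) - 1) (e c) N 1)
        (evalState k ans u v tot y σ A r 0 (e c) 0 1) ∧
      A + r * guessWeight p n k (e ⊥) par leaf lab ren mat y (e c) σ 0 =
        L.gen (y : ZMod p) c (point p k σ))
    {σ : ℕ} (hσ : σ < (p * p * p ^ (k + k + (k + k))) ^ height b) {g : ℕ}
    (hg : g < p ^ (k + k + (k + k))) (A : ZMod p) (m : ℕ) (hm : m ≤ N) (r : ZMod p) :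
    Iter x B .mode body (evalState k ans u v tot y σ A r g (e b) m 1)
      (evalState k ans u v tot y σ A
        (r * ∏ c ∈ (children T b).filter (fun c => (e c : ℕ) < m), L.gen (y : ZMod p) c (point p k g))
        g (e b) 0 1) := by
  induction m generalizing r with
  | zero =>
    simp only [Nat.not_lt_zero, Finset.filter_false, Finset.prod_empty, mul_one]
    exact .refl
  | succ m ihm =>
    obtain ⟨c, hc⟩ := e.surjective ⟨m, hm⟩
    have hcm : (e c : ℕ) = m := by rw [hc]
    have hmem : c ∈ children T b ↔ par m = e b ∧ m ≠ e ⊥ := by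
      rw [mem_children, ← hcm, hT.par, Fin.val_inj, e.apply_eq_iff_eq, Ne, Ne, Fin.val_inj,
        e.apply_eq_iff_eq, and_comm]
    by_cases h : c ∈ children T b
    · have hfilter : (children T b).filter (fun a => (e a : ℕ) < m + 1) =
          insert c ((children T b).filter (fun a => (e a : ℕ) < m)) := by
        ext a
        simp only [Finset.mem_filter, Finset.mem_insert]
        constructor
        · rintro ⟨h1, h2⟩
          rcases Nat.lt_succ_iff_lt_or_eq.1 h2 with h3 | h3
          · exact Or.inr ⟨h1, h3⟩
          · exact Or.inl (e.injective (Fin.ext (h3.trans hcm.symm)))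
        · rintro (rfl | ⟨h1, h2⟩)
          · exact ⟨h, by omega⟩
          · exact ⟨h1, by omega⟩
      rw [hfilter, Finset.prod_insert (by simp [hcm]), ← mul_assoc]
      obtain ⟨hpar, hne⟩ := hmem.1 h
      obtain ⟨hc0, hcb⟩ := mem_children.1 h
      have hpush : push k σ A r g < (p * p * p ^ (k + k + (k + k))) ^ height c := by
        rw [hheight c hc0, hcb, pow_succ]
        exact push_lt A r hσ hg
      have hpos : 0 < p * p * p ^ (k + k + (k + k)) := by
        have := (Fact.out : p.Prime).pos
        positivity
      obtain ⟨A', r', h1, h2⟩ := ih c (lt_of_mem_children h) _ hpush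
      rw [hcm] at h1 h2
      -- Push, evaluate the child, pop: the value of the child multiplies `r`, and the scan goes on
      -- with the nodes numbered below `m`.
      refine .head ⟨by simp [evalState], runs_body_push hI hB (by omega) hpar hne
        (hpush.trans_le ((Nat.pow_le_pow_right hpos (hd c)).trans hW))⟩ (h1.trans (.head
        ⟨by simp [evalState], runs_body_pop hI hB hy (by omega) hne hg⟩ ?_))
      rw [h2, point_push, hpar]
      exact ihm (by omega) _
    · have hfilter : (children T b).filter (fun a => (e a : ℕ) < m + 1) =
          (children T b).filter (fun a => (e a : ℕ) < m) := by
        refine Finset.filter_congr fun a ha => ?_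
        have : (e a : ℕ) ≠ m := fun h' => h (e.injective (Fin.ext (h'.trans hcm.symm)) ▸ ha)
        omega
      rw [hfilter]
      exact .head ⟨by simp [evalState], runs_body_skip hI hB (by omega) (e b).2
        fun h' => h (hmem.2 h')⟩ (ihm (by omega) r)

/-- The sum over the guesses at a node. -/
theorem iter_guesses (b : T)
    (ih : ∀ c, b < c → ∀ σ < (p * p * p ^ (k + k + (k + k))) ^ height c, ∃ A r : ZMod p,
      Iter x B .mode body
        (evalState k ans u v tot y σ (0 : ZMod p) 1 (p ^ (k + k + (k + k)) - 1) (e c) N 1)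
        (evalState k ans u v tot y σ A r 0 (e c) 0 1) ∧
      A + r * guessWeight p n k (e ⊥) par leaf lab ren mat y (e c) σ 0 =
        L.gen (y : ZMod p) c (point p k σ))
    {σ : ℕ} (hσ : σ < (p * p * p ^ (k + k + (k + k))) ^ height b) (g : ℕ)
    (hg : g < p ^ (k + k + (k + k))) (A : ZMod p) :
    ∃ A' r : ZMod p, Iter x B .mode body (evalState k ans u v tot y σ A 1 g (e b) N 1)
      (evalState k ans u v tot y σ A' r 0 (e b) 0 1) ∧
      A' + r * guessWeight p n k (e ⊥) par leaf lab ren mat y (e b) σ 0 =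
      A + ∑ j ∈ Finset.range (g + 1), guessWeight p n k (e ⊥) par leaf lab ren mat y (e b) σ j *
        ∏ c ∈ children T b, L.gen (y : ZMod p) c (point p k j) := by
  -- A scan that starts at `N` meets every child, so the product is complete.
  have key : ∀ g < p ^ (k + k + (k + k)), ∀ A : ZMod p,
      Iter x B .mode body (evalState k ans u v tot y σ A 1 g (e b) N 1)
      (evalState k ans u v tot y σ A (∏ c ∈ children T b, L.gen (y : ZMod p) c (point p k g)) g
        (e b) 0 1) := by
    intro g hg A
    have := iter_children hI hB hT hheight hd hW hy (ans := ans) (u := u) (v := v) (tot := tot)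
      b ih hσ hg A N le_rfl 1
    rwa [one_mul, Finset.filter_true_of_mem fun c _ => (e c).2] at this
  induction g generalizing A with
  | zero =>
    -- The claim stops just before the term of the guess `0` is added, because this last round
    -- differs: the root stops, and every other node pops.
    refine ⟨A, _, key 0 hg A, ?_⟩
    rw [Finset.sum_range_one, mul_comm]
  | succ g ihg =>
    obtain ⟨A', r, h1, h2⟩ := ihg (by omega) (A + (∏ c ∈ children T b,
      L.gen (y : ZMod p) c (point p k (g + 1))) *
        guessWeight p n k (e ⊥) par leaf lab ren mat y (e b) σ (g + 1))
    refine ⟨A', r, (key (g + 1) hg A).trans (.head ⟨by simp [evalState],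
      runs_body_next hI hB hy (e b).2⟩ h1), ?_⟩
    rw [h2, Finset.sum_range_succ _ (g + 1)]
    ring

/-- The evaluation of the generating function at a node. -/
theorem iter_node (hp : n < p - 1) (b : T) (σ : ℕ)
    (hσ : σ < (p * p * p ^ (k + k + (k + k))) ^ height b) : ∃ A r : ZMod p,
      Iter x B .mode body
        (evalState k ans u v tot y σ (0 : ZMod p) 1 (p ^ (k + k + (k + k)) - 1) (e b) N 1)
        (evalState k ans u v tot y σ A r 0 (e b) 0 1) ∧
      A + r * guessWeight p n k (e ⊥) par leaf lab ren mat y (e b) σ 0 =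
        L.gen (y : ZMod p) b (point p k σ) := by
  -- Nodes grow away from the root, so this induction runs from the leaves towards the root.
  induction b using WellFoundedGT.induction generalizing σ with
  | ind b ih =>
    have hpos : 0 < p ^ (k + k + (k + k)) := pow_pos (Fact.out : p.Prime).pos _
    obtain ⟨A, r, h1, h2⟩ := iter_guesses hI hB hT hheight hd hW hy (ans := ans) (u := u) (v := v)
      (tot := tot) b ih hσ (p ^ (k + k + (k + k)) - 1) (by omega) 0
    refine ⟨A, r, h1, ?_⟩
    rw [h2, zero_add, gen_eq_sum_guessWeight L e hT hp, Nat.sub_add_cancel hpos]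

/-- The evaluation of the generating function at the root. -/
theorem runs_loop (hp : n < p - 1) :
    Runs x B (loop Reg.mode body)
      (evalState k ans u v tot y 0 (0 : ZMod p) 1 (p ^ (k + k + (k + k)) - 1) (e ⊥) N 1)
      (evalState k ans u v tot y 0 (L.gen (y : ZMod p) ⊥ (point p k 0)) 1 0 (e ⊥) 0 0) := by
  have hpos : 0 < p * p * p ^ (k + k + (k + k)) := by
    have := (Fact.out : p.Prime).pos
    positivity
  obtain ⟨A, r, h1, h2⟩ := iter_node hI hB hT hheight hd hW hy (ans := ans) (u := u) (v := v)
    (tot := tot) hp ⊥ 0 (pow_pos hpos _)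
  rw [← h2]
  exact Iter.runs (h1.tail ⟨by simp [evalState], runs_body_stop hI hB hy (e ⊥).2⟩) rfl

end Evaluation

end MaxCutProgram

/-! ### Trial division, interpolation and the search over primes and cut sizes. -/

namespace MaxCutProgram

open RAM RAM.Expr RAM.Cmd LabelledTree

/-- The variables between the evaluations. -/
def idleState (ans p u q v tot y : ℕ) : Reg → ℕ :=
  Store.get ⟨ans, p, u, q, v, tot, y, 0, 0, 0, 0, 0, 0, 0, 0, 0, 0, 0, 0⟩

section TestPrime

variable {x : List ℕ} {B n k N root : ℕ} {par leaf lab : ℕ → ℕ} {ren mat : ℕ → ℕ → ℕ}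

theorem prime_iff_mod_ne_zero {p : ℕ} (hp : 2 ≤ p) :
    p.Prime ↔ ∀ i < p - 2, p % (i + 2) ≠ 0 := by
  rw [Nat.prime_def_lt']
  refine ⟨fun h i hi h0 => h.2 (i + 2) (by omega) (by omega) (Nat.dvd_of_mod_eq_zero h0),
    fun h => ⟨hp, fun m hm hmp hdvd => h (m - 2) (by omega) ?_⟩⟩
  rw [Nat.sub_add_cancel hm]
  exact Nat.mod_eq_zero_of_dvd hdvd

/-- The value computed by trial division. -/
def trial (p : ℕ) : ℕ → ℕ → ℕ
  | 0, a => a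
  | m + 1, a => trial p m (1 - (1 - min a p * (p % (m + 2))))

theorem trial_ne_zero {p : ℕ} (hp : 0 < p) (K a : ℕ) :
    trial p K a ≠ 0 ↔ a ≠ 0 ∧ ∀ i < K, p % (i + 2) ≠ 0 := by
  induction K generalizing a with
  | zero => simp [trial]
  | succ K ih =>
    have e : 1 - (1 - min a p * (p % (K + 2))) ≠ 0 ↔ a ≠ 0 ∧ p % (K + 2) ≠ 0 := by
      have e1 : min a p ≠ 0 ↔ a ≠ 0 := by omega
      rw [← e1, ← mul_ne_zero_iff]
      omega
    rw [trial, ih, e]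
    simp only [Nat.lt_succ_iff_lt_or_eq, or_imp, forall_and, forall_eq]
    tauto

/-- The variable `u` is positive at first exactly if `p` exceeds `n * n + 1`, and a proper divisor
turns it into zero for good; `1 - (1 - ·)` normalizes positive numbers to `1`. -/
theorem runs_testPrime (hI : Input x n k N root par leaf lab ren mat) {p : ℕ}
    (hB : Fits B n k N p) (hn : 1 ≤ n) (ans : ℕ) :
    ∃ U, Runs x B testPrime (idleState ans p 0 0 0 0 0) (idleState ans p U 0 0 0 0) ∧
      (U ≠ 0 ↔ p.Prime ∧ n * n + 1 < p) := by
  have htwo := hB.two_le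
  have haddr := hB.addr
  have hcube := hB.cube
  have hfor := Runs.forDown (x := x) (B := B) (r := Reg.i)
    (c := (Cmd.assign .u (1 - (1 - Reg.u * (Reg.p % (Reg.i + 2)))) : Cmd Reg)) htwo
    -- The rule for loops asks about every `a`. The minimum with `p` keeps the product in the body
    -- below `p * p` for all of them and does not alter the values that occur.
    (σ := fun m a => Store.get
      ⟨ans, p, min a p, 0, 0, 0, 0, 0, 0, 0, 0, 0, 0, 0, 0, m, 0, 0, 0⟩)
    (g := fun m a => 1 - (1 - min a p * (p % (m + 2)))) (F := trial p)
    (fun _ => rfl) (fun _ _ => rfl) (fun _ _ => rfl) (p - 2) (fun m hm a => by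
      refine Runs.assign (fun hs => ?_) ?_
      · have h1 := hs .u
        have h2 := hs .p
        have h4 : p % (m + 2) < p := (Nat.mod_lt _ (by omega)).trans_le (by omega)
        have h5 : min a p * (p % (m + 2)) ≤ p * p := Nat.mul_le_mul (min_le_right _ _) h4.le
        have h6 : p * p < B := by nlinarith
        simp only [update_i, get_u, get_p] at h1 h2
        simp only [update_i, bdd_sub, bdd_ofNat, bdd_mul, bdd_mod, bdd_add, bdd_var, eval_mod,
          eval_add, eval_var, eval_ofNat, get_u, get_p, get_i, h1, h2, true_and]
        omega
      · simp only [update_i, update_u, eval_sub, eval_ofNat, eval_mul, eval_mod, eval_add, eval_var,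
          get_u, get_p, get_i]
        congr 2
        omega) (p - (n * n + 1))
  rw [min_eq_left (Nat.sub_le _ _)] at hfor
  refine ⟨min (trial p (p - 2) (p - (n * n + 1))) p,
    Runs.assign_seq (fun hs => ?_) (Runs.assign_seq (fun hs => ?_) ?_), ?_⟩
  rotate_left 2
  · simp only [idleState, update_u, update_i, eval_sub, eval_add, eval_mul, eval_var, eval_ofNat,
      hI.eval_eN, get_p]
    exact hfor
  · have hnn : 1 ≤ n * n := Nat.mul_pos hn hn
    rcases Nat.eq_zero_or_pos p with rfl | hpos
    · simp [Nat.not_prime_zero]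
    have e : min (trial p (p - 2) (p - (n * n + 1))) p ≠ 0 ↔
        trial p (p - 2) (p - (n * n + 1)) ≠ 0 := by omega
    rw [e, trial_ne_zero hpos, and_comm]
    by_cases hp : n * n + 1 < p
    · rw [prime_iff_mod_ne_zero (by omega)]
      refine and_congr_right fun _ => ?_
      omega
    · have : p - (n * n + 1) = 0 := by omega
      simp [this, hp]
  · have := hs .p
    simp only [idleState, get_p] at this
    simp only [idleState, bdd_sub, bdd_add, bdd_mul, bdd_ofNat, bdd_var, hI.bdd_eN hB, hI.eval_eN,
      get_p, this, eval_mul, eval_ofNat, true_and]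
    omega
  · exact (bdd_sub _ _ _ _ _).2 ⟨hs _, show 2 < B by omega⟩

end TestPrime

section Scan

open scoped Classical

variable {x : List ℕ} {B n k N d p : ℕ} {par leaf lab : ℕ → ℕ} {ren mat : ℕ → ℕ → ℕ}
  {T : RootedTree} [Fintype T] {L : LabelledTree (Fin n) k T} {e : T ≃ Fin N}
  [Fact p.Prime] {ans u v tot y : ℕ} {height : T → ℕ}
  (hI : Input x n k N (e ⊥) par leaf lab ren mat) (hB : Fits B n k N p)
  (hT : Tables L e par leaf lab ren mat)
  (hheight : ∀ c, c ≠ ⊥ → height c = height (Order.pred c) + 1) (hd : ∀ c, height c ≤ d)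
  (hW : (p * p * p ^ (k + k + (k + k))) ^ (d + 1) ≤ B)

include hI hB hT hheight hd hW

theorem runs_addTerm (hy : y < p) (hp : n < p - 1) (t : ZMod p) :
    Runs x B addTerm (idleState ans p u (p ^ (k + k + (k + k))) v t.val y)
      (idleState ans p u (p ^ (k + k + (k + k))) v
        (t + (y : ZMod p) ^ (p - 1 - v) * L.gen (y : ZMod p) ⊥ (point p k 0)).val y) := by
  have htwo := hB.two_le
  have hp2 := (Fact.out : p.Prime).two_le
  have hcube := hB.cube
  have hz : (0 : ZMod p).val = 0 := ZMod.val_zero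
  have ho : (1 : ZMod p).val = 1 := ZMod.val_one p
  have hW' : (p * p * p ^ (k + k + (k + k))) ^ d ≤ B :=
    (Nat.pow_le_pow_right (by positivity) (Nat.le_succ d)).trans hW
  refine Runs.assign_seq (fun _ => htwo) (Runs.assign_seq (fun hs =>
    (bdd_sub _ _ _ _ _).2 ⟨hs _, htwo⟩) (Runs.assign_seq (fun _ => hI.bdd_eRoot hB)
    (Runs.assign_seq (fun _ => hI.bdd_eNodes hB) (Runs.assign_seq (fun _ => htwo) ?_))))
  have hloop := runs_loop hI hB hT hheight hd hW' hy (ans := ans) (u := u) (v := v)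
    (tot := t.val) hp
  generalize L.gen (y : ZMod p) ⊥ (point p k 0) = w at hloop ⊢
  simp only [evalState, hz, ho] at hloop
  simp only [idleState, update_R, update_G, update_B, update_C, update_mode, eval_sub, eval_ofNat,
    eval_var, hI.eval_eRoot, hI.eval_eNodes, get_q]
  refine hloop.seq (Runs.assign_seq (fun hs => hs _) (Runs.assign_seq (fun hs =>
    (bdd_sub _ _ _ _ _).2 ⟨(bdd_sub _ _ _ _ _).2 ⟨hs _, htwo⟩, hs _⟩) ?_))
  simp only [update_R, update_e, eval_sub, eval_ofNat, eval_var, get_A, get_p, get_v]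
  refine runs_mulPow_seq hcube (Or.inr rfl) rfl hy.le w rfl ?_
  simp only [get_y]
  generalize hr : w * (y : ZMod p) ^ (p - 1 - v) = r
  refine Runs.assign_seq (fun hs => ?_) (Runs.assign_seq (fun _ => show 0 < B by omega)
    (Runs.assign_seq (fun _ => show 0 < B by omega) (Runs.assign (fun _ => show 0 < B by omega) ?_)))
  · refine (bdd_mod _ _ _ _ _).2 ⟨⟨hs _, hs _, ?_⟩, hs _⟩
    change t.val + r.val < B
    have := t.val_lt
    have := r.val_lt
    nlinarith
  · simp only [update_tot, update_A, update_R, update_B, eval_mod, eval_add, eval_var, eval_ofNat,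
      get_tot, get_R, get_p]
    rw [mul_comm _ w, hr, ZMod.val_add]

/-- The evaluation of the interpolation formula. -/
theorem runs_forDown_addTerm (hp : n < p - 1) :
    Runs x B (forDown .y addTerm) (idleState ans p u (p ^ (k + k + (k + k))) v 0 p)
      (idleState ans p u (p ^ (k + k + (k + k))) v
        (∑ y : ZMod p, y ^ (p - 1 - v) * L.gen y ⊥ (point p k 0)).val 0) := by
  have hfor := Runs.forDown (x := x) (B := B) (r := Reg.y) (c := addTerm) hB.two_le
    (σ := fun m (t : ZMod p) => idleState ans p u (p ^ (k + k + (k + k))) v t.val m)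
    (g := fun m t => t + (m : ZMod p) ^ (p - 1 - v) * L.gen (m : ZMod p) ⊥ (point p k 0))
    (F := fun K t => t + ∑ y ∈ Finset.range K,
      (y : ZMod p) ^ (p - 1 - v) * L.gen (y : ZMod p) ⊥ (point p k 0))
    (by simp) (fun m t => by rw [Finset.sum_range_succ]; ring) (fun _ _ => rfl) p
    (fun m hm t => by
      rw [idleState, update_y]
      exact runs_addTerm hI hB hT hheight hd hW hm hp t) 0
  rw [ZMod.val_zero, zero_add, Finset.sum_range] at hfor
  convert hfor using 3
  exact (Equiv.sum_comp (ZMod.equivFin p) _).symm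

end Scan

section Cuts

open scoped Classical

variable {x : List ℕ} {B n k N d p : ℕ} {par leaf lab : ℕ → ℕ} {ren mat : ℕ → ℕ → ℕ}
  {T : RootedTree} [Fintype T] {G : SimpleGraph (Fin n)} {M : TreeModel G d k T} {e : T ≃ Fin N}
  {ans u : ℕ} {height : T → ℕ}

/-- The number of sets of vertices with a cut of given size. -/
noncomputable def cutCount (G : SimpleGraph (Fin n)) (v : ℕ) : ℕ :=
  (Finset.univ.filter fun X : Finset (Fin n) => cutSize G X = v).card

/-- The largest size of a cut that is detected modulo `p`. -/
noncomputable def detected (G : SimpleGraph (Fin n)) (p : ℕ) : ℕ :=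
  ((Finset.range (n * n + 1)).filter fun v => ¬ p ∣ cutCount G v).sup id

variable (hI : Input x n k N (e ⊥) par leaf lab ren mat)
  (hT : Tables M.toLabelledTree e par leaf lab ren mat)
  (hheight : ∀ c, c ≠ ⊥ → height c = height (Order.pred c) + 1) (hd : ∀ c, height c ≤ d)

include hI hT hheight hd

/-- Interpolation gives minus the number of sets with cut size `v`, so `tot` vanishes exactly if `p`
divides this number. The exponent `d + 1`, one more than the stack needs, leaves room for `q` even
if `d = 0`. -/
theorem runs_scanCuts [hprime : Fact p.Prime] (hB : Fits B n k N p)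
    (hW : (p * p * p ^ (k + k + (k + k))) ^ (d + 1) ≤ B) (hp : n * n + 1 < p) :
    Runs x B scanCuts (idleState ans p u 0 0 0 0)
      (idleState (ans ⊔ detected G p) p u 0 0 0 0) := by
  have htwo := hB.two_le
  have haddr := hB.addr
  have hdigits := hB.digits
  have hp2 := hprime.out.two_le
  have hn : n ≤ n * n := Nat.le_mul_self n
  have hpos : 0 < p ^ (k + k + (k + k)) := by positivity
  have hq : p ^ (k + k + (k + k)) < B := by
    calc p ^ (k + k + (k + k)) < p * p * p ^ (k + k + (k + k)) :=
        lt_mul_of_one_lt_left hpos (by nlinarith)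
      _ ≤ (p * p * p ^ (k + k + (k + k))) ^ (d + 1) := Nat.le_self_pow (by omega) _
      _ ≤ B := hW
  have hqfor := Runs.forDown (x := x) (B := B) (r := Reg.i)
    (c := (Cmd.assign .q (Reg.q * Reg.p) : Cmd Reg)) htwo
    (σ := fun m (_ : Unit) => Store.get ⟨ans, p, u, p ^ (k + k + (k + k) - m), 0, 0, 0, 0, 0, 0, 0,
      0, 0, 0, 0, m, 0, 0, 0⟩) (g := fun _ _ => ()) (F := fun _ _ => ()) (by simp) (by simp)
    (fun _ _ => rfl) (k + k + (k + k)) (fun m hm _ => by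
      have e : p ^ (k + k + (k + k) - (m + 1)) * p = p ^ (k + k + (k + k) - m) := by
        rw [← pow_succ]
        congr 1
        omega
      rw [update_i]
      refine Runs.assign (fun hs => (bdd_mul _ _ _ _ _).2 ⟨hs _, hs _, ?_⟩) ?_
      · change p ^ (k + k + (k + k) - (m + 1)) * p < B
        rw [e]
        exact (Nat.pow_le_pow_right (by omega) (by omega)).trans_lt hq
      · simp only [update_q, eval_mul, eval_var, get_q, get_p, e]) ()
  simp only [Nat.sub_self, pow_zero, Nat.sub_zero] at hqfor
  have hvfor := Runs.forDown (x := x) (B := B) (r := Reg.v)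
    (c := assign .y Reg.p ;; forDown .y addTerm ;;
    ifz Reg.tot skip (assign .ans (Reg.ans + (Reg.v - Reg.ans))) ;; assign .tot 0) htwo
    (σ := fun m a => idleState a p u (p ^ (k + k + (k + k))) m 0 0)
    (g := fun m a => if ¬ p ∣ cutCount G m then a ⊔ m else a)
    (F := fun K a => a ⊔ ((Finset.range K).filter fun v => ¬ p ∣ cutCount G v).sup id)
    (by simp) (fun m a => by
      rw [Finset.range_add_one, Finset.filter_insert]
      by_cases h : p ∣ cutCount G m
      · rw [if_neg (not_not.2 h), if_neg (not_not.2 h)]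
      · rw [if_pos h, if_pos h, Finset.sup_insert, sup_assoc, id])
    (fun _ _ => rfl) (n * n + 1) (fun m hm a => by
      have hsum := M.sum_gen_bot (p := p) (v := m) (by simp only [Fintype.card_fin]; omega) (by omega)
        (point p k 0)
      have hzero : (∑ y : ZMod p, y ^ (p - 1 - m) * M.gen y ⊥ (point p k 0)).val = 0 ↔
          p ∣ cutCount G m := by
        rw [hsum, ZMod.val_eq_zero, neg_eq_zero, ZMod.natCast_eq_zero_iff, cutCount]
      have hloop := runs_forDown_addTerm hI hB hT hheight hd hW (ans := a) (u := u) (v := m)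
        (by omega)
      rw [idleState, update_v]
      refine Runs.assign_seq (fun hs => hs _) ?_
      rw [update_y]
      refine hloop.seq ?_
      generalize (∑ y : ZMod p, y ^ (p - 1 - m) * M.gen y ⊥ (point p k 0)).val = t at hzero
      by_cases h : p ∣ cutCount G m
      · rw [if_neg (not_not.2 h)]
        refine Runs.seq (Runs.ifz_zero (fun hs => hs _) (hzero.2 h) Runs.skip)
          (Runs.assign (fun _ => show 0 < B by omega) ?_)
        simp only [idleState, update_tot, eval_ofNat]
      · rw [if_pos h]
        refine Runs.seq (Runs.ifz_ne (fun hs => hs _) (mt hzero.1 h) (Runs.assign (fun hs => ?_) rfl))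
          (Runs.assign (fun _ => show 0 < B by omega) ?_)
        · have h1 := hs .ans
          have h2 := hs .v
          simp only [idleState, get_ans, get_v] at h1 h2
          simp only [idleState, bdd_add, bdd_sub, bdd_var, eval_sub, eval_var, get_ans, get_v, h1, h2,
            true_and]
          omega
        · simp only [idleState, update_ans, update_tot, eval_add, eval_sub, eval_var, eval_ofNat,
            get_ans, get_v]
          rw [show a + (m - a) = a ⊔ m by omega]) ans
  refine Runs.assign_seq (fun _ => htwo) (Runs.assign_seq (fun _ => ?_) ?_)
  · simp only [bdd_add, hI.bdd_eK hB, eval_add, hI.eval_eK, true_and]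
    omega
  simp only [idleState, update_q, update_i, eval_add, hI.eval_eK, eval_ofNat]
  refine hqfor.seq (Runs.assign_seq (fun _ => ?_) ?_)
  · simp only [bdd_add, bdd_mul, bdd_ofNat, hI.bdd_eN hB, eval_mul, hI.eval_eN, eval_ofNat, true_and]
    omega
  simp only [update_v, eval_add, eval_mul, eval_ofNat, hI.eval_eN]
  refine hvfor.seq (Runs.assign (fun _ => show 0 < B by omega) ?_)
  simp only [idleState, update_q, eval_ofNat]
  rfl

theorem runs_main (hn : 1 ≤ n) {Q : ℕ} (hQ : Q = 2 * ((n + 2) * (n + 2) * (n + 2) * (n + 2)) + 1)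
    (hB : Fits B n k N Q) (hW : (Q * Q * Q ^ (k + k + (k + k))) ^ (d + 1) ≤ B) :
    Runs x B main (fun _ => 0) (idleState (((Finset.range Q).filter fun p =>
      p.Prime ∧ n * n + 1 < p).sup (detected G)) 0 0 0 0 0 0) := by
  have htwo := hB.two_le
  have haddr := hB.addr
  have hcube := hB.cube
  have hQ1 : 1 ≤ Q := by omega
  have hfor := Runs.forDown (x := x) (B := B) (r := Reg.p)
    (c := testPrime ;; ifz Reg.u skip scanCuts ;; assign .u 0) htwo
    (σ := fun m a => idleState a m 0 0 0 0 0)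
    (g := fun m a => if m.Prime ∧ n * n + 1 < m then a ⊔ detected G m else a)
    (F := fun K a => a ⊔ ((Finset.range K).filter fun p =>
      p.Prime ∧ n * n + 1 < p).sup (detected G))
    (by simp) (fun m a => by
      rw [Finset.range_add_one, Finset.filter_insert]
      split_ifs
      · rw [Finset.sup_insert, sup_assoc]
      · rfl)
    (fun _ _ => rfl) Q (fun m hm a => by
      -- The bounds are monotone in the modulus, so those for `Q` serve every candidate `m < Q`.
      have hB' : Fits B n k N m := ⟨hB.addr, le_trans (by gcongr) hB.cube, hB.digits⟩
      obtain ⟨U, h1, h2⟩ := runs_testPrime hI hB' hn a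
      rw [idleState, update_p]
      refine h1.seq ?_
      by_cases h : m.Prime ∧ n * n + 1 < m
      · rw [if_pos h]
        have : Fact m.Prime := ⟨h.1⟩
        refine Runs.seq (Runs.ifz_ne (fun hs => hs _) (h2.2 h)
          (runs_scanCuts hI hT hheight hd hB' (le_trans (by gcongr) hW) h.2))
          (Runs.assign (fun _ => show 0 < B by omega) ?_)
        simp only [idleState, update_u, eval_ofNat]
      · rw [if_neg h]
        refine Runs.seq (Runs.ifz_zero (fun hs => hs _) (not_not.1 (mt h2.1 h)) Runs.skip)
          (Runs.assign (fun _ => show 0 < B by omega) ?_)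
        simp only [idleState, update_u, eval_ofNat]) 0
  have hstart : (fun _ => 0 : Reg → ℕ) = idleState 0 0 0 0 0 0 0 := by
    funext r
    cases r <;> rfl
  rw [hstart]
  refine Runs.assign_seq (fun _ => ?_) ?_
  · have hlt : Q < B := by
      have : 33 ≤ Q := by
        have : 3 * 3 * 3 * 3 ≤ (n + 2) * (n + 2) * (n + 2) * (n + 2) := by gcongr <;> omega
        omega
      nlinarith
    have e1 : (n + 2) * (n + 2) ≤ (n + 2) * (n + 2) * (n + 2) := Nat.le_mul_of_pos_right _ (by omega)
    have e2 : (n + 2) * (n + 2) * (n + 2) ≤ (n + 2) * (n + 2) * (n + 2) * (n + 2) :=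
      Nat.le_mul_of_pos_right _ (by omega)
    simp only [bdd_add, bdd_mul, bdd_ofNat, hI.bdd_eN hB, eval_add, eval_mul, hI.eval_eN, eval_ofNat,
      true_and]
    omega
  · simp only [idleState, update_p, eval_add, eval_mul, hI.eval_eN, eval_ofNat]
    rw [← hQ]
    rw [Nat.zero_max] at hfor
    exact hfor

end Cuts

/-- Every size of a cut is detected modulo some prime. -/
theorem sup_detected {n : ℕ} (hn : 1 ≤ n) (G : SimpleGraph (Fin n)) :
    ((Finset.range (2 * ((n + 2) * (n + 2) * (n + 2) * (n + 2)) + 1)).filter fun p =>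
      p.Prime ∧ n * n + 1 < p).sup (detected G) = maxCut G := by
  classical
  rw [maxCut_eq_sup]
  -- A detected size has a nonzero count and hence belongs to a cut. Conversely, the count for the
  -- size of a given cut lies between `1` and `2 ^ n`, so it survives modulo some prime in the
  -- range.
  apply le_antisymm
  · refine Finset.sup_le fun p _ => Finset.sup_le fun v hv => ?_
    have h0 : cutCount G v ≠ 0 := fun h => (Finset.mem_filter.1 hv).2 (h ▸ dvd_zero p)
    rw [cutCount, Finset.card_ne_zero] at h0
    obtain ⟨X, hX⟩ := h0
    have : cutSize G X = v := by simpa using hX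
    exact this ▸ Finset.le_sup (f := cutSize G) (Finset.mem_univ X)
  · refine Finset.sup_le fun X _ => ?_
    have h0 : cutCount G (cutSize G X) ≠ 0 := by
      rw [cutCount, Finset.card_ne_zero]
      exact ⟨X, by simp⟩
    have h1 : cutCount G (cutSize G X) ≤ 2 ^ n := by
      refine (Finset.card_le_univ _).trans ?_
      simp
    obtain ⟨p, hp, hlt, hle, hdvd⟩ := Nat.exists_prime_not_dvd_of_le_two_pow hn h0 h1
    have hX := cutSize_le G X
    rw [Fintype.card_fin] at hX
    calc cutSize G X ≤ detected G p := Finset.le_sup (f := id) (b := cutSize G X) (Finset.mem_filter.2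
        ⟨Finset.mem_range.2 (by omega), hdvd⟩)
      _ ≤ _ := Finset.le_sup (f := detected G) (by
        simp only [Finset.mem_filter, Finset.mem_range]
        refine ⟨?_, hp, hlt⟩
        rw [show (n + 2) * (n + 2) * (n + 2) * (n + 2) = (n + 2) ^ 4 by ring]
        omega)

end MaxCutProgram

/-! ### The tables in the input -/

theorem List.getD_append_middle {α : Type*} (l₁ l₂ l₃ : List α) (z : α) {s i : ℕ}
    (hs : l₁.length = s) (hi : i < l₂.length) : (l₁ ++ l₂ ++ l₃).getD (s + i) z = l₂.getD i z := by
  subst hs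
  rw [List.append_assoc, List.getD_append_right _ _ _ _ (by omega), Nat.add_sub_cancel_left,
    List.getD_append _ _ _ _ hi]

theorem List.getD_ofFn {α : Type*} {m : ℕ} (f : Fin m → α) (z : α) (i : Fin m) :
    (List.ofFn f).getD i z = f i := by
  rw [List.getD_eq_getElem _ _ (by simp)]
  simp

theorem List.length_flatten_ofFn {α : Type*} {m k : ℕ} (f : Fin m → List α)
    (hf : ∀ a, (f a).length = k) : (List.ofFn f).flatten.length = m * k := by
  induction m with
  | zero => simp
  | succ m ih =>
    rw [List.ofFn_succ, List.flatten_cons, List.length_append, hf, ih _ fun a => hf _]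
    ring

theorem List.getD_flatten_ofFn {α : Type*} {m k : ℕ} (f : Fin m → List α)
    (hf : ∀ a, (f a).length = k) (z : α) (a : Fin m) {i : ℕ} (hi : i < k) :
    (List.ofFn f).flatten.getD (a * k + i) z = (f a).getD i z := by
  induction m with
  | zero => exact a.elim0
  | succ m ih =>
    rw [List.ofFn_succ, List.flatten_cons]
    refine Fin.cases ?_ (fun a => ?_) a
    · rw [List.getD_append _ _ _ _ (by simpa [hf] using hi)]
      simp
    · have hle : (f 0).length ≤ (a.succ : ℕ) * k + i := by
        rw [hf, Fin.val_succ, add_mul, one_mul]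
        omega
      rw [List.getD_append_right _ _ _ _ hle, ← ih (fun b => f b.succ) (fun b => hf _) a]
      congr 1
      rw [hf, Fin.val_succ, add_mul, one_mul]
      omega

namespace MaxCutProgram

section Encode

variable {n d k N : ℕ} {G : SimpleGraph (Fin n)} {T : RootedTree} (M : TreeModel G d k T)
  (e : T ≃ Fin N)

/-- The table of the parents. -/
noncomputable def parTable : ℕ → ℕ := fun a => (M.encode e).getD (5 + n * n + a) 0
/-- The table of the leaves. -/
noncomputable def leafTable : ℕ → ℕ := fun v => (M.encode e).getD (5 + n * n + N + v) 0
/-- The table of the labels. -/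
noncomputable def labTable : ℕ → ℕ := fun v => (M.encode e).getD (5 + n * n + N + n + v) 0
/-- The table of the renaming functions. -/
noncomputable def renTable : ℕ → ℕ → ℕ := fun a i => (M.encode e).getD (5 + n * n + N + n + n + a * k + i) 0
/-- The table of the matrices. -/
noncomputable def matTable : ℕ → ℕ → ℕ := fun a i =>
  (M.encode e).getD (5 + n * n + N + n + n + N * k + a * (k * k) + i) 0

theorem length_encodeGraph : (encodeGraph G).length = n * n :=
  List.length_flatten_ofFn _ fun _ => by simp

theorem tables_encode : Tables M.toLabelledTree e (parTable M e) (leafTable M e) (labTable M e)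
    (renTable M e) (matTable M e) where
  par a := by
    rw [parTable, TreeModel.encode]
    simp only [List.append_assoc]
    rw [← List.append_assoc, ← List.append_assoc, List.getD_append_middle _ _ _ _
      (by simp [length_encodeGraph]; omega) (by simp), List.getD_ofFn]
    simp
  leaf v := by
    rw [leafTable, TreeModel.encode]
    simp only [List.append_assoc]
    rw [← List.append_assoc, ← List.append_assoc, ← List.append_assoc, List.getD_append_middle _ _ _ _
      (by simp [length_encodeGraph]; omega) (by simp), List.getD_ofFn]
  lab v := by
    rw [labTable, TreeModel.encode]
    simp only [List.append_assoc]
    rw [← List.append_assoc, ← List.append_assoc, ← List.append_assoc, ← List.append_assoc,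
      List.getD_append_middle _ _ _ _ (by simp [length_encodeGraph]; omega) (by simp),
      List.getD_ofFn]
  ren a i := by
    have hlen : ((e a : ℕ) * k + i) < N * k := by
      calc (e a : ℕ) * k + i < (e a + 1) * k := by rw [add_mul, one_mul]; omega
        _ ≤ N * k := Nat.mul_le_mul_right _ (e a).2
    rw [renTable, TreeModel.encode, add_assoc _ ((e a : ℕ) * k)]
    simp only [List.append_assoc]
    rw [← List.append_assoc, ← List.append_assoc, ← List.append_assoc, ← List.append_assoc,
      ← List.append_assoc,
      List.getD_append_middle _ _ _ _ (by simp [length_encodeGraph]; omega)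
        (by rwa [List.length_flatten_ofFn (k := k) _ fun _ => by simp]),
      List.getD_flatten_ofFn (k := k) _ (fun _ => by simp) _ _ i.2, List.getD_ofFn]
    simp
  mat a i j := by
    have hij : (i : ℕ) * k + j < k * k := by
      calc (i : ℕ) * k + j < (i + 1) * k := by rw [add_mul, one_mul]; omega
        _ ≤ k * k := Nat.mul_le_mul_right _ i.2
    have hlen : ((e a : ℕ) * (k * k) + (i * k + j)) < N * (k * k) := by
      calc (e a : ℕ) * (k * k) + (i * k + j) < (e a + 1) * (k * k) := by
            rw [add_mul, one_mul]; omega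
        _ ≤ N * (k * k) := Nat.mul_le_mul_right _ (e a).2
    rw [matTable, TreeModel.encode, add_assoc _ ((e a : ℕ) * (k * k)), ← List.append_nil (_ ++ _)]
    rw [List.getD_append_middle _ _ _ _
      (by
        simp only [List.length_append, length_encodeGraph, List.length_ofFn, List.length_cons,
          List.length_nil]
        rw [List.length_flatten_ofFn (k := k) _ fun _ => by simp]) (by
        rwa [List.length_flatten_ofFn (k := k * k) _ fun _ =>
          List.length_flatten_ofFn _ fun _ => by simp]),
      List.getD_flatten_ofFn (k := k * k) _ (fun _ => List.length_flatten_ofFn _ fun _ => by simp)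
        _ _ hij,
      List.getD_flatten_ofFn (k := k) _ (fun _ => by simp) _ _ j.2, List.getD_ofFn]
    simp

/-- The tables are defined by reading the input, so the addresses agree by `rfl`. Only the ranges of
the entries need an argument, and `tables_encode` provides it. -/
theorem input_encode : Input (M.encode e) n k N (e ⊥) (parTable M e) (leafTable M e) (labTable M e)
    (renTable M e) (matTable M e) := by
  have hT := tables_encode M e
  have hnode : ∀ a < N, ∃ b : T, (e b : ℕ) = a := fun a ha =>
    ⟨e.symm ⟨a, ha⟩, by rw [e.apply_symm_apply]⟩
  refine ⟨rfl, rfl, rfl, rfl, (e ⊥).2, fun a ha => ⟨rfl, ?_⟩, fun v hv => ⟨rfl, ?_⟩,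
    fun v hv => ⟨rfl, ?_⟩, fun a ha i hi => ⟨rfl, ?_⟩, fun a ha i hi => ⟨rfl, ?_⟩⟩
  · obtain ⟨b, rfl⟩ := hnode a ha
    rw [hT.par]
    exact (e _).2
  · rw [hT.leaf ⟨v, hv⟩]
    exact (e _).2
  · rw [hT.lab ⟨v, hv⟩]
    exact (M.label _).2
  · obtain ⟨b, rfl⟩ := hnode a ha
    rw [hT.ren b ⟨i, hi⟩]
    exact (M.rename _ _).2
  · obtain ⟨b, rfl⟩ := hnode a ha
    have hk : 0 < k := Nat.pos_of_ne_zero (by rintro rfl; simp at hi)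
    have := hT.mat b ⟨i / k, Nat.div_lt_of_lt_mul hi⟩ ⟨i % k, Nat.mod_lt _ hk⟩
    rw [mul_comm, Nat.div_add_mod] at this
    rw [this]
    exact Bool.toNat_le _

end Encode

end MaxCutProgram

/-! ### The size of a tree-model -/

/-- The distance of a node from the root. -/
noncomputable def RootedTree.height {T : RootedTree} (a : T) : ℕ :=
  sInf {m : ℕ | Order.pred^[m] a = ⊥}

theorem RootedTree.pred_iterate_height {T : RootedTree} (a : T) :
    Order.pred^[height a] a = ⊥ :=
  Nat.sInf_mem (s := {m : ℕ | Order.pred^[m] a = ⊥}) bot_le.exists_pred_iterate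

theorem RootedTree.height_eq {T : RootedTree} {a : T} (ha : a ≠ ⊥) :
    height a = height (Order.pred a) + 1 := by
  apply le_antisymm
  · exact Nat.sInf_le (pred_iterate_height (Order.pred a))
  · have h := pred_iterate_height a
    rcases hm : height a with _ | m
    · rw [hm] at h
      exact absurd h ha
    · rw [hm] at h
      exact Nat.succ_le_succ (Nat.sInf_le h)

namespace TreeModel

variable {n d k N : ℕ} {G : SimpleGraph (Fin n)} {T : RootedTree} (M : TreeModel G d k T)

include M

theorem height_le (a : T) : RootedTree.height a ≤ d := Nat.sInf_le (M.depth.1 a)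

theorem exists_leaf_ge [Finite T] (a : T) : ∃ v, a ≤ M.leaf v := by
  obtain ⟨m, ham, hm⟩ := Finite.exists_le_maximal (p := fun _ : T => True) (a := a) trivial
  have hmax : IsMax m := fun b hb => hm.2 trivial hb
  refine ⟨M.leaf.symm ⟨m, hmax⟩, ?_⟩
  rwa [M.leaf.apply_symm_apply]

theorem one_le_card [Finite T] : 1 ≤ n := by
  obtain ⟨v, _⟩ := M.exists_leaf_ge ⊥
  exact v.pos

theorem one_le_labels [Finite T] : 1 ≤ k := by
  obtain ⟨v, _⟩ := M.exists_leaf_ge ⊥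
  exact (M.label v).pos

/-- Every node lies on the path from some leaf to the root, and such a path has at most `d + 1`
nodes. This bounds the addresses in the input. -/
theorem card_le (e : T ≃ Fin N) : N ≤ n * (d + 1) := by
  have : Finite T := .of_equiv _ e.symm
  have hsurj : Function.Surjective fun vm : Fin n × Fin (d + 1) =>
      e (Order.pred^[(vm.2 : ℕ)] (M.leaf vm.1 : T)) := by
    intro b
    obtain ⟨a, rfl⟩ := e.surjective b
    obtain ⟨v, hv⟩ := M.exists_leaf_ge a
    obtain ⟨m, hm⟩ := hv.exists_pred_iterate
    -- After `d` steps the root has been reached, and further steps do not leave it.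
    refine ⟨(v, ⟨min m d, by omega⟩), congrArg e ?_⟩
    rcases le_total m d with h | h
    · simp only [min_eq_left h]
      exact hm
    · simp only [min_eq_right h]
      obtain ⟨j, rfl⟩ := Nat.exists_eq_add_of_le h
      rw [M.depth.1, ← hm, add_comm, Function.iterate_add_apply, M.depth.1]
      exact (Function.iterate_fixed Order.pred_bot j).symm
  simpa using Fintype.card_le_of_surjective _ hsurj

/-- A tree of depth `0` is a single node and has room for one vertex only. Hence `d + 1 ≤ 2 * d` may
be used in the final bounds. -/
theorem one_le_depth (hn : 2 ≤ n) : 1 ≤ d := by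
  by_contra h
  obtain rfl : d = 0 := by omega
  have hbot : ∀ a : T, a = ⊥ := M.depth.1
  have := M.leaf.injective (a₁ := ⟨0, by omega⟩) (a₂ := ⟨1, by omega⟩)
    (Subtype.ext ((hbot _).trans (hbot _).symm))
  simp at this

end TreeModel

/-! ### The bounds -/

namespace MaxCutProgram

/-- The values that occur in the program are less than this number. -/
def valueBound (n d k : ℕ) : ℕ := (n + 2) ^ (30 * (k * (d + 1)))

section Bounds

variable {n d k N : ℕ} {Q : ℕ} (hk : 1 ≤ k)
  (hQ : Q = 2 * ((n + 2) * (n + 2) * (n + 2) * (n + 2)) + 1)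

include hQ

theorem le_pow_five (hn : 1 ≤ n) : Q ≤ (n + 2) ^ 5 := by
  have h1 : 1 ≤ (n + 2) ^ 4 := Nat.one_le_pow _ _ (by omega)
  have h2 : (n + 2) ^ 5 = (n + 2) ^ 4 * (n + 2) := pow_succ _ _
  have h3 : (n + 2) * (n + 2) * (n + 2) * (n + 2) = (n + 2) ^ 4 := by ring
  rw [hQ, h3, h2]
  nlinarith

include hk

/-- A frame consists of `4k + 2` residues, each bounded by `(n + 2) ^ 5`. The constant `30` comes
from `5 * (4 * k + 2) ≤ 30 * k`. -/
theorem stack_le_valueBound (hn : 1 ≤ n) :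
    (Q * Q * Q ^ (k + k + (k + k))) ^ (d + 1) ≤ valueBound n d k := by
  have h := le_pow_five hQ hn
  calc (Q * Q * Q ^ (k + k + (k + k))) ^ (d + 1) = Q ^ ((4 * k + 2) * (d + 1)) := by ring
    _ ≤ ((n + 2) ^ 5) ^ ((4 * k + 2) * (d + 1)) := by gcongr
    _ = (n + 2) ^ (5 * (4 * k + 2) * (d + 1)) := by rw [← pow_mul]; ring_nf
    _ ≤ (n + 2) ^ (30 * k * (d + 1)) := by
        apply Nat.pow_le_pow_right (by omega)
        exact Nat.mul_le_mul_right _ (by omega)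
    _ = valueBound n d k := by rw [valueBound]; ring_nf

/-- Neither `d` nor `k` need be bounded in terms of `n`, but `j < (n + 2) ^ j` absorbs such factors
into the exponent. -/
theorem fits_valueBound (hn : 1 ≤ n) (hN : N ≤ n * (d + 1)) : Fits (valueBound n d k) n k N Q := by
  have hkd : k + d ≤ k * (d + 1) := by nlinarith
  have hpow : ∀ j, j < (n + 2) ^ j := fun j => Nat.lt_pow_self (by omega)
  refine ⟨?_, ?_, ?_⟩
  · have h1 : N ≤ (n + 2) ^ (d + 2) := by
      calc N ≤ n * (d + 1) := hN
        _ ≤ (n + 2) * (n + 2) ^ (d + 1) := Nat.mul_le_mul (by omega) (hpow _).le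
        _ = (n + 2) ^ (d + 2) := by ring
    have h2 : N + N * k + N * (k * k) ≤ (n + 2) ^ (d + 2 * k + 4) := by
      calc N + N * k + N * (k * k) ≤ N * ((k + 1) * (k + 1)) := by nlinarith
        _ ≤ (n + 2) ^ (d + 2) * ((n + 2) ^ (k + 1) * (n + 2) ^ (k + 1)) :=
            Nat.mul_le_mul h1 (Nat.mul_le_mul (hpow _).le (hpow _).le)
        _ = _ := by ring
    have h3 : 5 + n * n + n + n ≤ (n + 2) ^ (d + 2 * k + 4) := by
      calc 5 + n * n + n + n ≤ (n + 2) ^ 3 := by nlinarith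
        _ ≤ _ := Nat.pow_le_pow_right (by omega) (by omega)
    have h4 : 1 ≤ (n + 2) ^ (d + 2 * k + 4) := Nat.one_le_pow _ _ (by omega)
    calc 5 + n * n + N + n + n + N * k + N * (k * k)
        ≤ 2 * (n + 2) ^ (d + 2 * k + 4) := by omega
      _ < (n + 2) * (n + 2) ^ (d + 2 * k + 4) := by nlinarith
      _ = (n + 2) ^ (d + 2 * k + 5) := by ring
      _ ≤ valueBound n d k := Nat.pow_le_pow_right (by omega) (by omega)
  · have h := le_pow_five hQ hn
    calc Q * Q * Q ≤ (n + 2) ^ 5 * (n + 2) ^ 5 * (n + 2) ^ 5 := by gcongr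
      _ = (n + 2) ^ 15 := by ring
      _ ≤ valueBound n d k := Nat.pow_le_pow_right (by omega) (by omega)
  · calc k + k + k + k < 9 * (n + 2) ^ k := by have := hpow k; omega
      _ ≤ (n + 2) ^ 2 * (n + 2) ^ k := Nat.mul_le_mul_right _ (by nlinarith)
      _ = (n + 2) ^ (k + 2) := by ring
      _ ≤ valueBound n d k := Nat.pow_le_pow_right (by omega) (by omega)

end Bounds

/-- The two inequalities used are `n + 2 ≤ n ^ 2` and `d + 1 ≤ 2 * d`; each doubles the exponent. -/
theorem valueBound_le {n d k : ℕ} (hn : 2 ≤ n) (hd : 1 ≤ d) :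
    valueBound n d k ≤ n ^ (120 * (d * k)) := by
  calc valueBound n d k ≤ (n ^ 2) ^ (30 * (k * (d + 1))) := by
        apply Nat.pow_le_pow_left
        nlinarith
    _ = n ^ (60 * (k * (d + 1))) := by rw [← pow_mul]; ring_nf
    _ ≤ n ^ (120 * (d * k)) := by
        apply Nat.pow_le_pow_right (by omega)
        nlinarith [Nat.mul_le_mul_right k hd]

/-- Rounding the logarithm down costs another factor of two, by `Nat.log 2 n + 1 ≤ 2 * Nat.log 2 n`.
-/
theorem size_valueBound_le {n d k : ℕ} (hn : 2 ≤ n) (hd : 1 ≤ d) (hk : 1 ≤ k) :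
    (valueBound n d k).size ≤ 240 * (d * k * Nat.log 2 n) := by
  have hlog : 1 ≤ Nat.log 2 n := Nat.log_pos (by omega) hn
  have hdk : 1 ≤ d * k := Nat.mul_pos hd hk
  rw [Nat.size_le]
  calc valueBound n d k ≤ n ^ (120 * (d * k)) := valueBound_le hn hd
    _ < (2 ^ (Nat.log 2 n + 1)) ^ (120 * (d * k)) :=
        Nat.pow_lt_pow_left (Nat.lt_pow_succ_log_self (by omega) n) (by omega)
    _ = 2 ^ ((Nat.log 2 n + 1) * (120 * (d * k))) := (pow_mul _ _ _).symm
    _ ≤ 2 ^ (240 * (d * k * Nat.log 2 n)) := by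
        apply Nat.pow_le_pow_right (by omega)
        nlinarith

/-- The register of a variable. -/
def Reg.index : Reg → ℕ
  | .ans => 0 | .p => 1 | .u => 2 | .q => 3 | .v => 4 | .tot => 5 | .y => 6
  | .S => 7 | .A => 8 | .R => 9 | .G => 10 | .B => 11 | .C => 12 | .mode => 13
  | .t => 14 | .i => 15 | .e => 16 | .a => 17 | .b => 18

theorem Reg.index_injective : Function.Injective Reg.index := by
  intro r r' h
  cases r <;> cases r' <;> first | rfl | cases h

theorem Reg.index_lt (r : Reg) : r.index < 19 := by
  cases r <;> decide

end MaxCutProgram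

open MaxCutProgram

theorem theorem2 :
    ∃ (P : RAM.Program) (c : ℕ),
      ∀ (n d k N : ℕ) (G : SimpleGraph (Fin n)) (T : RootedTree) (M : TreeModel G d k T)
        (e : T ≃ Fin N),
        ∃ t : ℕ, P.HaltsWith (M.encode e) t (maxCut G) ∧
          (2 ≤ n →
            P.time (M.encode e) t ≤ n ^ (c * (d * k)) ∧
            P.space (M.encode e) t ≤ c * (d * k * Nat.log 2 n)) := by
  obtain ⟨P, K, hP⟩ := RAM.Cmd.exists_program Reg.index_injective Reg.index_lt
    (out := Reg.ans) rfl main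
  -- `K` depends only on the compiled program; the time needs `120 * K` and the space `240 * K`.
  refine ⟨P, 240 * K, fun n d k N G T M e => ?_⟩
  have hfin : Finite T := .of_equiv _ e.symm
  have := Fintype.ofFinite T
  have hn := M.one_le_card
  have hk := M.one_le_labels
  have hB := fits_valueBound (d := d) hk rfl hn (M.card_le e)
  have hmain := runs_main (height := RootedTree.height) (input_encode M e) (tables_encode M e)
    (fun c hc => RootedTree.height_eq hc) M.height_le hn rfl hB (stack_le_valueBound hk rfl hn)
  obtain ⟨t, h1, h2, h3⟩ := hP _ _ _ hB.two_le
    (hmain fun _ => show 0 < valueBound n d k by have := hB.two_le; omega)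
  refine ⟨t, sup_detected hn G ▸ h1, fun hn2 => ?_⟩
  have hd := M.one_le_depth hn2
  constructor
  · calc P.time (M.encode e) t ≤ (n ^ (120 * (d * k))) ^ K :=
          h2.trans (Nat.pow_le_pow_left (valueBound_le hn2 hd) K)
      _ = n ^ (120 * K * (d * k)) := by rw [← pow_mul]; ring_nf
      _ ≤ n ^ (240 * K * (d * k)) := Nat.pow_le_pow_right (by omega) (by gcongr; omega)
  · calc P.space (M.encode e) t ≤ K * (240 * (d * k * Nat.log 2 n)) :=
          h3.trans (Nat.mul_le_mul_left K (size_valueBound_le hn2 hd hk))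
      _ = 240 * K * (d * k * Nat.log 2 n) := by ring
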